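/- **Setting.** Let $p$ be a prime, $\mathbb F_q$ a finite field of characteristic $p$, $N\ge 1$ an integer prime to $p$ such that $\mathbb F_q$ contains a primitive $N$-th root of unity, $K=\mathrm{Frac}(W(\mathbb F_q))$ with its $p$-adic absolute value, $\xi\in K$ a primitive $N$-th root of unity, $z_j=\xi^j$ ($1\le j\le N$, or $j \in \mathbb Z/N$). Let $A$ be a complete ultrametric normed commutative $K$-algebra. Let $A\langle\langle e_Z\rangle\rangle$ be the algebra of non-commutative power series $f=\sum_w f[w]\,w$ in the letters $e_0,e_{z_1},\dots,e_{z_N}$; the weight of a word is its number of letters, its depth the number of its letters different from $e_0$. *The group.* Let $\tilde\Pi_{1,0}(A)_\Sigma$ be the set of series $g$ with $g[\emptyset]=1$ which satisfy the shuffle equation $g[w]g[w']=g[w\,\text{ш}\,w']$, with $g[e_0]=g[e_1]=0$, and such that for each $d\ge1$, $\sup\{|g[w]| : w \text{ of weight } s \text{ and depth } d\}\to0$ as $s\to\infty$. Let $G(A)=\{g^{-1}e_1g : g\in\tilde\Pi_{1,0}(A)_\Sigma\}$. For a series $u$ without constant term and a series $f$ put $u\circ_{\mathrm{Ad}}f=f(e_0,u^{(z_1)},\dots,u^{(z_N)})$,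 where $u^{(z_j)}$ is obtained from $u$ by $e_0\mapsto e_0$, $e_{z_i}\mapsto e_{z_jz_i}$. *The action.* Let $A\langle\langle e_Z\rangle\rangle_{\mathrm{har}}$ be the set of series $f$ such that $l\mapsto f[e_0^lw]$ is constant for every word $w$. For $n\ge1$ and $u=g^{-1}e_1g\in G(A)$ let $u_n=(\tau(n)g)^{-1}e_1(\tau(n)g)$, where $\tau(n)$ multiplies the coefficient of each word $w$ by $n^{\mathrm{weight}(w)}$; thus $u_n[w]=n^{\mathrm{weight}(w)-1}u[w]$ for $w\neq\emptyset$. For $S\subset\mathbb N^*$ the harmonic Ihara action on $\mathrm{Map}(S,A\langle\langle e_Z\rangle\rangle_{\mathrm{har}})$ is $$(u\circ_{\mathrm{har}}h)_n[w]=\lim_{l\to\infty}(u_n\circ_{\mathrm{Ad}}h_n)[e_0^lw].$$ *The harmonic sequence.* For $n,s_1,\dots,s_d\ge1$ and $j_1,\dots,j_{d+1}\in\mathbb Z/N$ let $$\mathrm{har}_n\binom{z_{j_{d+1}},\dots,z_{j_1}}{s_d,\dots,s_1}=n^{s_1+\dots+s_d}\sum_{0<m_1<\dots<m_d<n}\frac{(z_{j_2}/z_{j_1})^{m_1}\cdots(z_{j_{d+1}}/z_{j_d})^{m_d}\,(1/z_{j_{d+1}})^n}{m_1^{s_1}\cdots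 m_d^{s_d}} .$$ We write $\mathrm{har}_S$ for any $h\in\mathrm{Map}(S,A\langle\langle e_Z\rangle\rangle_{\mathrm{har}})$ whose coefficient $h_n[e_{z_{j_{d+1}}}e_0^{s_d-1}e_{z_{j_d}}\cdots e_0^{s_1-1}e_{z_{j_1}}]$ is the number above for all $n\in S$ and all $d\ge 0$, $j$, $s$ (the coefficients at words ending with $e_0$, which index no multiple harmonic sum, may be arbitrary, for instance $0$). *The independence set.* Let $\mathcal E0_S$ be the set of those $h\in\mathrm{Map}(S,A\langle\langle e_Z\rangle\rangle_{\mathrm{har}})$ for which the $N$ functions $n\in S\mapsto h_n[e_{z_i}]$ are linearly independent over the ring of rigid analytic functions on $\mathbb Z_p$, i.e. of the power series $\sum_k a_kn^k$ with $a_k\in A$, $a_k\to0$. **Proposition.** Assume that $N=1$ or $N$ is prime. i) Let $S\subset\mathbb N^*$ contain a sequence that tends $p$-adically to $0$. Then $G(A)$ is a group for $\circ_{\mathrm{Ad}}$, the limits above exist, and $\circ_{\mathrm{har}}$ is an action of $G(A)$ on $\mathrm{Map}(S,A\langle\langle e_Z\rangle\rangle_{\mathrm{har}})$. The set $\mathcal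 E0_S$ is stable and the action is free on it; if $N=1$, it contains every $\mathrm{har}_S$. Sequences $\mathrm{har}_S$ exist, and, for $N=1$ or $N$ prime, there is a stable subset of $\mathrm{Map}(S,A\langle\langle e_Z\rangle\rangle_{\mathrm{har}})$ which contains $\mathcal E0_S$ and every $\mathrm{har}_S$ and on which the action is free. In particular, the orbit of $\mathrm{har}_S$ is a torsor under $G(A)$ (it is non-empty, stable, and $G(A)$ acts on it simply transitively). ii) In particular, for $A=K$ and $S=q^{\mathbb N}=\{q^a : a\in\mathbb N\}$, the orbit of $\mathrm{har}_{q^{\mathbb N}}$ in $\mathrm{Map}(q^{\mathbb N},K\langle\langle e_Z\rangle\rangle_{\mathrm{har}})$ is a torsor under $G(K)$. -/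

import Mathlib

open Filter Topology

namespace HarmonicIhara

/-! ### Non-commutative series over the alphabet `e_0, e_{z_1}, …, e_{z_N}` -/

/-- The alphabet: `none` is `e_0`, and `some j` is `e_{z_j}`, where `z_j = ξ ^ j`, `j ∈ ℤ/N`.
In particular `some 0` is `e_1`. -/
abbrev Letter (N : ℕ) := Option (ZMod N)

abbrev Word (N : ℕ) := List (Letter N)

/-- The number of letters different from `e_0`; the weight of a word is its length. -/
def depth {N : ℕ} (w : Word N) : ℕ := w.countP Option.isSome

/-- `A⟨⟨e_Z⟩⟩`: a series is the family of its coefficients, `f w` is `f[w]`. -/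
abbrev Series (N : ℕ) (A : Type*) := Word N → A

section Ring

variable {N : ℕ} {A : Type*} [CommRing A]

def one : Series N A := fun w => if w = [] then 1 else 0

/-- The series consisting of one letter. -/
def letter (a : Letter N) : Series N A := fun w => if w = [a] then 1 else 0

/-- The (concatenation) product of series. -/
def mul (f g : Series N A) : Series N A := fun w =>
  ∑ i ∈ Finset.range (w.length + 1), f (w.take i) * g (w.drop i)

/-- All the shuffles of two words, listed with multiplicity. -/
def shuffles {α : Type*} : List α → List α → List (List α)
  | [], v => [v]
  | a :: u, [] => [a :: u]
  | a :: u, b :: v =>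
      (shuffles u (b :: v)).map (fun w => a :: w) ++ (shuffles (a :: u) v).map (fun w => b :: w)
  termination_by u v => u.length + v.length

/-- The points of `Π_{1,0}` with values in `A`: the series that satisfy the shuffle equation. -/
def IsPiPoint (f : Series N A) : Prop :=
  f [] = 1 ∧ ∀ w w' : Word N, f w * f w' = ((shuffles w w').map f).sum

/-- Direct image under the rotation `x ↦ z_j x`: the letter `e_{z_i}` is replaced by
`e_{z_j z_i}`, and `e_0` is fixed. -/
def rotate (j : ZMod N) (f : Series N A) : Series N A := fun w =>
  f (w.map (Option.map (fun i => i - j)))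

/-- The image of a word under the substitution `e_0 ↦ e_0`, `e_{z_j} ↦ rotate j u`. -/
def substWord (u : Series N A) : Word N → Series N A
  | [] => one
  | none :: v => mul (letter none) (substWord u v)
  | some j :: v => mul (rotate j u) (substWord u v)

/-- The adjoint Ihara product
`u ∘_Ad f = f (e_0, u^{(z_1)}, …, u^{(z_N)})`, with `u^{(z_j)} = rotate j u`.
It is used for series `u` without constant term; a word `v` longer than `w` then does not
contribute to the coefficient of `w`, so the sum runs over the words of length at most that
of `w`. For `u = g'⁻¹ e_1 g'` and `f = g⁻¹ e_1 g` it is `(g' ∘ g)⁻¹ e_1 (g' ∘ g)`,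
with `∘` the Ihara product. -/
def adIhara [NeZero N] (u f : Series N A) : Series N A := fun w =>
  ∑ m ∈ Finset.range (w.length + 1), ∑ v : Fin m → Letter N,
    f (List.ofFn v) * substWord u (List.ofFn v) w

/-- If `u = g⁻¹ e_1 g`, then this is `(τ(n) g)⁻¹ e_1 (τ(n) g)`, where `τ(n)` multiplies the
coefficient of each word `w` by `n ^ weight w`. The exponent is `weight w - 1` because `e_1`
itself is not rescaled (and `u` has no constant term). -/
def tauAd (n : ℕ) (u : Series N A) : Series N A := fun w => (n : A) ^ (w.length - 1) * u w

/-- `A⟨⟨e_Z⟩⟩_har` in the De Rham-rational version: the series `f` such that the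
sequence `l ↦ f[e_0 ^ l w]` is constant, for all words `w`. -/
abbrev HarSpace (N : ℕ) (A : Type*) :=
  {f : Series N A // ∀ (l : ℕ) (w : Word N), f (List.replicate l none ++ w) = f w}

end Ring

section Normed

variable {N : ℕ} {A : Type*} [NormedCommRing A]

/-- `Π̃_{1,0}(A)_Σ`: points `g` of `Π_{1,0}` with `g[e_0] = g[e_1] = 0` whose coefficients
of each fixed depth `d ≥ 1` tend to `0` when the weight tends to infinity. -/
def IsPiTildeSigma (g : Series N A) : Prop :=
  IsPiPoint g ∧ g [none] = 0 ∧ g [some 0] = 0 ∧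
    ∀ d : ℕ, 1 ≤ d → ∀ ε : ℝ, 0 < ε → ∃ s₀ : ℕ, ∀ w : Word N,
      s₀ ≤ w.length → depth w = d → ‖g w‖ < ε

/-- `Ad_{Π̃_{1,0}(A)_Σ}(e_1)`: the series `u = g⁻¹ e_1 g`, for `g` in `Π̃_{1,0}(A)_Σ`
(the series `g` is invertible, because `g[∅] = 1`). -/
abbrev AdGroup (N : ℕ) (A : Type*) [NormedCommRing A] :=
  {u : Series N A // ∃ g : Series N A, IsPiTildeSigma g ∧ mul g u = mul (letter (some 0)) g}

/-- The group law on `AdGroup N A` is the adjoint Ihara product, and the group acts on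
`Map(S, A⟨⟨e_Z⟩⟩_har)` by the harmonic Ihara action
`(u ∘_har h)_n = lim (τ(n)(u) ∘_Ad h_n)`, where `(lim f)[w] = lim_{l → ∞} f[e_0 ^ l w]`
(that the limit exists is part of the definition). -/
def IsHarmonicIharaAction (N : ℕ) [NeZero N] (A : Type*) [NormedCommRing A] (S : Set ℕ)
    [Group (AdGroup N A)] [MulAction (AdGroup N A) (S → HarSpace N A)] : Prop :=
  (∀ u v : AdGroup N A, (u * v).val = adIhara u.val v.val) ∧
  ∀ (u : AdGroup N A) (h : S → HarSpace N A) (n : S) (w : Word N),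
    Tendsto (fun l : ℕ => adIhara (tauAd n u.val) (h n).val (List.replicate l none ++ w))
      atTop (𝓝 (((u • h) n).val w))

/-- The sequences `(h_n)_{n ∈ S}` such that the functions `n ↦ h_n[e_{z_i}]`, for the `N` letters
`e_{z_i}`, are linearly independent over the ring of rigid analytic functions
`n ↦ ∑ k, a_k n ^ k`, `a_k → 0`, on `ℤ_p`. -/
def IndepSet (N : ℕ) [NeZero N] (A : Type*) [NormedCommRing A] (S : Set ℕ) :
    Set (S → HarSpace N A) :=
  {h | ∀ a : ZMod N → ℕ → A, (∀ i, Tendsto (a i) atTop (𝓝 0)) →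
    (∀ n : S, ∑ i, (∑' k, a i k * (n : A) ^ k) * (h n).val [some i] = 0) → ∀ i k, a i k = 0}

end Normed

/-! ### Weighted multiple harmonic sums -/

/-- The weighted multiple harmonic sum
`n ^ (s_d + … + s_1) ∑_{0 < m_1 < … < m_d < n} (z_{j_2} / z_{j_1}) ^ m_1 ⋯
  (z_{j_{d+1}} / z_{j_d}) ^ m_d (1 / z_{j_{d+1}}) ^ n / (m_1 ^ s_1 ⋯ m_d ^ s_d)`,
where `z_j = ξ ^ j`. The indices are shifted by one: `j i` and `s i` are `j_{i+1}` and
`s_{i+1}`. -/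
def har {N : ℕ} {K : Type*} [Field K] (ξ : K) (n : ℕ) {d : ℕ} (j : Fin (d + 1) → ZMod N)
    (s : Fin d → ℕ) : K :=
  (n : K) ^ (∑ i, s i) *
    ∑ m ∈ (Fintype.piFinset fun _ : Fin d => Finset.Ioo 0 n).filter
        (fun m => ∀ a b, a < b → m a < m b),
      (∏ i, (ξ ^ (j i.succ).val / ξ ^ (j i.castSucc).val) ^ (m i) / (m i : K) ^ (s i)) *
        (1 / ξ ^ (j (Fin.last d)).val) ^ n

/-- The word `e_{z_{j_{d+1}}} e_0^{s_d - 1} e_{z_{j_d}} ⋯ e_0^{s_1 - 1} e_{z_{j_1}}`. -/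
def harmonicWord {N d : ℕ} (j : Fin (d + 1) → ZMod N) (s : Fin d → ℕ) : Word N :=
  some (j (Fin.last d)) ::
    (List.ofFn fun i : Fin d =>
      List.replicate (s i.rev - 1) none ++ [some (j i.rev.castSucc)]).flatten

/-- `h` is (an extension to all words of) the sequence `har_S`: the coefficients of `h_n` at the
words that index multiple harmonic sums are the weighted multiple harmonic sums of upper
bound `n`. The words that end with `e_0` index no multiple harmonic sum, and the coefficients
there are arbitrary, for instance zero. -/
def IsHarmonicSequence {N : ℕ} {K A : Type*} [Field K] [CommRing A] [Algebra K A] (ξ : K)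
    {S : Set ℕ} (h : S → HarSpace N A) : Prop :=
  ∀ (n : S) (d : ℕ) (j : Fin (d + 1) → ZMod N) (s : Fin d → ℕ), (∀ i, 1 ≤ s i) →
    (h n).val (harmonicWord j s) = algebraMap K A (har ξ n j s)

/-! ### Stable subsets, freeness, torsors -/

section Action

variable (G : Type*) [Group G] {X : Type*} [MulAction G X]

def IsStable (E : Set X) : Prop := ∀ g : G, ∀ x ∈ E, g • x ∈ E

/-- The action of `G` has trivial stabilizers at the points of `E`. -/
def IsFreeOn (E : Set X) : Prop := ∀ x ∈ E, ∀ g : G, g • x = x → g = 1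

/-- `E` is a torsor under `G`: it is non-empty and stable, and `G` acts on it simply
transitively. -/
def IsTorsor (E : Set X) : Prop :=
  E.Nonempty ∧ IsStable G E ∧ ∀ x ∈ E, ∀ y ∈ E, ∃! g : G, g • x = y

end Action

end HarmonicIhara

open HarmonicIhara

/-! Everything is filtered by depth, the number of letters other than e_0. A series u = g⁻¹ e_1 g
equals e_1 in depth at most 1, is primitive for the coproduct dual to the shuffle product, and its
coefficients of bounded depth tend to 0 (`IsAd`). Hence the substitution e_{z_j} ↦ u^{(z_j)} is
unitriangular for the depth, so it is injective and inverted by a Neumann series that is finite at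
each word.

The group. Substituting primitive series commutes with the coproduct (`coprod_subst`), so group-like
series stay group-like; by injectivity in both tensor factors the converse holds too
(`isGroupLike_of_ihara`). Together with the stability of null series this gives products and
inverses (`ihara_mem_adSet`, `exists_ihara_eq_X`).

The action. If f ignores leading e_0's, the coefficient of u ∘ f at e_0^l w, for w beginning with a
letter other than e_0, is a finite combination of partial sums ∑_{k ≤ l} u^{(z_j)}[e_0^k w']
(`ihara_replicate_append`), which converge because u is null. Substitution preserves convergence to
0 along e_0^l w (`tendsto_ihara_zero`), so iterated limits compose and the action law follows.

Freeness. Let u fix h and agree with e_1 up to depth D ≥ 1. By primitivity it suffices to kill the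
coefficients of u at e_0^r y, with y = e_{z_i} x e_{z_l} of depth D + 1 (`AgreesUpTo.succ`); then
one inducts on D. On the independence set, the fixed point equation at y says, after division by a
power of n, that ∑_j (∑_k u^{(z_j)}[e_0^k y] n^k) h_n[e_{z_j}] = 0, and independence concludes.

For har_S the functions h_n[e_{z_j}] = z_j^{-n} may be dependent: on powers of q they are constant,
as N divides q - 1. The equation is then read one depth higher, at e_{z_{i₀}} e_0^a y
(`stabilizer_eq`). There c_j = u^{(z_j)}[e_0^r y] is paired with the sums ∑_{m<n} (z_{i₀}/z_j)^m
m^{-s}, and for n ≤ p^{ρ+1} all other terms are O(p^{ρ(s-1)}) after removal of a common power of n.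
A Fourier transform in i₀ turns the pairing into ĉ(b) times N ∑_{m ≡ b mod N} m^{-s}. For s = φ(p^M)
and p^ρ < n this sum has size p^{ρs} up to a constant (`le_norm_sum_class`): by Euler's theorem its
terms of maximal pole are congruent to each other, so they cannot cancel too much. As S is
unbounded, ĉ = 0, hence c = 0. -/

namespace HarmonicIhara

/-! ### The ring of non-commutative series -/

/-- Non-commutative series over the alphabet `α` with coefficients in `R`, with the
concatenation product. -/
def NCSeries (α R : Type*) := List α → R

namespace NCSeries

variable {α R : Type*}

/-- The series of the coefficients of the words that begin with `a`. -/
def tail (a : α) (f : NCSeries α R) : NCSeries α R := fun w => f (a :: w)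

/-- The series with the single coefficient `m` at the empty word. -/
def const [Zero R] (m : R) : NCSeries α R := fun w => match w with
  | [] => m
  | _ :: _ => 0

@[simp] theorem tail_apply (a : α) (f : NCSeries α R) (w : List α) : f.tail a w = f (a :: w) := rfl

@[ext] theorem ext {f g : NCSeries α R} (h : ∀ w, f w = g w) : f = g := funext h

theorem ext_tail {f g : NCSeries α R} (h0 : f [] = g []) (h : ∀ a, f.tail a = g.tail a) :
    f = g := by
  ext w
  cases w with
  | nil => exact h0
  | cons a w => exact congrFun (h a) w

section Ring

variable [Ring R]

instance : AddCommGroup (NCSeries α R) := inferInstanceAs (AddCommGroup (List α → R))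

instance : Mul (NCSeries α R) :=
  ⟨fun f g w => ∑ i ∈ Finset.range (w.length + 1), f (w.take i) * g (w.drop i)⟩

instance : One (NCSeries α R) := ⟨const 1⟩

theorem mul_apply (f g : NCSeries α R) (w : List α) :
    (f * g) w = ∑ i ∈ Finset.range (w.length + 1), f (w.take i) * g (w.drop i) := rfl

@[simp] theorem zero_apply (w : List α) : (0 : NCSeries α R) w = 0 := rfl
@[simp] theorem add_apply (f g : NCSeries α R) (w : List α) : (f + g) w = f w + g w := rfl
@[simp] theorem sub_apply (f g : NCSeries α R) (w : List α) : (f - g) w = f w - g w := rfl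
@[simp] theorem neg_apply (f : NCSeries α R) (w : List α) : (-f) w = -f w := rfl
@[simp] theorem one_nil : (1 : NCSeries α R) [] = 1 := rfl
@[simp] theorem one_cons (a : α) (w : List α) : (1 : NCSeries α R) (a :: w) = 0 := rfl
@[simp] theorem const_nil (m : R) : (const m : NCSeries α R) [] = m := rfl
@[simp] theorem const_cons (m : R) (a : α) (w : List α) : (const m : NCSeries α R) (a :: w) = 0 :=
  rfl
@[simp] theorem tail_one (a : α) : (1 : NCSeries α R).tail a = 0 := rfl
@[simp] theorem tail_add (a : α) (f g : NCSeries α R) : (f + g).tail a = f.tail a + g.tail a := rfl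
@[simp] theorem tail_const (a : α) (m : R) : (const m : NCSeries α R).tail a = 0 := rfl

@[simp] theorem sum_apply {ι : Type*} (s : Finset ι) (f : ι → NCSeries α R) (w : List α) :
    (∑ i ∈ s, f i) w = ∑ i ∈ s, f i w := Finset.sum_apply w s f

@[simp] theorem mul_nil (f g : NCSeries α R) : (f * g) [] = f [] * g [] := by
  simp [mul_apply]

theorem mul_cons (f g : NCSeries α R) (a : α) (w : List α) :
    (f * g) (a :: w) = f [] * g (a :: w) + (f.tail a * g) w := by
  rw [mul_apply, List.length_cons, Finset.sum_range_succ', add_comm]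
  simp [mul_apply]

@[simp] theorem const_mul_apply (m : R) (f : NCSeries α R) (w : List α) :
    (const m * f : NCSeries α R) w = m * f w := by
  cases w with
  | nil => simp
  | cons a w => rw [mul_cons, tail_const]; simp [mul_apply]

instance : Ring (NCSeries α R) where
  __ := (inferInstance : AddCommGroup (NCSeries α R))
  left_distrib f g h := by ext w; simp [mul_apply, mul_add, Finset.sum_add_distrib]
  right_distrib f g h := by ext w; simp [mul_apply, add_mul, Finset.sum_add_distrib]
  zero_mul f := by ext w; simp [mul_apply]
  mul_zero f := by ext w; simp [mul_apply]
  mul_assoc f g h := by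
    ext w
    induction w generalizing f with
    | nil => simp [mul_assoc]
    | cons a w ih =>
      -- Removing the first letter obeys a Leibniz rule twisted by the constant term; this is what
      -- makes the induction on the word close, for all `f` at once.
      have key : (f * g).tail a = const (f []) * g.tail a + f.tail a * g := by
        ext v
        simp only [tail_apply, mul_cons f, add_apply, const_mul_apply]
      have hc : (const (f []) * g.tail a * h : NCSeries α R) w = f [] * (g.tail a * h) w := by
        simp only [mul_apply (const _ * _), const_mul_apply, mul_assoc, ← Finset.mul_sum]
        rfl
      have hd : ((const (f []) * g.tail a + f.tail a * g) * h : NCSeries α R) w =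
          (const (f []) * g.tail a * h : NCSeries α R) w + (f.tail a * g * h) w := by
        simp only [mul_apply _ h, add_apply, add_mul, Finset.sum_add_distrib]
      rw [mul_cons, key, hd, hc, ih, mul_cons f, mul_cons g, mul_nil, mul_add]
      simp only [mul_assoc, add_assoc]
  one_mul f := by
    ext w
    cases w with
    | nil => simp
    | cons a w => rw [mul_cons, tail_one]; simp [mul_apply]
  mul_one f := by
    ext w
    induction w generalizing f with
    | nil => simp
    | cons a w ih => rw [mul_cons, ih]; simp

theorem tail_mul (a : α) (f g : NCSeries α R) :
    (f * g).tail a = const (f []) * g.tail a + f.tail a * g := by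
  ext w; rw [tail_apply, mul_cons, add_apply, const_mul_apply]; rfl

/-- The series consisting of one letter. -/
def X [DecidableEq α] (a : α) : NCSeries α R := fun w => if w = [a] then 1 else 0

@[simp] theorem X_nil [DecidableEq α] (a : α) : (X a : NCSeries α R) [] = 0 := by simp [X]

theorem tail_X [DecidableEq α] (a b : α) : (X a : NCSeries α R).tail b = if b = a then 1 else 0 := by
  ext w
  cases w <;> by_cases h : b = a <;> simp [X, h]

theorem X_mul_cons [DecidableEq α] (a b : α) (f : NCSeries α R) (w : List α) :
    (X a * f : NCSeries α R) (b :: w) = if b = a then f w else 0 := by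
  rw [mul_cons, tail_X]; by_cases h : b = a <;> simp [h]

theorem tail_X_mul [DecidableEq α] (a b : α) (f : NCSeries α R) :
    (X a * f : NCSeries α R).tail b = if b = a then f else 0 := by
  ext w; rw [tail_apply, X_mul_cons]; split <;> rfl

end Ring

section Algebra

variable {A M : Type*} [CommRing A] [Ring M] [Algebra A M]

instance : Module A (NCSeries α M) := inferInstanceAs (Module A (List α → M))

@[simp] theorem smul_apply (a : A) (f : NCSeries α M) (w : List α) : (a • f) w = a • f w := rfl

instance : Algebra A (NCSeries α M) :=
  Algebra.ofModule
    (fun r x y => by ext w; simp [mul_apply, Finset.smul_sum])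
    (fun r x y => by ext w; simp [mul_apply, Finset.smul_sum])

/-- Extension of the coefficients. -/
def extend (M : Type*) [Ring M] [Algebra A M] (f : NCSeries α A) : NCSeries α M :=
  fun w => algebraMap A M (f w)

@[simp] theorem extend_apply (f : NCSeries α A) (w : List α) :
    extend M f w = algebraMap A M (f w) := rfl

theorem extend_mul (f g : NCSeries α A) : extend M (f * g) = extend M f * extend M g := by
  ext w; simp [mul_apply]

theorem extend_one : extend M (1 : NCSeries α A) = 1 := by
  ext w; cases w <;> simp

theorem const_mul (m m' : M) : (const (m * m') : NCSeries α M) = const m * const m' := by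
  ext w; cases w <;> simp

/-- The scalars are central in `M`. For `M` a ring of series this says that the two tensor factors
commute with each other. -/
theorem extend_mul_const_comm (f : NCSeries α A) (m : M) :
    extend M f * const m = const m * extend M f := by
  ext w
  rw [const_mul_apply]
  induction w generalizing f with
  | nil => simpa using Algebra.commutes _ _
  | cons a w ih =>
    have := ih (f.tail a)
    rw [mul_cons, const_cons, mul_zero, zero_add]
    exact this

end Algebra

/-! ### Substitutions -/

section Subst

variable {A 𝓑 𝓒 : Type*} [CommRing A] [Ring 𝓑] [Algebra A 𝓑] [Ring 𝓒] [Algebra A 𝓒] [Fintype α]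

/-- `φ` satisfies the recursion that characterizes the substitution of the `T a` to the letters. -/
def IsSubst (T : α → 𝓑) (φ : NCSeries α A → 𝓑) : Prop :=
  ∀ f, φ f = f [] • 1 + ∑ a, T a * φ (f.tail a)

/-- The family `T` is topologically nilpotent, in an algebraic form. -/
def Contracting (T : α → 𝓑) : Prop :=
  ∀ E : Set 𝓑, (∀ x ∈ E, ∃ y : α → 𝓑, (∀ a, y a ∈ E) ∧ x = ∑ a, T a * y a) → ∀ x ∈ E, x = 0

/-- Each `T a` uses up at least one letter, so a coefficient is expressed through coefficients at
shorter words. -/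
theorem contracting_of_nil [Ring R] {T : α → NCSeries α R} (hT : ∀ a, T a [] = 0) :
    Contracting T := by
  intro E hE x hx
  ext w
  induction h : w.length using Nat.strong_induction_on generalizing w x with
  | _ n ih =>
    obtain ⟨y, hy, rfl⟩ := hE x hx
    rw [sum_apply, zero_apply]
    refine Finset.sum_eq_zero fun a _ => ?_
    rw [mul_apply]
    refine Finset.sum_eq_zero fun i hi => ?_
    by_cases h0 : i = 0
    · simp [h0, hT]
    · by_cases hw : w = []
      · simp [hw, hT]
      · have hl : 0 < w.length := List.length_pos_iff.2 hw
        rw [ih (w.drop i).length (by rw [List.length_drop]; omega) _ (hy a) _ rfl]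
        simp

/-- Here `T a` may use up letters in only one of the two words, so the induction is on the total
length. -/
theorem contracting_of_nil_nil [Ring R] {T : α → NCSeries α (NCSeries α R)}
    (hT : ∀ a, T a [] [] = 0) : Contracting T := by
  intro E hE x hx
  ext w w'
  induction h : w.length + w'.length using Nat.strong_induction_on generalizing w w' x with
  | _ n ih =>
    obtain ⟨y, hy, rfl⟩ := hE x hx
    rw [sum_apply, zero_apply, sum_apply]
    refine Finset.sum_eq_zero fun a _ => ?_
    rw [mul_apply, sum_apply]
    refine Finset.sum_eq_zero fun i hi => ?_
    rw [mul_apply]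
    refine Finset.sum_eq_zero fun j hj => ?_
    have hi' := Finset.mem_range.1 hi
    have hj' := Finset.mem_range.1 hj
    by_cases h0 : i = 0 ∧ j = 0
    · simp [h0.1, h0.2, hT]
    · rw [ih ((w.drop i).length + (w'.drop j).length)
        (by rw [List.length_drop, List.length_drop]; omega) _ (hy a) _ _ rfl]
      simp

variable {T : α → 𝓑} {φ ψ : NCSeries α A → 𝓑}

namespace IsSubst

/-- The defects φ f - ψ f form a set to which `Contracting` applies, because the constant terms
cancel in the recursion. Additivity, linearity and multiplicativity are obtained below in the same
way from their own sets of defects. -/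
theorem eq (hT : Contracting T) (hφ : IsSubst T φ) (hψ : IsSubst T ψ) (f : NCSeries α A) :
    φ f = ψ f := by
  refine sub_eq_zero.1 (hT {x | ∃ f, x = φ f - ψ f} ?_ _ ⟨f, rfl⟩)
  rintro _ ⟨f, rfl⟩
  refine ⟨fun a => φ (f.tail a) - ψ (f.tail a), fun a => ⟨_, rfl⟩, ?_⟩
  rw [hφ f, hψ f]
  simp [mul_sub, Finset.sum_sub_distrib]

theorem map_add (hT : Contracting T) (hφ : IsSubst T φ) (f g : NCSeries α A) :
    φ (f + g) = φ f + φ g := by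
  refine sub_eq_zero.1 (hT {x | ∃ f g, x = φ (f + g) - (φ f + φ g)} ?_ _ ⟨f, g, rfl⟩)
  rintro _ ⟨f, g, rfl⟩
  refine ⟨fun a => φ (f.tail a + g.tail a) - (φ (f.tail a) + φ (g.tail a)),
    fun a => ⟨_, _, rfl⟩, ?_⟩
  rw [hφ f, hφ g, hφ (f + g)]
  simp only [tail_add, add_apply, mul_sub, Finset.sum_sub_distrib, mul_add,
    Finset.sum_add_distrib, add_smul]
  abel

theorem map_smul (hT : Contracting T) (hφ : IsSubst T φ) (c : A) (f : NCSeries α A) :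
    φ (c • f) = c • φ f := by
  refine sub_eq_zero.1 (hT {x | ∃ f, x = φ (c • f) - c • φ f} ?_ _ ⟨f, rfl⟩)
  rintro _ ⟨f, rfl⟩
  refine ⟨fun a => φ (c • f.tail a) - c • φ (f.tail a), fun a => ⟨_, rfl⟩, ?_⟩
  have h (a : α) : (c • f).tail a = c • f.tail a := rfl
  rw [hφ f, hφ (c • f)]
  simp [h, mul_sub, Finset.sum_sub_distrib, smul_add, Finset.smul_sum, mul_smul]

theorem map_zero (hT : Contracting T) (hφ : IsSubst T φ) : φ 0 = 0 := by
  simpa using hφ.map_smul hT 0 0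

theorem map_one (hT : Contracting T) (hφ : IsSubst T φ) : φ 1 = 1 := by
  rw [hφ 1]; simp [hφ.map_zero hT]

theorem map_X [DecidableEq α] (hT : Contracting T) (hφ : IsSubst T φ) (a : α) : φ (X a) = T a := by
  rw [hφ]
  simp only [tail_X, X_nil, zero_smul, zero_add]
  rw [Finset.sum_eq_single a]
  · simp [hφ.map_one hT]
  · intro b _ hb; simp [hb, hφ.map_zero hT]
  · simp

theorem map_mul (hT : Contracting T) (hφ : IsSubst T φ) (f g : NCSeries α A) :
    φ (f * g) = φ f * φ g := by
  refine sub_eq_zero.1 (hT {x | ∃ f g, x = φ (f * g) - φ f * φ g} ?_ _ ⟨f, g, rfl⟩)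
  rintro _ ⟨f, g, rfl⟩
  refine ⟨fun a => φ (f.tail a * g) - φ (f.tail a) * φ g, fun a => ⟨_, _, rfl⟩, ?_⟩
  have hc (h : NCSeries α A) : const (f []) * h = f [] • h := by ext w; simp [smul_eq_mul]
  rw [hφ (f * g), hφ f]
  simp only [tail_mul, hc, hφ.map_add hT, hφ.map_smul hT, mul_add, mul_sub, add_mul,
    Finset.sum_add_distrib, Finset.sum_sub_distrib, Finset.sum_mul, mul_assoc, mul_nil,
    smul_mul_assoc, one_mul]
  have e : f [] • φ g = (f [] * g []) • 1 + ∑ a, T a * f [] • φ (g.tail a) := by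
    nth_rewrite 1 [hφ g]
    simp only [smul_add, Finset.smul_sum, mul_smul_comm, smul_smul]
  rw [e]
  abel

theorem comp {χ : 𝓑 → 𝓒} (h1 : χ 1 = 1) (hmul : ∀ x y, χ (x * y) = χ x * χ y)
    (hadd : ∀ x y, χ (x + y) = χ x + χ y) (hsmul : ∀ (c : A) x, χ (c • x) = c • χ x)
    (hφ : IsSubst T φ) : IsSubst (fun a => χ (T a)) (fun f => χ (φ f)) := by
  intro f
  let χ' : 𝓑 →+ 𝓒 := AddMonoidHom.mk' χ hadd
  have : χ (∑ a, T a * φ (f.tail a)) = ∑ a, χ (T a * φ (f.tail a)) := _root_.map_sum χ' _ _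
  simp only
  rw [hφ f, hadd, hsmul, h1, this]
  simp only [hmul]

end IsSubst

end Subst

end NCSeries

namespace NCSeries

/-! ### The shuffle coproduct -/

section Coproduct

variable {α A : Type*} [CommRing A]

/-- The dual of the shuffle product: the coefficient at `(w, w')` is the sum of the coefficients
of the shuffles of `w` and `w'`. -/
def coprod (f : NCSeries α A) : NCSeries α (NCSeries α A) :=
  fun w w' => ((shuffles w w').map f).sum

theorem coprod_nil_left (f : NCSeries α A) (w : List α) : coprod f [] w = f w := by
  have (f : List α → A) : ((shuffles [] w).map f).sum = f w := by simp [shuffles]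
  exact this f

theorem coprod_nil_right (f : NCSeries α A) (w : List α) : coprod f w [] = f w := by
  have (f : List α → A) : ((shuffles w []).map f).sum = f w := by cases w <;> simp [shuffles]
  exact this f

theorem coprod_cons_cons (f : NCSeries α A) (a b : α) (w w' : List α) :
    coprod f (a :: w) (b :: w') =
      coprod (f.tail a) w (b :: w') + coprod (f.tail b) (a :: w) w' := by
  have (f : List α → A) : ((shuffles (a :: w) (b :: w')).map f).sum =
      ((shuffles w (b :: w')).map fun v => f (a :: v)).sum +
        ((shuffles (a :: w) w').map fun v => f (b :: v)).sum := by
    simp [shuffles, Function.comp_def]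
  exact this f

/-- The tensor product of two series, as a series in two sets of letters. -/
def tensor (f g : NCSeries α A) : NCSeries α (NCSeries α A) :=
  extend (NCSeries α A) f * const g

/-- `u ⊗ 1 + 1 ⊗ u`. -/
def primitivePart (u : NCSeries α A) : NCSeries α (NCSeries α A) :=
  extend (NCSeries α A) u + const u

theorem tensor_apply (f g : NCSeries α A) (w w' : List α) : tensor f g w w' = f w * g w' := by
  rw [tensor, extend_mul_const_comm, const_mul_apply, extend_apply, ← Algebra.commutes,
    ← Algebra.smul_def, smul_apply, smul_eq_mul]

theorem tensor_mul (f g f' g' : NCSeries α A) :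
    tensor f g * tensor f' g' = tensor (f * f') (g * g') := by
  simp only [tensor, extend_mul, const_mul]
  rw [mul_assoc, ← mul_assoc (const g), ← extend_mul_const_comm f' g]
  simp only [mul_assoc]

theorem const_one {R : Type*} [Ring R] : (const 1 : NCSeries α R) = 1 := rfl

theorem tensor_one_one : tensor (1 : NCSeries α A) 1 = 1 := by
  rw [tensor, extend_one, const_one, one_mul]

theorem primitivePart_apply (u : NCSeries α A) (w w' : List α) :
    primitivePart u w w' = u w * (1 : NCSeries α A) w' + (1 : NCSeries α A) w * u w' := by
  have h : primitivePart u = tensor u 1 + tensor 1 u := by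
    rw [primitivePart, tensor, tensor, extend_one, const_one, mul_one, one_mul]
  rw [h, add_apply, add_apply, tensor_apply, tensor_apply]

theorem tensor_mul_primitivePart (g u : NCSeries α A) :
    tensor g g * primitivePart u = tensor (g * u) g + tensor g (g * u) := by
  rw [primitivePart, mul_add, tensor, tensor, tensor, mul_assoc, ← extend_mul_const_comm, ← mul_assoc,
    ← extend_mul, mul_assoc _ (const g) (const u), ← const_mul]

theorem primitivePart_mul_tensor (g u : NCSeries α A) :
    primitivePart u * tensor g g = tensor (u * g) g + tensor g (u * g) := by
  rw [primitivePart, add_mul, tensor, tensor, tensor, ← mul_assoc, ← extend_mul, ← mul_assoc,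
    ← extend_mul_const_comm, mul_assoc _ (const u) (const g), ← const_mul]

theorem contracting_primitivePart {T : α → NCSeries α A} (hT : ∀ a, T a [] = 0) [Fintype α] :
    Contracting fun a => primitivePart (T a) :=
  contracting_of_nil_nil fun a => by rw [primitivePart_apply, hT]; simp

variable [DecidableEq α]

theorem extend_X {M : Type*} [Ring M] [Algebra A M] (a : α) : extend M (X a : NCSeries α A) = X a := by
  ext w; simp [X, apply_ite (algebraMap A M)]

variable [Fintype α]

theorem contracting_X : Contracting (X : α → NCSeries α A) := contracting_of_nil X_nil

theorem isSubst_id : IsSubst (X : α → NCSeries α A) id := by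
  intro f
  refine ext_tail (by simp) fun b => ?_
  ext w
  have h (a : α) : (X a * f.tail a : NCSeries α A) (b :: w) = if b = a then f (a :: w) else 0 := X_mul_cons ..
  simp [h]

/-- The first letter of a shuffle comes from one of the two words. This is the recursion of the
substitution a ↦ a ⊗ 1 + 1 ⊗ a, so the coproduct is a ring homomorphism. -/
theorem isSubst_coprod :
    IsSubst (fun a => primitivePart (X a)) (coprod : NCSeries α A → _) := by
  intro f
  have h1 (a b : α) (Φ : NCSeries α (NCSeries α A)) (w w' : List α) :
      (extend (NCSeries α A) (X a : NCSeries α A) * Φ) (b :: w) w' = if b = a then Φ w w' else 0 := by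
    rw [extend_X, X_mul_cons]; split <;> rfl
  have h2 (a : α) (Φ : NCSeries α (NCSeries α A)) (w' : List α) :
      (extend (NCSeries α A) (X a : NCSeries α A) * Φ) [] w' = 0 := by
    rw [extend_X, mul_nil]; simp
  have h3 (a b : α) (Φ : NCSeries α (NCSeries α A)) (w w' : List α) :
      (const (X a : NCSeries α A) * Φ : NCSeries α (NCSeries α A)) w (b :: w') = if b = a then Φ w w' else 0 := by
    rw [const_mul_apply, X_mul_cons]
  have h4 (a : α) (Φ : NCSeries α (NCSeries α A)) (w : List α) :
      (const (X a : NCSeries α A) * Φ : NCSeries α (NCSeries α A)) w [] = 0 := by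
    rw [const_mul_apply, mul_nil]; simp
  ext w w'
  simp only [add_apply, sum_apply, primitivePart, add_mul, smul_apply]
  rcases w with _ | ⟨a, w⟩ <;> rcases w' with _ | ⟨b, w'⟩
  · simp [h2, h4, coprod_nil_left]
  · simp [h2, h3, coprod_nil_left]
  · simp [h1, h4, coprod_nil_right]
  · simp [h1, h3, coprod_cons_cons, Finset.sum_add_distrib]

theorem coprod_mul (f g : NCSeries α A) : coprod (f * g) = coprod f * coprod g :=
  isSubst_coprod.map_mul (contracting_primitivePart X_nil) f g

theorem coprod_add (f g : NCSeries α A) : coprod (f + g) = coprod f + coprod g :=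
  isSubst_coprod.map_add (contracting_primitivePart X_nil) f g

theorem coprod_smul (c : A) (f : NCSeries α A) : coprod (c • f) = c • coprod f :=
  isSubst_coprod.map_smul (contracting_primitivePart X_nil) c f

theorem coprod_one : coprod (1 : NCSeries α A) = 1 :=
  isSubst_coprod.map_one (contracting_primitivePart X_nil)

theorem coprod_X (a : α) : coprod (X a : NCSeries α A) = primitivePart (X a) :=
  isSubst_coprod.map_X (contracting_primitivePart X_nil) a

/-- The series that satisfy the shuffle equation and have constant term `1`. -/
def IsGroupLike (g : NCSeries α A) : Prop := g [] = 1 ∧ coprod g = tensor g g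

/-- The series whose coefficients vanish on shuffles of non-empty words. -/
def IsPrimitive (u : NCSeries α A) : Prop := coprod u = primitivePart u

theorem IsGroupLike.mul {f g : NCSeries α A} (hf : IsGroupLike f) (hg : IsGroupLike g) :
    IsGroupLike (f * g) :=
  ⟨by simp [hf.1, hg.1], by rw [coprod_mul, hf.2, hg.2, tensor_mul]⟩

theorem IsGroupLike.inv {f g : NCSeries α A} (hf : IsGroupLike f) (h : f * g = 1) (h' : g * f = 1) :
    IsGroupLike g := by
  refine ⟨by simpa [hf.1] using congrArg (fun x => x []) h, ?_⟩
  have h1 : tensor f f * coprod g = 1 := by rw [← hf.2, ← coprod_mul, h, coprod_one]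
  have h2 : tensor g g * tensor f f = 1 := by rw [tensor_mul, h', tensor_one_one]
  exact (left_inv_eq_right_inv h2 h1).symm

/-- Applying the coproduct to g u = x g and cancelling the invertible factor g ⊗ g leaves u ⊗ 1 + 1
⊗ u. -/
theorem IsGroupLike.isPrimitive_conj {g g' u x : NCSeries α A} (hg : IsGroupLike g)
    (h' : g' * g = 1) (hx : IsPrimitive x) (hu : g * u = x * g) : IsPrimitive u := by
  have h1 : tensor g g * coprod u = tensor g g * primitivePart u := by
    rw [tensor_mul_primitivePart, hu, ← primitivePart_mul_tensor, ← hg.2, ← coprod_mul, hu,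
      coprod_mul, hx]
  have h2 : tensor g' g' * tensor g g = 1 := by rw [tensor_mul, h', tensor_one_one]
  calc coprod u = tensor g' g' * (tensor g g * coprod u) := by rw [← mul_assoc, h2, one_mul]
    _ = _ := by rw [h1, ← mul_assoc, h2, one_mul]

end Coproduct

end NCSeries

namespace NCSeries

/-! ### Substitution of series without constant term -/

section SubstSeries

variable {α A M : Type*} [CommRing A] [Ring M] [Algebra A M]

/-- The image of a word under the substitution of the `U a` to the letters. -/
def wordSubst (U : α → NCSeries α A) (v : List α) : NCSeries α A := (v.map U).prod

@[simp] theorem wordSubst_nil (U : α → NCSeries α A) : wordSubst U [] = 1 := rfl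

@[simp] theorem wordSubst_cons (U : α → NCSeries α A) (a : α) (v : List α) :
    wordSubst U (a :: v) = U a * wordSubst U v := by simp [wordSubst]

variable {U : α → NCSeries α A}

theorem wordSubst_eq_zero_of_length_lt (hU : ∀ a, U a [] = 0) {v w : List α}
    (h : w.length < v.length) : wordSubst U v w = 0 := by
  induction v generalizing w with
  | nil => simp at h
  | cons a v ih =>
    rw [wordSubst_cons, mul_apply]
    refine Finset.sum_eq_zero fun i hi => ?_
    rcases Nat.eq_zero_or_pos i with rfl | h0
    · simp [hU]
    · rcases Nat.eq_zero_or_pos w.length with hw | hw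
      · simp [List.length_eq_zero_iff.1 hw, hU]
      · rw [ih, mul_zero]
        simp only [List.length_cons, List.length_drop] at h ⊢
        omega

/-- Application of a map to all the coefficients. -/
def mapCoeff {R R' : Type*} (φ : R → R') (f : NCSeries α R) : NCSeries α R' := fun w => φ (f w)

@[simp] theorem mapCoeff_apply {R R' : Type*} (φ : R → R') (f : NCSeries α R) (w : List α) :
    mapCoeff φ f w = φ (f w) := rfl

variable [Fintype α]

/-- The substitution of the `U a` to the letters. -/
def subst (U : α → NCSeries α A) (f : NCSeries α M) : NCSeries α M := fun w =>
  ∑ m ∈ Finset.range (w.length + 1), ∑ v : Fin m → α,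
    f (List.ofFn v) * algebraMap A M (wordSubst U (List.ofFn v) w)

theorem subst_apply_of_lt (hU : ∀ a, U a [] = 0) (f : NCSeries α M) {w : List α} {L : ℕ}
    (hL : w.length < L) : subst U f w = ∑ m ∈ Finset.range L, ∑ v : Fin m → α,
      f (List.ofFn v) * algebraMap A M (wordSubst U (List.ofFn v) w) := by
  refine Finset.sum_subset (Finset.range_mono (by omega)) fun m _ hm => ?_
  refine Finset.sum_eq_zero fun v _ => ?_
  rw [wordSubst_eq_zero_of_length_lt hU, map_zero, mul_zero]
  simp only [Finset.mem_range] at hm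
  rw [List.length_ofFn]
  omega

theorem sum_fin_succ_fun {ι N : Type*} [Fintype ι] [AddCommMonoid N] {m : ℕ} (F : List ι → N) :
    ∑ v : Fin (m + 1) → ι, F (List.ofFn v) = ∑ a, ∑ v : Fin m → ι, F (a :: List.ofFn v) := by
  rw [← (Fin.consEquiv fun _ : Fin (m + 1) => ι).sum_comp, Fintype.sum_prod_type]
  refine Finset.sum_congr rfl fun a _ => Finset.sum_congr rfl fun v _ => ?_
  rw [← List.ofFn_cons]
  rfl

theorem subst_eq (hU : ∀ a, U a [] = 0) (f : NCSeries α M) :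
    subst U f = const (f []) + ∑ a, extend M (U a) * subst U (f.tail a) := by
  ext w
  rw [subst, Finset.sum_range_succ', add_comm, add_apply, sum_apply]
  congr 1
  · cases w <;> simp
  · simp only [sum_fin_succ_fun fun v => f v * algebraMap A M (wordSubst U v w)]
    rw [Finset.sum_comm]
    refine Finset.sum_congr rfl fun a _ => ?_
    have key : ∀ i ∈ Finset.range (w.length + 1),
        extend M (U a) (w.take i) * subst U (f.tail a) (w.drop i) =
        ∑ m ∈ Finset.range w.length, ∑ v : Fin m → α, f (a :: List.ofFn v) *
          algebraMap A M (U a (w.take i) * wordSubst U (List.ofFn v) (w.drop i)) := by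
      intro i hi
      by_cases h0 : w.take i = []
      · simp [h0, hU]
      · have hl : (w.drop i).length < w.length := by
          rw [List.length_drop]
          have : 0 < (w.take i).length := List.length_pos_iff.2 h0
          rw [List.length_take] at this
          omega
        rw [subst_apply_of_lt hU _ hl, Finset.mul_sum]
        refine Finset.sum_congr rfl fun m _ => ?_
        rw [Finset.mul_sum]
        refine Finset.sum_congr rfl fun v _ => ?_
        rw [map_mul, extend_apply, tail_apply, ← mul_assoc, ← mul_assoc, Algebra.commutes]
    rw [mul_apply, Finset.sum_congr rfl key, Finset.sum_comm]
    refine Finset.sum_congr rfl fun m _ => ?_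
    rw [Finset.sum_comm]
    refine Finset.sum_congr rfl fun v _ => ?_
    rw [wordSubst_cons, mul_apply, map_sum, Finset.mul_sum]

theorem isSubst_subst (hU : ∀ a, U a [] = 0) : IsSubst U (subst U : NCSeries α A → _) := by
  intro f
  rw [subst_eq hU]
  congr 1
  ext w
  cases w <;> simp

theorem subst_const (m : M) : subst U (const m) = const m := by
  ext w
  rw [subst, Finset.sum_range_succ', Finset.sum_eq_zero]
  · cases w <;> simp
  · intro m _
    exact Finset.sum_eq_zero fun v _ => by simp [List.ofFn_succ]

theorem subst_add (f g : NCSeries α M) : subst U (f + g) = subst U f + subst U g := by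
  ext w
  simp [subst, add_mul, Finset.sum_add_distrib]

theorem subst_zero : subst U (0 : NCSeries α M) = 0 := by
  ext w; simp [subst]

theorem subst_sub (f g : NCSeries α M) : subst U (f - g) = subst U f - subst U g := by
  ext w
  simp [subst, sub_mul, Finset.sum_sub_distrib]

theorem subst_sum {ι : Type*} (s : Finset ι) (f : ι → NCSeries α M) :
    subst U (∑ i ∈ s, f i) = ∑ i ∈ s, subst U (f i) := by
  classical
  induction s using Finset.induction_on with
  | empty => simp [subst_zero]
  | insert a s ha ih => rw [Finset.sum_insert ha, Finset.sum_insert ha, subst_add, ih]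

theorem subst_const_mul (m : M) (f : NCSeries α M) :
    subst U (const m * f) = const m * subst U f := by
  ext w
  simp [subst, Finset.mul_sum, mul_assoc]

theorem subst_X_mul [DecidableEq α] (hU : ∀ a, U a [] = 0) (a : α) (f : NCSeries α M) :
    subst U (X a * f) = extend M (U a) * subst U f := by
  rw [subst_eq hU, mul_nil, X_nil, zero_mul, Finset.sum_eq_single a]
  · have : (const 0 : NCSeries α M) = 0 := by ext w; cases w <;> rfl
    rw [tail_X_mul, if_pos rfl, this, zero_add]
  · intro b _ hb
    rw [tail_X_mul, if_neg hb, subst_zero, mul_zero]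
  · simp

/-- Substitution in both factors of a tensor product. -/
def subst₂ (U : α → NCSeries α A) (Φ : NCSeries α (NCSeries α A)) : NCSeries α (NCSeries α A) :=
  subst U (mapCoeff (subst U) Φ)

theorem subst₂_add (Φ Ψ : NCSeries α (NCSeries α A)) :
    subst₂ U (Φ + Ψ) = subst₂ U Φ + subst₂ U Ψ := by
  rw [subst₂, subst₂, subst₂, ← subst_add]
  congr 1
  ext1 w
  rw [mapCoeff_apply, add_apply, subst_add]
  rfl

theorem subst₂_zero : subst₂ U 0 = 0 := by
  have := subst₂_add (U := U) 0 0
  simpa using this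

theorem subst₂_sum {ι : Type*} (s : Finset ι) (f : ι → NCSeries α (NCSeries α A)) :
    subst₂ U (∑ i ∈ s, f i) = ∑ i ∈ s, subst₂ U (f i) := by
  classical
  induction s using Finset.induction_on with
  | empty => simp [subst₂_zero]
  | insert a s ha ih => rw [Finset.sum_insert ha, Finset.sum_insert ha, subst₂_add, ih]

theorem subst₂_primitivePart_X_mul [DecidableEq α] (hU : ∀ a, U a [] = 0) (a : α)
    (Φ : NCSeries α (NCSeries α A)) :
    subst₂ U (primitivePart (X a) * Φ) = primitivePart (U a) * subst₂ U Φ := by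
  rw [primitivePart, primitivePart, add_mul, add_mul, subst₂_add]
  congr 1
  · rw [extend_X, subst₂, subst₂, ← subst_X_mul hU]
    congr 1
    ext1 w
    cases w with
    | nil => simp [subst_zero]
    | cons b w =>
      rw [mapCoeff_apply, X_mul_cons, X_mul_cons]
      split
      · rfl
      · exact subst_zero
  · rw [subst₂, subst₂, ← subst_const_mul]
    congr 1
    ext1 w
    rw [mapCoeff_apply, const_mul_apply, const_mul_apply, subst_X_mul hU]
    rfl

theorem subst₂_smul_one (c : A) : subst₂ U (c • 1) = c • 1 := by
  have h : ∀ c : A, (c • 1 : NCSeries α (NCSeries α A)) = const (const c) := by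
    intro c; ext w w'; cases w <;> cases w' <;> simp
  rw [h, subst₂]
  have : mapCoeff (subst U) (const (const c) : NCSeries α (NCSeries α A)) =
      (const (const c) : NCSeries α (NCSeries α A)) := by
    ext1 w
    cases w with
    | nil => exact subst_const c
    | cons a w => exact subst_zero
  rw [this, subst_const]

theorem subst₂_tensor (f g : NCSeries α A) :
    subst₂ U (tensor f g) = tensor (subst U f) (subst U g) := by
  have h (w : List α) : subst U ((tensor f g) w) = f w • subst U g := by
    ext w'
    simp only [subst, tensor_apply, smul_apply, smul_eq_mul, Finset.mul_sum, mul_assoc]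
  ext w w'
  rw [subst₂, tensor_apply, subst, sum_apply]
  simp only [sum_apply, mapCoeff_apply, h, Algebra.algebraMap_eq_smul_one]
  simp only [subst, Finset.sum_mul]
  refine Finset.sum_congr rfl fun m _ => Finset.sum_congr rfl fun v _ => ?_
  simp [subst]
  ring

/-- As each U a is primitive, both sides satisfy the recursion of the substitution a ↦ U a ⊗ 1 + 1 ⊗
U a, and uniqueness of substitutions applies. -/
theorem coprod_subst [DecidableEq α] (hU : ∀ a, U a [] = 0) (hp : ∀ a, IsPrimitive (U a)) (f : NCSeries α A) :
    coprod (subst U f) = subst₂ U (coprod f) := by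
  have h1 : IsSubst (fun a => primitivePart (U a)) fun f => coprod (subst U f) := by
    have := (isSubst_subst hU).comp (χ := coprod) coprod_one coprod_mul coprod_add coprod_smul
    simpa only [fun a => show coprod (U a) = _ from hp a] using this
  refine h1.eq (contracting_primitivePart hU) (ψ := fun f => subst₂ U (coprod f)) (fun f => ?_) f
  simp only
  rw [isSubst_coprod f, subst₂_add, subst₂_smul_one, subst₂_sum]
  simp only [subst₂_primitivePart_X_mul hU]

theorem subst_mul (hU : ∀ a, U a [] = 0) (f g : NCSeries α A) :
    subst U (f * g) = subst U f * subst U g :=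
  (isSubst_subst hU).map_mul (contracting_of_nil hU) f g

theorem subst_smul (hU : ∀ a, U a [] = 0) (c : A) (f : NCSeries α A) :
    subst U (c • f) = c • subst U f :=
  (isSubst_subst hU).map_smul (contracting_of_nil hU) c f

theorem subst_one (hU : ∀ a, U a [] = 0) : subst U (1 : NCSeries α A) = 1 :=
  (isSubst_subst hU).map_one (contracting_of_nil hU)

theorem subst_X [DecidableEq α] (hU : ∀ a, U a [] = 0) (a : α) : subst U (X a : NCSeries α A) = U a :=
  (isSubst_subst hU).map_X (contracting_of_nil hU) a

theorem subst_nil (U : α → NCSeries α A) (f : NCSeries α A) : subst U f [] = f [] := by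
  simp [subst]

theorem subst_subst {V : α → NCSeries α A} (hU : ∀ a, U a [] = 0) (hV : ∀ a, V a [] = 0)
    (f : NCSeries α A) : subst U (subst V f) = subst (fun a => subst U (V a)) f := by
  have hUV : ∀ a, subst U (V a) [] = 0 := fun a => by rw [subst_nil, hV]
  exact ((isSubst_subst hV).comp (χ := subst U) (subst_one hU) (subst_mul hU) subst_add
    (subst_smul hU)).eq (contracting_of_nil hUV) (isSubst_subst hUV) f

theorem IsGroupLike.subst [DecidableEq α] (hU : ∀ a, U a [] = 0) (hp : ∀ a, IsPrimitive (U a))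
    {f : NCSeries α A} (hf : IsGroupLike f) : IsGroupLike (subst U f) :=
  ⟨by rw [subst_nil, hf.1], by rw [coprod_subst hU hp, hf.2, subst₂_tensor]⟩

end SubstSeries

end NCSeries

open NCSeries

/-! ### Rotations and depth -/

section Depth

variable {N : ℕ}

@[simp] theorem depth_nil : depth ([] : Word N) = 0 := rfl
@[simp] theorem depth_none_cons (w : Word N) : depth (none :: w) = depth w := by simp [depth]
@[simp] theorem depth_some_cons (j : ZMod N) (w : Word N) : depth (some j :: w) = depth w + 1 := by
  simp [depth]
@[simp] theorem depth_append (v w : Word N) : depth (v ++ w) = depth v + depth w := by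
  simp [depth]
@[simp] theorem depth_replicate (l : ℕ) : depth (List.replicate l none : Word N) = 0 := by
  simp [depth, List.countP_replicate]

theorem depth_take_add_drop (i : ℕ) (w : Word N) : depth (w.take i) + depth (w.drop i) = depth w := by
  rw [← depth_append, List.take_append_drop]

/-- The rotation of the letters of a word by `-j`. -/
def unrotate (j : ZMod N) (w : Word N) : Word N := w.map (Option.map (fun i => i - j))

@[simp] theorem length_unrotate (j : ZMod N) (w : Word N) : (unrotate j w).length = w.length := by
  simp [unrotate]

@[simp] theorem depth_unrotate (j : ZMod N) (w : Word N) : depth (unrotate j w) = depth w := by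
  induction w with
  | nil => rfl
  | cons a w ih => cases a <;> simpa [unrotate] using ih

@[simp] theorem unrotate_append (j : ZMod N) (v w : Word N) :
    unrotate j (v ++ w) = unrotate j v ++ unrotate j w := by simp [unrotate]

@[simp] theorem unrotate_replicate (j : ZMod N) (l : ℕ) :
    unrotate j (List.replicate l none) = List.replicate l none := by simp [unrotate]

theorem unrotate_unrotate (i j : ZMod N) (w : Word N) :
    unrotate i (unrotate j w) = unrotate (i + j) w := by
  simp only [unrotate, List.map_map, Function.comp_def, Option.map_map]
  congr 1; funext a; congr 1; funext x; ring

@[simp] theorem unrotate_zero (w : Word N) : unrotate 0 w = w := by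
  simp [unrotate]

theorem unrotate_eq_singleton (j : ZMod N) (w : Word N) :
    unrotate j w = [some 0] ↔ w = [some j] := by
  rcases w with _ | ⟨_ | i, _ | ⟨b, w⟩⟩ <;> simp [unrotate, sub_eq_zero]

theorem eq_replicate_of_depth_eq_zero {w : Word N} (h : depth w = 0) :
    w = List.replicate w.length none := by
  induction w with
  | nil => rfl
  | cons a w ih =>
    cases a with
    | none =>
      rw [List.length_cons, List.replicate_succ, ← ih (by simpa using h)]
    | some j => simp at h

end Depth

section Series

variable {N : ℕ} {A : Type*}

/-- The image of a series under the rotation `x ↦ z_j x`. -/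
def rot (j : ZMod N) (f : NCSeries (Letter N) A) : NCSeries (Letter N) A := fun w => f (unrotate j w)

@[simp] theorem rot_apply (j : ZMod N) (f : NCSeries (Letter N) A) (w : Word N) :
    rot j f w = f (unrotate j w) := rfl

theorem rot_rot (i j : ZMod N) (f : NCSeries (Letter N) A) : rot i (rot j f) = rot (j + i) f := by
  ext w; simp [unrotate_unrotate]

@[simp] theorem rot_zero (f : NCSeries (Letter N) A) : rot 0 f = f := by ext w; simp

variable [CommRing A]

theorem rot_mul (j : ZMod N) (f g : NCSeries (Letter N) A) : rot j (f * g) = rot j f * rot j g := by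
  ext w; simp [mul_apply, unrotate, List.map_take, List.map_drop]

theorem rot_one (j : ZMod N) : rot j (1 : NCSeries (Letter N) A) = 1 := by
  ext w; cases w <;> rfl

theorem rot_X_some (i j : ZMod N) :
    rot j (X (some i) : NCSeries (Letter N) A) = X (some (i + j)) := by
  ext w
  have : unrotate j w = [some i] ↔ w = [some (i + j)] := by
    rcases w with _ | ⟨_ | i, _ | ⟨b, w⟩⟩ <;> simp [unrotate, sub_eq_iff_eq_add]
  simp [X, this]

theorem rot_X_none (j : ZMod N) : rot j (X none : NCSeries (Letter N) A) = X none := by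
  ext w
  have : unrotate j w = [none] ↔ w = [none] := by
    rcases w with _ | ⟨_ | i, _ | ⟨b, w⟩⟩ <;> simp [unrotate]
  simp [X, this]

/-- The substitution `e_0 ↦ e_0`, `e_{z_j} ↦ rot j u`. -/
def letterSubst (u : NCSeries (Letter N) A) : Letter N → NCSeries (Letter N) A
  | none => X none
  | some j => rot j u

@[simp] theorem letterSubst_none (u : NCSeries (Letter N) A) : letterSubst u none = X none := rfl
@[simp] theorem letterSubst_some (u : NCSeries (Letter N) A) (j : ZMod N) :
    letterSubst u (some j) = rot j u := rfl

theorem letterSubst_nil {u : NCSeries (Letter N) A} (hu : u [] = 0) (a : Letter N) :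
    letterSubst u a [] = 0 := by
  cases a
  · simp
  · exact hu

theorem letterSubst_X_zero (a : Letter N) :
    letterSubst (X (some 0) : NCSeries (Letter N) A) a = X a := by
  cases a with
  | none => rfl
  | some j => rw [letterSubst_some, rot_X_some, zero_add]

variable [NeZero N]

theorem isSubst_rot (j : ZMod N) :
    IsSubst (fun a : Letter N => (X (a.map (· + j)) : NCSeries (Letter N) A)) (rot j) := by
  intro f
  refine ext_tail (by simp [unrotate]) fun b => ?_
  ext w
  have h (a : Letter N) : (X (a.map (· + j)) * rot j (f.tail a) : NCSeries (Letter N) A) (b :: w) =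
      if b = a.map (· + j) then rot j (f.tail a) w else 0 := X_mul_cons ..
  have h' (a : Letter N) : b = a.map (· + j) ↔ b.map (fun i => i - j) = a := by
    cases a <;> cases b <;> simp [sub_eq_iff_eq_add]
  simp only [tail_apply, NCSeries.add_apply, NCSeries.smul_apply, one_cons, smul_zero, zero_add, NCSeries.sum_apply, h,
    h', Finset.sum_ite_eq, Finset.mem_univ, if_true]
  simp [unrotate]

/-- Both sides are the substitution that sends a letter to the rotation of its image. This
equivariance is what makes the Ihara product associative. -/
theorem rot_subst {u : NCSeries (Letter N) A} (hu : u [] = 0) (j : ZMod N)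
    (f : NCSeries (Letter N) A) :
    rot j (subst (letterSubst u) f) = subst (letterSubst u) (rot j f) := by
  have hU := letterSubst_nil hu
  have h1 := (isSubst_subst hU).comp (χ := rot j) (rot_one j) (rot_mul j) (fun _ _ => rfl)
    (fun _ _ => rfl)
  have h2 := (isSubst_rot (A := A) j).comp (χ := subst (letterSubst u)) (subst_one hU)
    (subst_mul hU) subst_add (subst_smul hU)
  have h : (fun a : Letter N => subst (letterSubst u) (X (a.map (· + j)))) =
      fun a => rot j (letterSubst u a) := by
    funext a
    rw [subst_X hU]
    cases a with
    | none => exact (rot_X_none j).symm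
    | some i => exact (rot_rot j i u).symm
  rw [h] at h2
  exact h1.eq (contracting_of_nil (T := fun a => rot j (letterSubst u a))
    fun a => letterSubst_nil hu a) h2 f

/-! The adjoint Ihara product. -/

/-- The adjoint Ihara product on the ring of series. -/
def ihara (u f : NCSeries (Letter N) A) : NCSeries (Letter N) A := subst (letterSubst u) f

theorem ihara_assoc {u v : NCSeries (Letter N) A} (hu : u [] = 0) (hv : v [] = 0)
    (f : NCSeries (Letter N) A) : ihara (ihara u v) f = ihara u (ihara v f) := by
  rw [ihara, ihara, ihara, ihara, subst_subst (letterSubst_nil hu) (letterSubst_nil hv)]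
  congr 1
  funext a
  cases a with
  | none => exact (subst_X (letterSubst_nil hu) none).symm
  | some j => exact rot_subst hu j v

theorem ihara_X_some {u : NCSeries (Letter N) A} (hu : u [] = 0) (j : ZMod N) :
    ihara u (X (some j)) = rot j u := subst_X (letterSubst_nil hu) (some j)

theorem X_ihara (f : NCSeries (Letter N) A) : ihara (X (some 0)) f = f := by
  rw [ihara, show letterSubst (X (some 0) : NCSeries (Letter N) A) = X from
    funext letterSubst_X_zero]
  exact (isSubst_subst X_nil).eq contracting_X isSubst_id f

/-! Truncation by the depth. -/

/-- The coefficients of depth less than `k` are zero. -/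
def VanishBelow (k : ℕ) (f : NCSeries (Letter N) A) : Prop := ∀ w, depth w < k → f w = 0

omit [NeZero N] in
theorem VanishBelow.mul {k l : ℕ} {f g : NCSeries (Letter N) A} (hf : VanishBelow k f)
    (hg : VanishBelow l g) : VanishBelow (k + l) (f * g) := by
  intro w hw
  rw [mul_apply]
  refine Finset.sum_eq_zero fun i _ => ?_
  have := depth_take_add_drop i w
  by_cases h : depth (w.take i) < k
  · rw [hf _ h, zero_mul]
  · rw [hg _ (by omega), mul_zero]

omit [NeZero N] in
theorem VanishBelow.pow {f : NCSeries (Letter N) A} (hf : VanishBelow 1 f) (k : ℕ) :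
    VanishBelow k (f ^ k) := by
  induction k with
  | zero => intro w hw; omega
  | succ k ih => rw [pow_succ]; exact ih.mul hf

/-- The series `u` coincides with `e_1` in depth at most `D`. -/
def AgreesUpTo (D : ℕ) (u : NCSeries (Letter N) A) : Prop := ∀ w, depth w ≤ D → u w = X (some 0) w

omit [NeZero N] in
theorem AgreesUpTo.mono {D D' : ℕ} {u : NCSeries (Letter N) A} (h : AgreesUpTo D u) (hD : D' ≤ D) :
    AgreesUpTo D' u := fun w hw => h w (hw.trans hD)

omit [NeZero N] in
theorem AgreesUpTo.vanishBelow {D : ℕ} {u : NCSeries (Letter N) A} (h : AgreesUpTo D u) :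
    VanishBelow 1 u := by
  intro w hw
  rw [h w (by omega), X, if_neg]
  rintro rfl
  simp at hw

omit [NeZero N] in
theorem VanishBelow.nil {u : NCSeries (Letter N) A} (h : VanishBelow 1 u) : u [] = 0 :=
  h [] (by simp)

omit [NeZero N] in
theorem VanishBelow.rot {k : ℕ} {u : NCSeries (Letter N) A} (h : VanishBelow k u) (j : ZMod N) :
    VanishBelow k (rot j u) := fun w hw => h _ (by simpa using hw)

omit [NeZero N] in
theorem AgreesUpTo.rot_apply {D : ℕ} {u : NCSeries (Letter N) A} (h : AgreesUpTo D u) (j : ZMod N)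
    {w : Word N} (hw : depth w ≤ D) : rot j u w = if w = [some j] then 1 else 0 := by
  rw [HarmonicIhara.rot_apply, h _ (by simpa using hw), X]
  simp [unrotate_eq_singleton]

omit [NeZero N] in
-- A term of u^{(z_j)} other than e_{z_j} has depth at least D + 1, and each remaining letter of v
-- other than e_0 contributes at least 1. A non-trivial contribution to w thus needs depth w ≥ depth
-- v + D; below that bound the substitution matrix is the identity. If v has depth 0 nothing is
-- substituted.
theorem wordSubst_apply_of_agreesUpTo {D : ℕ} (hD : 1 ≤ D) {u : NCSeries (Letter N) A}
    (hu : AgreesUpTo D u) {v w : Word N} (h : depth v = 0 ∨ depth w + 1 ≤ depth v + D) :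
    wordSubst (letterSubst u) v w = if v = w then 1 else 0 := by
  induction v generalizing w with
  | nil => cases w <;> simp
  | cons a v ih =>
    rw [wordSubst_cons]
    cases a with
    | none =>
      rcases w with _ | ⟨b, w⟩
      · simp
      · rw [letterSubst_none, X_mul_cons]
        by_cases hb : b = none
        · subst hb
          rw [if_pos rfl, ih (by simpa using h)]
          simp
        · rw [if_neg hb, if_neg]
          rintro ⟨⟩
          exact hb rfl
    | some j =>
      have h : depth w ≤ depth v + D := by
        rcases h with h | h
        · simp at h
        · simp at h; omega
      rw [letterSubst_some]
      rcases w with _ | ⟨b, w⟩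
      · simp [unrotate, hu.vanishBelow.nil]
      · rw [mul_apply, Finset.sum_eq_single 1]
        · have h1 : rot j u ((b :: w).take 1) = if b = some j then 1 else 0 := by
            rw [hu.rot_apply]
            · simp
            · cases b <;> simp [hD]
          rw [h1]
          by_cases hb : b = some j
          · subst hb
            rw [if_pos rfl, one_mul, List.drop_succ_cons, List.drop_zero, ih]
            · simp
            · right; simp at h; omega
          · rw [if_neg hb, zero_mul, if_neg]
            rintro ⟨⟩
            exact hb rfl
        · intro i hi h1
          have hd := depth_take_add_drop i (b :: w)
          by_cases hi' : depth ((b :: w).take i) ≤ D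
          · rw [hu.rot_apply j hi', if_neg, zero_mul]
            intro h
            have := congrArg List.length h
            simp only [List.length_take, List.length_cons, List.length_nil, Finset.mem_range] at this hi
            omega
          · rw [ih (by right; omega), if_neg, mul_zero]
            rintro rfl
            omega
        · simp

end Series

/-! ### Series whose coefficients of bounded depth tend to zero -/

section Null

variable {N : ℕ} {A : Type*} [NormedCommRing A]

/-- The coefficients of bounded depth tend to `0` when the weight tends to infinity. -/
def IsNull (f : NCSeries (Letter N) A) : Prop :=
  ∀ (d : ℕ) (ε : ℝ), 0 < ε → ∃ s : ℕ, ∀ w : Word N, s ≤ w.length → depth w ≤ d → ‖f w‖ ≤ ε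

theorem IsNull.of_eq_zero {f : NCSeries (Letter N) A} (s : ℕ)
    (h : ∀ w : Word N, s ≤ w.length → f w = 0) : IsNull f :=
  fun _ ε hε => ⟨s, fun w hw _ => by rw [h w hw, norm_zero]; exact hε.le⟩

theorem isNull_zero : IsNull (0 : NCSeries (Letter N) A) := .of_eq_zero 0 fun _ _ => rfl

theorem isNull_one : IsNull (1 : NCSeries (Letter N) A) :=
  .of_eq_zero 1 fun w hw => by cases w <;> simp at hw ⊢

theorem isNull_X (a : Letter N) : IsNull (X a : NCSeries (Letter N) A) :=
  .of_eq_zero 2 fun w hw => by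
    rw [X, if_neg]; rintro rfl; simp at hw

theorem IsNull.rot {f : NCSeries (Letter N) A} (hf : IsNull f) (j : ZMod N) : IsNull (rot j f) := by
  intro d ε hε
  obtain ⟨s, hs⟩ := hf d ε hε
  exact ⟨s, fun w h1 h2 => hs _ (by simpa) (by simpa)⟩

theorem isNull_letterSubst {u : NCSeries (Letter N) A} (hu : IsNull u) (a : Letter N) :
    IsNull (letterSubst u a) := by
  cases a
  · exact isNull_X _
  · exact hu.rot _

theorem IsNull.bounded [NeZero N] {f : NCSeries (Letter N) A} (hf : IsNull f) (d : ℕ) :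
    ∃ C : ℝ, 0 < C ∧ ∀ w, depth w ≤ d → ‖f w‖ ≤ C := by
  obtain ⟨s, hs⟩ := hf d 1 one_pos
  obtain ⟨B, hB⟩ := ((List.finite_length_lt (Letter N) s).image fun w => ‖f w‖).bddAbove
  refine ⟨max B 1, by positivity, fun w hw => ?_⟩
  by_cases h : w.length < s
  · exact (hB ⟨w, h, rfl⟩).trans (le_max_left _ _)
  · exact (hs w (by omega) hw).trans (le_max_right _ _)

variable [IsUltrametricDist A]

theorem IsNull.add {f g : NCSeries (Letter N) A} (hf : IsNull f) (hg : IsNull g) :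
    IsNull (f + g) := by
  intro d ε hε
  obtain ⟨s, hs⟩ := hf d ε hε
  obtain ⟨t, ht⟩ := hg d ε hε
  exact ⟨max s t, fun w h1 h2 => (IsUltrametricDist.norm_add_le_max _ _).trans
    (max_le (hs w ((le_max_left _ _).trans h1) h2) (ht w ((le_max_right _ _).trans h1) h2))⟩

omit [IsUltrametricDist A] in
theorem IsNull.neg {f : NCSeries (Letter N) A} (hf : IsNull f) : IsNull (-f) := by
  intro d ε hε
  obtain ⟨s, hs⟩ := hf d ε hε
  exact ⟨s, fun w h1 h2 => by simpa using hs w h1 h2⟩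

theorem IsNull.sub {f g : NCSeries (Letter N) A} (hf : IsNull f) (hg : IsNull g) :
    IsNull (f - g) := by
  rw [sub_eq_add_neg]; exact hf.add hg.neg

theorem IsNull.sum {ι : Type*} (s : Finset ι) {f : ι → NCSeries (Letter N) A}
    (hf : ∀ i ∈ s, IsNull (f i)) : IsNull (∑ i ∈ s, f i) := by
  classical
  induction s using Finset.induction_on with
  | empty => exact isNull_zero
  | insert a s ha ih =>
    rw [Finset.sum_insert ha]
    exact (hf a (by simp)).add (ih fun i hi => hf i (by simp [hi]))

variable [NeZero N]

theorem IsNull.mul {f g : NCSeries (Letter N) A} (hf : IsNull f) (hg : IsNull g) :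
    IsNull (f * g) := by
  intro d ε hε
  obtain ⟨B, hB0, hB⟩ := hf.bounded d
  obtain ⟨C, hC0, hC⟩ := hg.bounded d
  obtain ⟨s, hs⟩ := hf d (ε / C) (by positivity)
  obtain ⟨t, ht⟩ := hg d (ε / B) (by positivity)
  refine ⟨s + t, fun w h1 h2 => ?_⟩
  rw [mul_apply]
  refine IsUltrametricDist.norm_sum_le_of_forall_le_of_nonneg hε.le fun i hi => ?_
  have hd := depth_take_add_drop i w
  refine (norm_mul_le _ _).trans ?_
  by_cases h : s ≤ (w.take i).length
  · calc _ ≤ ε / C * C := by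
          gcongr
          · exact hs _ h (by omega)
          · exact hC _ (by omega)
      _ = ε := by field_simp
  · calc _ ≤ B * (ε / B) := by
          gcongr
          · exact hB _ (by omega)
          · refine ht _ ?_ (by omega)
            simp only [List.length_take, List.length_drop, Finset.mem_range] at *
            omega
      _ = ε := by field_simp

theorem IsNull.pow {f : NCSeries (Letter N) A} (hf : IsNull f) (k : ℕ) : IsNull (f ^ k) := by
  induction k with
  | zero => simpa using isNull_one
  | succ k ih => rw [pow_succ]; exact ih.mul hf

theorem isNull_wordSubst {u : NCSeries (Letter N) A} (hu : IsNull u) (v : Word N) :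
    IsNull (wordSubst (letterSubst u) v) := by
  induction v with
  | nil => exact isNull_one
  | cons a v ih => rw [wordSubst_cons]; exact (isNull_letterSubst hu a).mul ih

omit [IsUltrametricDist A] [NeZero N] in
theorem vanishBelow_wordSubst {u : NCSeries (Letter N) A} (hu : VanishBelow 1 u) (v : Word N) :
    VanishBelow (depth v) (wordSubst (letterSubst u) v) := by
  induction v with
  | nil => intro w hw; simp at hw
  | cons a v ih =>
    rw [wordSubst_cons]
    cases a with
    | none => simpa using VanishBelow.mul (k := 0) (fun w hw => by simp at hw) ih
    | some j => simpa [add_comm] using (hu.rot j).mul ih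

/-- The coefficients of the images of words are bounded in each depth, uniformly in the word. -/
theorem norm_wordSubst_le {u : NCSeries (Letter N) A} (hu : IsNull u) (h1 : VanishBelow 1 u)
    (d : ℕ) : ∃ C : ℝ, 0 < C ∧ ∀ v w, depth w ≤ d →
      ‖wordSubst (letterSubst u) v w‖ ≤ C := by
  induction d with
  | zero =>
    -- The norm of 1 in `A` need not be 1; the maximum with 1 keeps the bound positive.
    refine ⟨max 1 ‖(1 : A)‖, by positivity, fun v w hw => ?_⟩
    by_cases hv : depth v = 0
    · rw [eq_replicate_of_depth_eq_zero hv]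
      generalize v.length = n
      have hw' := hw
      induction n generalizing w with
      | zero => cases w <;> simp
      | succ n ih =>
        rw [List.replicate_succ, wordSubst_cons, letterSubst_none]
        rcases w with _ | ⟨b, w⟩
        · simp
        · rw [X_mul_cons]
          split
          · subst b
            exact ih w (by simpa using hw) (by simpa using hw)
          · simp
    · rw [vanishBelow_wordSubst h1 v w (by omega)]
      simp
  -- A letter e_0 of v only shifts the word, at no cost. A letter e_{z_j} absorbs a prefix of depth
  -- at least 1 and leaves depth at most d. The factor B is therefore paid at most once per unit of
  -- depth, however long v is.
  | succ d ihd =>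
    obtain ⟨C, hC0, hC⟩ := ihd
    obtain ⟨B, hB0, hB⟩ := hu.bounded (d + 1)
    refine ⟨max (max 1 ‖(1 : A)‖) (B * C), by positivity, fun v => ?_⟩
    induction v with
    | nil => intro w _; cases w <;> simp
    | cons a v ih =>
      intro w hw
      rw [wordSubst_cons]
      cases a with
      | none =>
        rcases w with _ | ⟨b, w⟩
        · simp
        · rw [letterSubst_none, X_mul_cons]
          split
          · subst b
            exact ih w (by simpa using hw)
          · simp
      | some j =>
        rw [mul_apply]
        refine (IsUltrametricDist.norm_sum_le_of_forall_le_of_nonneg (C := B * C) (by positivity)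
          fun i _ => ?_).trans (le_max_right _ _)
        have hd := depth_take_add_drop i w
        by_cases h0 : depth (w.take i) < 1
        · rw [letterSubst_some, h1.rot j _ h0, zero_mul, norm_zero]; positivity
        · refine (norm_mul_le _ _).trans ?_
          gcongr
          · exact hB _ (by simpa using by omega)
          · exact hC _ _ (by omega)

theorem norm_ihara_le {u f : NCSeries (Letter N) A} {w : Word N} {ε : ℝ} (hε : 0 ≤ ε)
    (h : ∀ v, f v * wordSubst (letterSubst u) v w ≠ 0 →
      ‖f v * wordSubst (letterSubst u) v w‖ ≤ ε) : ‖ihara u f w‖ ≤ ε := by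
  rw [ihara, subst]
  refine IsUltrametricDist.norm_sum_le_of_forall_le_of_nonneg hε fun m _ =>
    IsUltrametricDist.norm_sum_le_of_forall_le_of_nonneg hε fun v _ => ?_
  by_cases h0 : f (List.ofFn v) * wordSubst (letterSubst u) (List.ofFn v) w = 0
  · rw [Algebra.algebraMap_self, RingHom.id_apply, h0, norm_zero]; exact hε
  · exact h _ h0

theorem IsNull.exists_forall_mul_wordSubst {u : NCSeries (Letter N) A} (hu : IsNull u)
    (f : NCSeries (Letter N) A) {E : Set (Word N)} (hE : E.Finite) (d : ℕ) {ε : ℝ} (hε : 0 < ε) :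
    ∃ s : ℕ, ∀ v ∈ E, ∀ w : Word N, s ≤ w.length → depth w ≤ d →
      ‖f v * wordSubst (letterSubst u) v w‖ ≤ ε := by
  choose s hs using fun v => isNull_wordSubst hu v d (ε / (‖f v‖ + 1)) (by positivity)
  obtain ⟨B, hB⟩ := (hE.image s).bddAbove
  refine ⟨B, fun v hv w h1 h2 => (norm_mul_le _ _).trans ?_⟩
  calc _ ≤ (‖f v‖ + 1) * (ε / (‖f v‖ + 1)) := by
        gcongr
        · linarith
        · exact hs v w ((hB ⟨v, hv, rfl⟩).trans h1) h2
    _ = ε := by field_simp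

/-- The words v shorter than s are finitely many and each has a null image. For a longer v that
contributes, f[v] is small, as its depth is at most that of w, and the coefficients of its image are
uniformly bounded. -/
theorem isNull_ihara {u f : NCSeries (Letter N) A} (hu : IsNull u) (h1 : VanishBelow 1 u)
    (hf : IsNull f) : IsNull (ihara u f) := by
  intro d ε hε
  obtain ⟨C, hC0, hC⟩ := norm_wordSubst_le hu h1 d
  obtain ⟨s, hs⟩ := hf d (ε / C) (by positivity)
  obtain ⟨t, ht⟩ := hu.exists_forall_mul_wordSubst f (List.finite_length_lt (Letter N) s) d hε
  refine ⟨t, fun w hw hd => norm_ihara_le hε.le fun v hv => ?_⟩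
  by_cases hvs : v.length < s
  · exact ht v hvs w hw hd
  · refine (norm_mul_le _ _).trans ?_
    have hvd : depth v ≤ depth w := by
      by_contra h
      exact hv (by rw [vanishBelow_wordSubst h1 v w (by omega), mul_zero])
    calc _ ≤ ε / C * C := by
          gcongr
          · exact hs v (by omega) (by omega)
          · exact hC v w hd
      _ = ε := by field_simp

/-! Inverses. -/

/-- The inverse of a series that is `1` in depth `0`. -/
def geomInv (g : NCSeries (Letter N) A) : NCSeries (Letter N) A := fun w =>
  ∑ k ∈ Finset.range (depth w + 1), ((1 - g) ^ k) w

omit [IsUltrametricDist A] [NeZero N] in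
theorem geomInv_apply {g : NCSeries (Letter N) A} (hg : VanishBelow 1 (1 - g)) {w : Word N} {K : ℕ}
    (hK : depth w ≤ K) : geomInv g w = (∑ k ∈ Finset.range (K + 1), (1 - g) ^ k) w := by
  rw [NCSeries.sum_apply, geomInv]
  refine Finset.sum_subset (Finset.range_mono (by omega)) fun k _ hk => ?_
  exact hg.pow k w (by simp at hk; omega)

omit [IsUltrametricDist A] [NeZero N] in
theorem mul_geomInv {g : NCSeries (Letter N) A} (hg : VanishBelow 1 (1 - g)) :
    g * geomInv g = 1 := by
  ext w
  have h : (g * geomInv g) w = (g * ∑ k ∈ Finset.range (depth w + 1), (1 - g) ^ k) w := by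
    rw [mul_apply, mul_apply]
    refine Finset.sum_congr rfl fun i _ => ?_
    have := depth_take_add_drop i w
    rw [geomInv_apply hg (K := depth w) (by omega)]
  have h2 := mul_neg_geom_sum (1 - g) (depth w + 1)
  rw [sub_sub_cancel] at h2
  rw [h, h2, NCSeries.sub_apply, hg.pow _ w (by omega), sub_zero]

omit [IsUltrametricDist A] [NeZero N] in
theorem geomInv_mul {g : NCSeries (Letter N) A} (hg : VanishBelow 1 (1 - g)) :
    geomInv g * g = 1 := by
  ext w
  have h : (geomInv g * g) w = ((∑ k ∈ Finset.range (depth w + 1), (1 - g) ^ k) * g) w := by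
    rw [mul_apply, mul_apply]
    refine Finset.sum_congr rfl fun i _ => ?_
    have := depth_take_add_drop i w
    rw [geomInv_apply hg (K := depth w) (by omega)]
  have h2 := geom_sum_mul_neg (1 - g) (depth w + 1)
  rw [sub_sub_cancel] at h2
  rw [h, h2, NCSeries.sub_apply, hg.pow _ w (by omega), sub_zero]

theorem isNull_geomInv {g : NCSeries (Letter N) A} (hg : VanishBelow 1 (1 - g)) (h : IsNull g) :
    IsNull (geomInv g) := by
  intro d ε hε
  obtain ⟨s, hs⟩ := IsNull.sum (Finset.range (d + 1)) (fun k _ => (isNull_one.sub h).pow k) d ε hε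
  exact ⟨s, fun w h1 h2 => by rw [geomInv_apply hg h2]; exact hs w h1 h2⟩

/-- The solution `h` of `ihara u h = f`. -/
def iharaInv (u f : NCSeries (Letter N) A) : NCSeries (Letter N) A := fun w =>
  ∑ k ∈ Finset.range (depth w + 1), ((fun x => x - ihara u x)^[k] f) w

omit [IsUltrametricDist A] in
theorem subst_apply_eq_self {U : Letter N → NCSeries (Letter N) A}
    {M : Type*} [Ring M] [Algebra A M] {f : NCSeries (Letter N) M} {w : Word N}
    (h : ∀ v, f v * algebraMap A M (wordSubst U v w) = if v = w then f v else 0) :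
    subst U f w = f w := by
  rw [subst, Finset.sum_range_succ, Finset.sum_eq_zero, zero_add]
  · simp only [h]
    rw [Finset.sum_eq_single fun i => w[i]]
    · have h : (List.ofFn fun i : Fin w.length => w[i]) = w := List.ofFn_getElem
      rw [if_pos h, h]
    · intro v _ hv
      rw [if_neg]
      intro h
      apply hv
      exact List.ofFn_injective (h.trans List.ofFn_getElem.symm)
    · simp
  · intro m hm
    refine Finset.sum_eq_zero fun v _ => ?_
    rw [h, if_neg]
    rintro rfl
    simp at hm

omit [IsUltrametricDist A] in
theorem ihara_apply_of_vanishBelow {u : NCSeries (Letter N) A} (hu : AgreesUpTo 1 u)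
    {M : Type*} [Ring M] [Algebra A M] {f : NCSeries (Letter N) M} {w : Word N}
    (hf : ∀ v, depth v < depth w → f v = 0) : subst (letterSubst u) f w = f w := by
  refine subst_apply_eq_self fun v => ?_
  by_cases h : depth v < depth w
  · rw [hf v h]; simp
  · rw [wordSubst_apply_of_agreesUpTo le_rfl hu (by right; omega)]
    split <;> simp

omit [IsUltrametricDist A] in
theorem ihara_apply_of_agreesUpTo {D : ℕ} (hD : 1 ≤ D) {u : NCSeries (Letter N) A}
    (hu : AgreesUpTo D u) (f : NCSeries (Letter N) A) {w : Word N} (hw : depth w ≤ D) :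
    ihara u f w = f w := by
  refine subst_apply_eq_self fun v => ?_
  rw [wordSubst_apply_of_agreesUpTo hD hu (by omega)]
  split <;> simp

omit [IsUltrametricDist A] in
-- Unitriangularity for the depth: x - u ∘ x loses the part of x of lowest depth. Hence the Neumann
-- series defining `iharaInv` is a finite sum at each word.
theorem vanishBelow_iterate {u : NCSeries (Letter N) A} (hu : AgreesUpTo 1 u)
    (f : NCSeries (Letter N) A) (k : ℕ) :
    VanishBelow k ((fun x => x - ihara u x)^[k] f) := by
  induction k with
  | zero => intro w hw; omega
  | succ k ih =>
    rw [Function.iterate_succ_apply']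
    intro w hw
    rw [NCSeries.sub_apply, ihara, ihara_apply_of_vanishBelow hu, sub_self]
    exact fun v hv => ih v (by omega)

omit [IsUltrametricDist A] in
theorem iharaInv_apply {u : NCSeries (Letter N) A} (hu : AgreesUpTo 1 u)
    (f : NCSeries (Letter N) A) {w : Word N} {K : ℕ} (hK : depth w ≤ K) :
    iharaInv u f w =
      (∑ k ∈ Finset.range (K + 1), (fun x => x - ihara u x)^[k] f) w := by
  rw [NCSeries.sum_apply, iharaInv]
  refine Finset.sum_subset (Finset.range_mono (by omega)) fun k _ hk => ?_
  exact vanishBelow_iterate hu f k w (by simp at hk; omega)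

omit [IsUltrametricDist A] in
theorem ihara_congr {u : NCSeries (Letter N) A} (hu : VanishBelow 1 u)
    {f g : NCSeries (Letter N) A} {w : Word N} (h : ∀ v, depth v ≤ depth w → f v = g v) :
    ihara u f w = ihara u g w := by
  rw [ihara, ihara, subst, subst]
  refine Finset.sum_congr rfl fun m _ => Finset.sum_congr rfl fun v _ => ?_
  by_cases hv : depth (List.ofFn v) ≤ depth w
  · rw [h _ hv]
  · rw [vanishBelow_wordSubst hu _ w (by omega)]; simp

omit [IsUltrametricDist A] in
theorem ihara_iharaInv {u : NCSeries (Letter N) A} (hu : AgreesUpTo 1 u)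
    (f : NCSeries (Letter N) A) : ihara u (iharaInv u f) = f := by
  ext w
  rw [ihara_congr hu.vanishBelow (g := (∑ k ∈ Finset.range (depth w + 1),
    (fun x => x - ihara u x)^[k] f : NCSeries (Letter N) A)) fun v hv => iharaInv_apply hu f hv, ihara, subst_sum]
  have h (k : ℕ) : subst (letterSubst u) ((fun x => x - ihara u x)^[k] f) =
      (fun x => x - ihara u x)^[k] f - (fun x => x - ihara u x)^[k + 1] f := by
    rw [Function.iterate_succ_apply', sub_sub_cancel]
    rfl
  simp only [h]
  rw [Finset.sum_range_sub', NCSeries.sub_apply, vanishBelow_iterate hu f (depth w + 1) w (by omega), sub_zero]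
  rfl

theorem isNull_iharaInv {u f : NCSeries (Letter N) A} (hu : IsNull u) (h1 : AgreesUpTo 1 u)
    (hf : IsNull f) : IsNull (iharaInv u f) := by
  have hk (k : ℕ) : IsNull ((fun x => x - ihara u x)^[k] f) := by
    induction k with
    | zero => exact hf
    | succ k ih => rw [Function.iterate_succ_apply']; exact ih.sub (isNull_ihara hu h1.vanishBelow ih)
  intro d ε hε
  obtain ⟨s, hs⟩ := IsNull.sum (Finset.range (d + 1)) (fun k _ => hk k) d ε hε
  exact ⟨s, fun w h2 h3 => by rw [iharaInv_apply h1 f h3]; exact hs w h2 h3⟩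

omit [IsUltrametricDist A] in
-- Induction on the depth by unitriangularity. Coefficients in a ring `M` are allowed so that the
-- result applies to series of series, that is, to one factor of a tensor square.
theorem subst_injective {u : NCSeries (Letter N) A} (hu : AgreesUpTo 1 u)
    {M : Type*} [Ring M] [Algebra A M] {f : NCSeries (Letter N) M}
    (hf : subst (letterSubst u) f = 0) : f = 0 := by
  ext w
  induction h : depth w using Nat.strong_induction_on generalizing w with
  | _ n ih =>
    rw [← ihara_apply_of_vanishBelow hu (fun v hv => ih _ (h ▸ hv) v rfl), hf]

omit [IsUltrametricDist A] [NeZero N] in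
theorem coprod_rot (j : ZMod N) (f : NCSeries (Letter N) A) (w w' : Word N) :
    coprod (rot j f) w w' = coprod f (unrotate j w) (unrotate j w') := by
  induction w generalizing f w' with
  | nil => rw [coprod_nil_left, rot_apply]; exact (coprod_nil_left _ _).symm
  | cons a w ih =>
    induction w' generalizing f with
    | nil => rw [coprod_nil_right, rot_apply]; exact (coprod_nil_right _ _).symm
    | cons b w' ih' =>
      have h (c : Letter N) : (rot j f).tail c = rot j (f.tail (c.map fun i => i - j)) := rfl
      rw [coprod_cons_cons, h, h, ih, ih']
      exact (coprod_cons_cons ..).symm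

omit [IsUltrametricDist A] [NeZero N] in
theorem _root_.HarmonicIhara.NCSeries.IsPrimitive.rot {u : NCSeries (Letter N) A}
    (hu : IsPrimitive u) (j : ZMod N) : IsPrimitive (rot j u) := by
  ext w w'
  rw [coprod_rot, hu, primitivePart_apply, primitivePart_apply]
  have h (w : Word N) : (1 : NCSeries (Letter N) A) (unrotate j w) = (1 : NCSeries (Letter N) A) w :=
    congrFun (rot_one j) w
  rw [h, h]
  rfl

omit [IsUltrametricDist A] in
theorem isPrimitive_letterSubst {u : NCSeries (Letter N) A}
    (hu : IsPrimitive u) (a : Letter N) : IsPrimitive (letterSubst u a) := by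
  cases a with
  | none => exact coprod_X none
  | some j => exact hu.rot j

omit [IsUltrametricDist A] in
-- Substitution in both tensor factors sends the coproduct of h and h ⊗ h to the same series;
-- injectivity is then used once for each factor.
theorem isGroupLike_of_ihara {u h : NCSeries (Letter N) A} (hu : AgreesUpTo 1 u)
    (hp : IsPrimitive u) (hh : IsGroupLike (ihara u h)) : IsGroupLike h := by
  have hU := letterSubst_nil hu.vanishBelow.nil
  refine ⟨by rw [← hh.1, ihara, subst_nil], ?_⟩
  have h2 : subst₂ (letterSubst u) (coprod h) = subst₂ (letterSubst u) (tensor h h) := by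
    rw [← coprod_subst hU (isPrimitive_letterSubst hp), subst₂_tensor]; exact hh.2
  have h3 : mapCoeff (subst (letterSubst u)) (coprod h) =
      mapCoeff (subst (letterSubst u)) (tensor h h) := by
    refine sub_eq_zero.1 (subst_injective hu ?_)
    rw [subst_sub]
    exact sub_eq_zero.2 h2
  ext1 w
  refine sub_eq_zero.1 (subst_injective hu ?_)
  rw [subst_sub]
  exact sub_eq_zero.2 (congrFun h3 w)

end Null

/-! ### The group -/

/-! ### Translation of the definitions, and group-like series in depth 0. -/

section Bridge

variable {N : ℕ} {A : Type*} [CommRing A]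

theorem substWord_eq (u : Series N A) (v : Word N) :
    substWord u v = wordSubst (letterSubst (show NCSeries (Letter N) A from u)) v := by
  induction v with
  | nil => funext w; cases w <;> simp [substWord, one]
  | cons a v ih =>
    rw [wordSubst_cons]
    cases a with
    | none => rw [substWord, ih]; rfl
    | some j => rw [substWord, ih]; rfl

theorem adIhara_eq [NeZero N] (u f : Series N A) :
    adIhara u f = ihara (show NCSeries (Letter N) A from u) (show NCSeries (Letter N) A from f) := by
  funext w
  simp only [adIhara, ihara, subst, substWord_eq, Algebra.algebraMap_self, RingHom.id_apply]

theorem isPiPoint_iff (f : Series N A) :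
    IsPiPoint f ↔ IsGroupLike (show NCSeries (Letter N) A from f) := by
  refine and_congr Iff.rfl ⟨fun h => ?_, fun h w w' => ?_⟩
  · ext w w'
    rw [tensor_apply]
    exact (h w w').symm
  · have := congrFun (congrFun h w) w'
    rw [tensor_apply] at this
    exact this.symm

theorem coprod_none_replicate (f : NCSeries (Letter N) A) (n : ℕ) :
    coprod f [none] (List.replicate n none) = (n + 1 : ℕ) * f (List.replicate (n + 1) none) := by
  induction n generalizing f with
  | zero => rw [List.replicate_zero, coprod_nil_right]; simp
  | succ n ih =>
    rw [List.replicate_succ, coprod_cons_cons, ih, coprod_nil_left]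
    simp only [tail_apply, ← List.replicate_succ]
    push_cast
    ring

/-- Shuffling e_0 with e_0^n gives (n + 1) e_0^{n+1}, and non-zero integers are invertible in `A`.
-/
theorem apply_replicate_eq_zero (hA : ∀ n : ℕ, n ≠ 0 → IsUnit (n : A))
    {g : NCSeries (Letter N) A} (hg : IsGroupLike g) (h0 : g [none] = 0) (n : ℕ) :
    g (List.replicate (n + 1) none) = 0 := by
  have h := coprod_none_replicate g n
  rw [hg.2, tensor_apply, h0, zero_mul] at h
  exact (hA (n + 1) n.succ_ne_zero).mul_right_eq_zero.1 h.symm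

theorem vanishBelow_one_sub (hA : ∀ n : ℕ, n ≠ 0 → IsUnit (n : A))
    {g : NCSeries (Letter N) A} (hg : IsGroupLike g) (h0 : g [none] = 0) : VanishBelow 1 (1 - g) := by
  intro w hw
  rw [eq_replicate_of_depth_eq_zero (Nat.lt_one_iff.1 hw)]
  cases w.length with
  | zero => rw [List.replicate_zero, NCSeries.sub_apply, hg.1, one_nil, sub_self]
  | succ n =>
    rw [NCSeries.sub_apply, apply_replicate_eq_zero hA hg h0, List.replicate_succ, one_cons, sub_zero]

theorem vanishBelow_X_some (j : ZMod N) : VanishBelow 1 (X (some j) : NCSeries (Letter N) A) := by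
  intro w hw
  rw [X, if_neg]
  rintro rfl
  simp at hw

theorem mul_singleton (f g : NCSeries (Letter N) A) (a : Letter N) :
    (f * g) [a] = f [] * g [a] + f [a] * g [] := by
  rw [mul_cons, mul_nil]; rfl

end Bridge

section Group

variable {N : ℕ} {A : Type*} [NormedCommRing A]

/-- Depth 0, which the decay condition omits, is harmless because g vanishes at the words e_0^{n+1}.
Passing from exact depth to bounded depth is a maximum over finitely many depths. -/
theorem isPiTildeSigma_iff (hA : ∀ n : ℕ, n ≠ 0 → IsUnit (n : A)) (g : NCSeries (Letter N) A) :
    IsPiTildeSigma g ↔ IsGroupLike g ∧ g [none] = 0 ∧ g [some 0] = 0 ∧ IsNull g := by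
  constructor
  · rintro ⟨h1, h2, h3, h4⟩
    have hg : IsGroupLike g := (isPiPoint_iff g).1 h1
    refine ⟨hg, h2, h3, fun d ε hε => ?_⟩
    choose s hs using fun d : ℕ => h4 (d + 1) (by omega) ε hε
    refine ⟨(Finset.range d).sup s + 1, fun w hw hd => ?_⟩
    by_cases h0 : depth w = 0
    · rw [eq_replicate_of_depth_eq_zero h0, show w.length = w.length - 1 + 1 by omega,
        apply_replicate_eq_zero hA hg h2, norm_zero]
      exact hε.le
    · refine (hs (depth w - 1) w ?_ (by omega)).le
      have : s (depth w - 1) ≤ (Finset.range d).sup s :=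
        Finset.le_sup (Finset.mem_range.2 (by omega))
      omega
  · rintro ⟨h1, h2, h3, h4⟩
    refine ⟨(isPiPoint_iff g).2 h1, h2, h3, fun d _ ε hε => ?_⟩
    obtain ⟨s, hs⟩ := h4 d (ε / 2) (by positivity)
    exact ⟨s, fun w hw hd => (hs w hw hd.le).trans_lt (by linarith)⟩

/-- The properties of the series `g⁻¹ e_1 g` that are used in the sequel. -/
structure IsAd (u : NCSeries (Letter N) A) : Prop where
  agrees : AgreesUpTo 1 u
  isNull : IsNull u
  isPrimitive : IsPrimitive u

variable [IsUltrametricDist A] [NeZero N]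

theorem isAd_of_mul_eq {g u : NCSeries (Letter N) A} (hg : IsGroupLike g)
    (h1 : VanishBelow 1 (1 - g)) (hn : IsNull g) (hu : g * u = X (some 0) * g) : IsAd u := by
  have e1 : u = geomInv g * (X (some 0) * g) := by
    rw [← hu, ← mul_assoc, geomInv_mul h1, one_mul]
  have triv (f : NCSeries (Letter N) A) : VanishBelow 0 f := fun w hw => by simp at hw
  have hv : VanishBelow 1 u := by
    rw [e1]; exact (triv _).mul ((vanishBelow_X_some 0).mul (triv g))
  have hX : IsPrimitive (X (some 0) : NCSeries (Letter N) A) := coprod_X _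
  refine ⟨fun w hw => ?_, ?_, hg.isPrimitive_conj (geomInv_mul h1) hX hu⟩
  -- The two corrections to e_1 are products of two series without terms of depth 0, so they begin
  -- in depth 2.
  · have e2 : u = X (some 0) - X (some 0) * (1 - g) + (1 - g) * u := by
      rw [sub_mul, hu]; noncomm_ring
    have h2 := (h1.mul hv) w (by omega)
    have h3 := ((vanishBelow_X_some (A := A) (0 : ZMod N)).mul h1) w (by omega)
    conv_lhs => rw [e2]
    rw [NCSeries.add_apply, NCSeries.sub_apply, h2, h3, sub_zero, add_zero]
  · rw [e1]; exact (isNull_geomInv h1 hn).mul ((isNull_X _).mul hn)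

omit [IsUltrametricDist A] in
theorem ihara_singleton {u : NCSeries (Letter N) A} (hu : AgreesUpTo 1 u)
    (f : NCSeries (Letter N) A) (h : VanishBelow 1 (1 - f)) (a : Letter N) :
    ihara u f [a] = f [a] := by
  have hU := letterSubst_nil hu.vanishBelow.nil
  have h1 : ihara u (1 - f) [a] = (1 - f) [a] :=
    ihara_apply_of_vanishBelow hu fun v hv => h v (lt_of_lt_of_le hv (by cases a <;> simp))
  rw [ihara, subst_sub, subst_one hU, NCSeries.sub_apply, NCSeries.sub_apply] at h1
  exact sub_right_injective h1

/-- The set of the series `g⁻¹ e_1 g`. -/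
def adSet (N : ℕ) (A : Type*) [NormedCommRing A] : Set (NCSeries (Letter N) A) :=
  {u | ∃ g, (IsGroupLike g ∧ g [none] = 0 ∧ g [some 0] = 0 ∧ IsNull g) ∧ g * u = X (some 0) * g}

variable (hA : ∀ n : ℕ, n ≠ 0 → IsUnit (n : A))

include hA

theorem isAd_of_mem {u : NCSeries (Letter N) A} (hu : u ∈ adSet N A) : IsAd u := by
  obtain ⟨g, ⟨h1, h2, _, h4⟩, h5⟩ := hu
  exact isAd_of_mul_eq h1 (vanishBelow_one_sub hA h1 h2) h4 h5

omit hA [IsUltrametricDist A] in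
theorem X_mem_adSet : (X (some 0) : NCSeries (Letter N) A) ∈ adSet N A := by
  refine ⟨1, ⟨⟨rfl, ?_⟩, rfl, rfl, isNull_one⟩, by simp⟩
  rw [coprod_one, tensor_one_one]

theorem ihara_mem_adSet {u v : NCSeries (Letter N) A} (hu : u ∈ adSet N A) (hv : v ∈ adSet N A) :
    ihara u v ∈ adSet N A := by
  have hu' := isAd_of_mem hA hu
  obtain ⟨g, ⟨h1, h2, h3, h4⟩, h5⟩ := hu
  obtain ⟨f, ⟨k1, k2, k3, k4⟩, k5⟩ := hv
  have hU := letterSubst_nil hu'.agrees.vanishBelow.nil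
  have hf := vanishBelow_one_sub hA k1 k2
  -- The conjugating series is the Ihara product of g and f: substitution sends f v = e_1 f to (u ∘
  -- f)(u ∘ v) = u (u ∘ f), and g u = e_1 g.
  refine ⟨g * ihara u f, ⟨h1.mul (k1.subst hU (isPrimitive_letterSubst hu'.isPrimitive)), ?_, ?_,
    h4.mul (isNull_ihara hu'.isNull hu'.agrees.vanishBelow k4)⟩, ?_⟩
  · rw [mul_singleton, ihara_singleton hu'.agrees f hf, h2, k2]; simp
  · rw [mul_singleton, ihara_singleton hu'.agrees f hf, h3, k3]; simp
  · rw [mul_assoc, ihara, ihara, ← subst_mul hU, k5, subst_mul hU, subst_X hU, letterSubst_some,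
      rot_zero, ← mul_assoc, h5, mul_assoc]

theorem exists_ihara_eq_X {u : NCSeries (Letter N) A} (hu : u ∈ adSet N A) :
    ∃ v ∈ adSet N A, ihara u v = X (some 0) := by
  have hu' := isAd_of_mem hA hu
  obtain ⟨g, ⟨h1, h2, h3, h4⟩, h5⟩ := hu
  have hU := letterSubst_nil hu'.agrees.vanishBelow.nil
  have hg := vanishBelow_one_sub hA h1 h2
  have hi := h1.inv (mul_geomInv hg) (geomInv_mul hg)
  -- The inverse of u is h⁻¹ e_1 h with u ∘ h = g⁻¹: substitution then turns it into g u g⁻¹ = e_1.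
  set h := iharaInv u (geomInv g) with hh
  have e : ihara u h = geomInv g := ihara_iharaInv hu'.agrees _
  have hgl : IsGroupLike h := isGroupLike_of_ihara hu'.agrees hu'.isPrimitive (e ▸ hi)
  have hgi (a : Letter N) : geomInv g [a] = -g [a] := by
    have := congrArg (fun f => f [a]) (mul_geomInv hg)
    simp only [mul_singleton, h1.1, hi.1, one_cons, one_mul, mul_one] at this
    exact eq_neg_of_add_eq_zero_left this
  have e0 : h [none] = 0 := by
    have : ihara u h [none] = h [none] :=
      ihara_apply_of_vanishBelow hu'.agrees fun v hv => by simp at hv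
    rw [← this, e, hgi, h2, neg_zero]
  have hhv := vanishBelow_one_sub hA hgl e0
  have hn : IsNull h := isNull_iharaInv hu'.isNull hu'.agrees (isNull_geomInv hg h4)
  have e1 : h [some 0] = 0 := by
    rw [← ihara_singleton hu'.agrees h hhv, e, hgi, h3, neg_zero]
  have hv : h * (geomInv h * (X (some 0) * h)) = X (some 0) * h := by
    rw [← mul_assoc, mul_geomInv hhv, one_mul]
  refine ⟨_, ⟨h, ⟨hgl, e0, e1, hn⟩, hv⟩, ?_⟩
  have h6 : geomInv g * ihara u (geomInv h * (X (some 0) * h)) = u * geomInv g := by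
    rw [← e, ihara, ihara, ← subst_mul hU, hv, subst_mul hU, subst_X hU, letterSubst_some, rot_zero]
  calc ihara u (geomInv h * (X (some 0) * h))
      = g * (geomInv g * ihara u (geomInv h * (X (some 0) * h))) := by
        rw [← mul_assoc g, mul_geomInv hg, one_mul]
    _ = _ := by rw [h6, ← mul_assoc, h5, mul_assoc, mul_geomInv hg, mul_one]

omit [IsUltrametricDist A] [NeZero N] in
theorem mem_adSet_iff (u : NCSeries (Letter N) A) :
    (∃ g : Series N A, IsPiTildeSigma g ∧ mul g u = mul (letter (some 0)) g) ↔ u ∈ adSet N A :=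
  exists_congr fun g => and_congr (isPiTildeSigma_iff hA g) Iff.rfl

theorem AdGroup.isAd (u : AdGroup N A) : IsAd (show NCSeries (Letter N) A from u.val) :=
  isAd_of_mem hA ((mem_adSet_iff hA _).1 u.property)

/-- The group law given by the adjoint Ihara product. -/
@[reducible] noncomputable def adGroupGroup : Group (AdGroup N A) :=
  letI : Mul (AdGroup N A) := ⟨fun u v => ⟨ihara u.val v.val, (mem_adSet_iff hA _).2
    (ihara_mem_adSet hA ((mem_adSet_iff hA _).1 u.property) ((mem_adSet_iff hA _).1 v.property))⟩⟩
  letI : One (AdGroup N A) := ⟨⟨X (some 0), (mem_adSet_iff hA _).2 X_mem_adSet⟩⟩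
  have inv (u : AdGroup N A) : ∃ v : AdGroup N A, u * v = 1 := by
    obtain ⟨v, hv, h⟩ := exists_ihara_eq_X hA ((mem_adSet_iff hA _).1 u.property)
    exact ⟨⟨v, (mem_adSet_iff hA _).2 hv⟩, Subtype.ext h⟩
  letI : Inv (AdGroup N A) := ⟨fun u => (inv u).choose⟩
  Group.ofRightAxioms
    (fun u v w => Subtype.ext (ihara_assoc (AdGroup.isAd hA u).agrees.vanishBelow.nil
      (AdGroup.isAd hA v).agrees.vanishBelow.nil w.val))
    (fun u => Subtype.ext ((ihara_X_some (AdGroup.isAd hA u).agrees.vanishBelow.nil 0).trans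
      (rot_zero _)))
    (fun u => (inv u).choose_spec)

theorem adGroupGroup_mul (u v : AdGroup N A) :
    (letI := adGroupGroup (N := N) hA; u * v).val = ihara u.val v.val := rfl

theorem adGroupGroup_one :
    (letI := adGroupGroup (N := N) hA; (1 : AdGroup N A)).val = X (some 0) := rfl

end Group

/-! ### The harmonic action -/

section Scaling

variable {N : ℕ} {A : Type*}

/-- The series `tauAd n u`. -/
def tau [CommRing A] (n : ℕ) (u : NCSeries (Letter N) A) : NCSeries (Letter N) A :=
  fun w => (n : A) ^ (w.length - 1) * u w

section

variable [CommRing A]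

@[simp] theorem tau_apply (n : ℕ) (u : NCSeries (Letter N) A) (w : Word N) :
    tau n u w = (n : A) ^ (w.length - 1) * u w := rfl

theorem rot_tau (n : ℕ) (j : ZMod N) (u : NCSeries (Letter N) A) : rot j (tau n u) = tau n (rot j u) := by
  ext w; simp

theorem AgreesUpTo.tau {D : ℕ} {u : NCSeries (Letter N) A} (hu : AgreesUpTo D u) (n : ℕ) :
    AgreesUpTo D (tau n u) := by
  intro w hw
  rw [tau_apply, hu w hw, X]
  split
  · subst w; simp
  · simp

/-- Homogeneity: replacing one letter by a word of weight k adds weight k - 1, which is the exponent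
in `tau`. These exponents add up to the difference of the lengths. -/
theorem wordSubst_tau {u : NCSeries (Letter N) A} (hu : u [] = 0) (n : ℕ) {v w : Word N}
    (h : v.length ≤ w.length) : wordSubst (letterSubst (tau n u)) v w =
      (n : A) ^ (w.length - v.length) * wordSubst (letterSubst u) v w := by
  have htu : tau n u [] = 0 := by simp [hu]
  induction v generalizing w with
  | nil => cases w <;> simp
  | cons a v ih =>
    rw [wordSubst_cons, wordSubst_cons]
    cases a with
    | none =>
      rcases w with _ | ⟨b, w⟩
      · simp
      · rw [letterSubst_none, letterSubst_none, X_mul_cons, X_mul_cons]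
        split
        · rw [ih (by simpa using h)]; simp
        · simp
    | some j =>
      rw [mul_apply, mul_apply, Finset.mul_sum]
      refine Finset.sum_congr rfl fun i hi => ?_
      rw [letterSubst_some, letterSubst_some, rot_tau, tau_apply]
      by_cases h0 : (w.take i) = []
      · have : rot j u (w.take i) = 0 := by rw [h0]; exact hu
        rw [this]; simp
      · by_cases h1 : v.length ≤ (w.drop i).length
        · rw [ih h1]
          have hp : 0 < (w.take i).length := List.length_pos_iff.2 h0
          have hl := congrArg List.length (List.take_append_drop i w)
          rw [List.length_append] at hl
          rw [List.length_cons, show w.length - (v.length + 1) =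
            ((w.take i).length - 1) + ((w.drop i).length - v.length) by omega, pow_add]
          ring
        · rw [wordSubst_eq_zero_of_length_lt (letterSubst_nil htu) (by omega),
            wordSubst_eq_zero_of_length_lt (letterSubst_nil hu) (by omega)]
          simp

theorem ihara_tau [NeZero N] {u v : NCSeries (Letter N) A} (hu : u [] = 0) (hv : v [] = 0) (n : ℕ) :
    ihara (tau n u) (tau n v) = tau n (ihara u v) := by
  ext w
  rw [tau_apply, ihara, ihara, subst, subst, Finset.mul_sum]
  refine Finset.sum_congr rfl fun m hm => ?_
  rw [Finset.mul_sum]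
  refine Finset.sum_congr rfl fun x _ => ?_
  have hm : m ≤ w.length := by simpa [Nat.lt_succ_iff] using hm
  rw [wordSubst_tau hu n (by simpa using hm), tau_apply, List.length_ofFn,
    Algebra.algebraMap_self, RingHom.id_apply, RingHom.id_apply]
  rcases Nat.eq_zero_or_pos m with rfl | h0
  · simp [hv]
  · rw [show w.length - 1 = (m - 1) + (w.length - m) by omega, pow_add]
    ring

end

variable [NormedCommRing A] [IsUltrametricDist A]

/-- An ultrametric sum of n copies of x. The bound is on the product because the norm of n in `A`
may exceed 1 when that of 1 does. -/
theorem norm_natCast_mul_le (n : ℕ) (x : A) : ‖(n : A) * x‖ ≤ ‖x‖ := by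
  induction n with
  | zero => simp
  | succ n ih =>
    rw [Nat.cast_succ, add_mul, one_mul]
    exact (IsUltrametricDist.norm_add_le_max _ _).trans (max_le ih le_rfl)

theorem norm_natCast_pow_mul_le (n k : ℕ) (x : A) : ‖(n : A) ^ k * x‖ ≤ ‖x‖ := by
  rw [← Nat.cast_pow]
  exact norm_natCast_mul_le _ x

theorem IsNull.tau {u : NCSeries (Letter N) A} (hu : IsNull u) (n : ℕ) : IsNull (tau n u) := by
  intro d ε hε
  obtain ⟨s, hs⟩ := hu d ε hε
  exact ⟨s, fun w h1 h2 => (norm_natCast_pow_mul_le n _ _).trans (hs w h1 h2)⟩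

end Scaling

/-! ### Existence and composition of the limits along e_0^l w. -/

section Limit

variable {N : ℕ} {A : Type*}

/-- As U vanishes on powers of e_0, the cut of the word cannot fall inside the leading e_0's. -/
theorem mul_replicate_append [Ring A] {U : NCSeries (Letter N) A}
    (hU : ∀ k, U (List.replicate k none) = 0)
    (F : NCSeries (Letter N) A) (k : ℕ) (w : Word N) :
    (U * F) (List.replicate k none ++ w) = ∑ i ∈ Finset.range (w.length + 1),
      U (List.replicate k none ++ w.take i) * F (w.drop i) := by
  induction k generalizing U with
  | zero => rfl
  | succ k ih =>
    have h0 : U [] = 0 := hU 0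
    rw [List.replicate_succ, List.cons_append, mul_cons, h0, zero_mul, zero_add,
      ih fun k => hU (k + 1)]
    rfl

theorem ihara_eq [CommRing A] [NeZero N] {u : NCSeries (Letter N) A} (hu : u [] = 0)
    (f : NCSeries (Letter N) A) : ihara u f = const (f []) + (X none * ihara u (f.tail none) +
      ∑ j, rot j u * ihara u (f.tail (some j))) := by
  rw [ihara, subst_eq (letterSubst_nil hu), Fintype.sum_option]
  rfl

theorem exists_replicate_append (w : Word N) : ∃ (m : ℕ) (w' : Word N),
    w = List.replicate m none ++ w' ∧ (w' = [] ∨ ∃ i v, w' = some i :: v) := by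
  induction w with
  | nil => exact ⟨0, [], rfl, .inl rfl⟩
  | cons a w ih =>
    cases a with
    | none =>
      obtain ⟨m, w', rfl, h⟩ := ih
      exact ⟨m + 1, w', rfl, h⟩
    | some i => exact ⟨0, some i :: w, rfl, .inr ⟨i, w, rfl⟩⟩

theorem HarSpace.tail (f : HarSpace N A) :
    NCSeries.tail none (show NCSeries (Letter N) A from f.val) = f.val :=
  NCSeries.ext fun w => f.property 1 w

theorem apply_replicate_append {f : NCSeries (Letter N) A} (hf : f.tail none = f) (l : ℕ)
    (w : Word N) : f (List.replicate l none ++ w) = f w := by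
  induction l with
  | zero => rfl
  | succ l ih => rw [← ih]; exact congrFun hf _

variable [NormedCommRing A] [NeZero N]

/-- Since f is its own tail along e_0, the recursion for substitution telescopes: each leading e_0
adds one term to partial sums over k of coefficients at e_0^k w'. Convergence as l tends to infinity
is thus convergence of the series in `zeroSum`. -/
theorem ihara_replicate_append {U f : NCSeries (Letter N) A} (hU : VanishBelow 1 U)
    (hf : f.tail none = f) (l : ℕ) (i : ZMod N) (w : Word N) :
    ihara U f (List.replicate l none ++ some i :: w) =
      ∑ j, ∑ r ∈ Finset.range ((some i :: w).length + 1),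
        (∑ k ∈ Finset.range (l + 1), rot j U (List.replicate k none ++ (some i :: w).take r)) *
          ihara U (f.tail (some j)) ((some i :: w).drop r) := by
  have hU0 (j : ZMod N) (k : ℕ) : rot j U (List.replicate k none) = 0 := hU.rot j _ (by simp)
  induction l with
  | zero =>
    rw [ihara_eq hU.nil]
    simp only [List.replicate_zero, List.nil_append, NCSeries.add_apply, const_cons, zero_add,
      NCSeries.sum_apply, Finset.sum_range_one, X_mul_cons]
    simp [mul_apply]
  | succ l ih =>
    have h (j : ZMod N) := mul_replicate_append (hU0 j) (ihara U (f.tail (some j))) (l + 1)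
      (some i :: w)
    rw [ihara_eq hU.nil, hf, NCSeries.add_apply, NCSeries.add_apply, NCSeries.sum_apply,
      Finset.sum_congr rfl fun j _ => h j, List.replicate_succ, List.cons_append, const_cons,
      X_mul_cons, if_pos rfl, zero_add, ih, ← Finset.sum_add_distrib]
    refine Finset.sum_congr rfl fun j _ => ?_
    rw [← Finset.sum_add_distrib]
    refine Finset.sum_congr rfl fun r _ => ?_
    rw [Finset.sum_range_succ _ (l + 1), add_mul]
    rfl

theorem ihara_apply_of_depth_eq_zero {U : NCSeries (Letter N) A} (hU : AgreesUpTo 1 U)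
    (f : NCSeries (Letter N) A) {w : Word N} (hw : depth w = 0) : ihara U f w = f w :=
  ihara_apply_of_vanishBelow hU fun v hv => by omega

variable [IsUltrametricDist A]

omit [NeZero N] [IsUltrametricDist A] in
-- The first letter of v other than e_0 has an image of depth at least 1, which must absorb all the
-- e_0's left and at least one further letter. What follows then has to fit in w.
theorem exists_replicate_of_wordSubst_ne_zero {U : NCSeries (Letter N) A} (hU : VanishBelow 1 U)
    (l : ℕ) {v w : Word N} (h : wordSubst (letterSubst U) v (List.replicate l none ++ w) ≠ 0) :
    ∃ (m : ℕ) (v' : Word N), v = List.replicate m none ++ v' ∧ v'.length ≤ w.length := by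
  have hlen {v w : Word N} (h : wordSubst (letterSubst U) v w ≠ 0) : v.length ≤ w.length := by
    by_contra hc
    exact h (wordSubst_eq_zero_of_length_lt (letterSubst_nil hU.nil) (by omega))
  induction l generalizing v with
  | zero => exact ⟨0, v, rfl, hlen h⟩
  | succ l ih =>
    cases v with
    | nil => exact ⟨0, [], rfl, by simp⟩
    | cons a v =>
      rw [wordSubst_cons] at h
      cases a with
      | none =>
        rw [List.replicate_succ, List.cons_append, letterSubst_none, X_mul_cons, if_pos rfl] at h
        obtain ⟨m, v', rfl, hv⟩ := ih h
        exact ⟨m + 1, v', rfl, hv⟩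
      | some j =>
        refine ⟨0, some j :: v, rfl, ?_⟩
        rw [letterSubst_some, mul_replicate_append fun k => hU.rot j _ (by simp)] at h
        obtain ⟨i, hi, h⟩ := Finset.exists_ne_zero_of_sum_ne_zero h
        have h1 := hlen (right_ne_zero_of_mul h)
        by_contra hc
        apply left_ne_zero_of_mul h
        have : i = 0 ∨ w.length = 0 := by
          simp only [List.length_drop, List.length_cons] at h1 hc
          omega
        have : w.take i = [] := by
          rcases this with rfl | h
          · simp
          · simp [List.length_eq_zero_iff.1 h]
        rw [this, List.append_nil]
        exact hU.rot j _ (by simp)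

/-- This allows f to be replaced by its limit inside a further substitution. Only the words e_0^m v'
with v' no longer than w contribute. For large m the coefficient of D is small, and finitely many
words remain, whose images are null. -/
theorem tendsto_ihara_zero {U D : NCSeries (Letter N) A} (hU : VanishBelow 1 U) (hn : IsNull U)
    (hD : ∀ w, Tendsto (fun l : ℕ => D (List.replicate l none ++ w)) atTop (𝓝 0)) (w : Word N) :
    Tendsto (fun l : ℕ => ihara U D (List.replicate l none ++ w)) atTop (𝓝 0) := by
  rw [Metric.tendsto_atTop]
  intro ε hε
  obtain ⟨C, hC0, hC⟩ := norm_wordSubst_le hn hU (depth w)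
  have hM (v : Word N) : ∃ M : ℕ, ∀ m ≥ M, ‖D (List.replicate m none ++ v)‖ ≤ ε / 2 / C := by
    obtain ⟨M, hM⟩ := Metric.tendsto_atTop.1 (hD v) (ε / 2 / C) (by positivity)
    exact ⟨M, fun m hm => by simpa using (hM m hm).le⟩
  choose M hM using hM
  have hF := List.finite_length_le (Letter N) w.length
  obtain ⟨B, hB⟩ := (hF.image M).bddAbove
  obtain ⟨s, hs⟩ := hn.exists_forall_mul_wordSubst D
    (Set.Finite.image2 (fun m v => List.replicate m none ++ v) (Set.finite_lt_nat B) hF)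
    (depth w) (ε := ε / 2) (by positivity)
  refine ⟨s, fun l hl => ?_⟩
  rw [dist_zero_right]
  refine (norm_ihara_le (ε := ε / 2) (by positivity) fun v hv => ?_).trans_lt (by linarith)
  obtain ⟨m, v', rfl, hv'⟩ := exists_replicate_of_wordSubst_ne_zero hU l (right_ne_zero_of_mul hv)
  by_cases hm : m < B
  · exact hs _ ⟨m, hm, v', hv', rfl⟩ _ (by simp; omega) (by simp)
  · refine (norm_mul_le _ _).trans ?_
    calc _ ≤ ε / 2 / C * C := by
          gcongr
          · exact hM v' m (le_trans (hB ⟨v', hv', rfl⟩) (by omega))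
          · exact hC _ _ (by simp)
      _ = ε / 2 := by field_simp

variable [CompleteSpace A]

omit [NeZero N] in
theorem IsNull.hasSum {U : NCSeries (Letter N) A} (hU : IsNull U) (w : Word N) :
    Summable fun k : ℕ => U (List.replicate k none ++ w) := by
  refine NonarchimedeanAddGroup.summable_of_tendsto_cofinite_zero ?_
  rw [Nat.cofinite_eq_atTop, Metric.tendsto_atTop]
  intro ε hε
  obtain ⟨s, hs⟩ := hU (depth w) (ε / 2) (by positivity)
  refine ⟨s, fun k hk => ?_⟩
  rw [dist_zero_right]
  exact (hs _ (by simp; omega) (by simp)).trans_lt (by linarith)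

/-- The sum of the coefficients of the words `e_0 ^ k w`. -/
noncomputable def zeroSum (U : NCSeries (Letter N) A) (w : Word N) : A :=
  ∑' k : ℕ, U (List.replicate k none ++ w)

theorem tendsto_ihara_some {U f : NCSeries (Letter N) A} (hU : VanishBelow 1 U) (hn : IsNull U)
    (hf : f.tail none = f) (i : ZMod N) (w : Word N) :
    Tendsto (fun l : ℕ => ihara U f (List.replicate l none ++ some i :: w)) atTop
      (𝓝 (∑ j, ∑ r ∈ Finset.range ((some i :: w).length + 1),
        zeroSum (rot j U) ((some i :: w).take r) *
          ihara U (f.tail (some j)) ((some i :: w).drop r))) := by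
  simp only [ihara_replicate_append hU hf]
  refine tendsto_finsetSum _ fun j _ => tendsto_finsetSum _ fun r _ => Tendsto.mul_const _ ?_
  exact ((hn.rot j).hasSum _).hasSum.tendsto_sum_nat.comp (tendsto_add_atTop_nat 1)

theorem exists_tendsto_ihara {U f : NCSeries (Letter N) A} (hU : AgreesUpTo 1 U) (hn : IsNull U)
    (hf : f.tail none = f) (w : Word N) :
    ∃ L, Tendsto (fun l : ℕ => ihara U f (List.replicate l none ++ w)) atTop (𝓝 L) := by
  obtain ⟨m, w', rfl, rfl | ⟨i, v, rfl⟩⟩ := exists_replicate_append w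
  · refine ⟨f [], tendsto_const_nhds.congr fun l => ?_⟩
    rw [ihara_apply_of_depth_eq_zero hU _ (by simp), apply_replicate_append hf,
      apply_replicate_append hf]
  · refine ⟨_, ((tendsto_ihara_some hU.vanishBelow hn hf i v).comp
      (tendsto_add_atTop_nat m)).congr fun l => ?_⟩
    simp only [Function.comp_apply, List.replicate_add, List.append_assoc]

/-- The harmonic Ihara action on one series. -/
noncomputable def harLim (U f : NCSeries (Letter N) A) : NCSeries (Letter N) A := fun w =>
  limUnder atTop fun l : ℕ => ihara U f (List.replicate l none ++ w)

theorem tendsto_harLim {U f : NCSeries (Letter N) A} (hU : AgreesUpTo 1 U) (hn : IsNull U)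
    (hf : f.tail none = f) (w : Word N) :
    Tendsto (fun l : ℕ => ihara U f (List.replicate l none ++ w)) atTop (𝓝 (harLim U f w)) :=
  tendsto_nhds_limUnder (exists_tendsto_ihara hU hn hf w)

theorem tail_harLim {U f : NCSeries (Letter N) A} (hU : AgreesUpTo 1 U) (hn : IsNull U)
    (hf : f.tail none = f) : (harLim U f).tail none = harLim U f := by
  ext w
  refine tendsto_nhds_unique (tendsto_harLim hU hn hf (none :: w))
    (((tendsto_harLim hU hn hf w).comp (tendsto_add_atTop_nat 1)).congr fun l => ?_)
  simp only [Function.comp_apply, List.replicate_add, List.append_assoc]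
  rfl

/-- By associativity, the error made by taking the inner limit first is the substitution of U in V ∘
f - lim (V ∘ f), which tends to 0. This is the law of an action. -/
theorem harLim_ihara {U V f : NCSeries (Letter N) A} (hU : AgreesUpTo 1 U) (hn : IsNull U)
    (hV : AgreesUpTo 1 V) (hVn : IsNull V) (hf : f.tail none = f)
    (w : Word N) : Tendsto (fun l : ℕ => ihara (ihara U V) f (List.replicate l none ++ w)) atTop
      (𝓝 (harLim U (harLim V f) w)) := by
  have h1 := tendsto_harLim hU hn (tail_harLim hV hVn hf) w
  have h2 := tendsto_ihara_zero (D := ihara V f - harLim V f) hU.vanishBelow hn (fun v => by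
    have h3 (l : ℕ) := apply_replicate_append (tail_harLim hV hVn hf) l v
    simpa [h3] using (tendsto_harLim hV hVn hf v).sub_const (harLim V f v)) w
  refine (by simpa using h2.add h1 : Tendsto _ _ _).congr fun l => ?_
  rw [ihara_assoc hU.vanishBelow.nil hV.vanishBelow.nil]
  have : ihara U (ihara V f - harLim V f) = ihara U (ihara V f) - ihara U (harLim V f) :=
    subst_sub _ _
  rw [this, NCSeries.sub_apply, sub_add_cancel]

variable (hA : ∀ n : ℕ, n ≠ 0 → IsUnit (n : A)) (S : Set ℕ)

include hA in
theorem AdGroup.tendsto (u : AdGroup N A) (n : ℕ) (f : HarSpace N A) (w : Word N) :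
    Tendsto (fun l : ℕ => ihara (tau n u.val) f.val (List.replicate l none ++ w)) atTop
      (𝓝 (harLim (tau n u.val) f.val w)) :=
  tendsto_harLim ((AdGroup.isAd hA u).agrees.tau n) ((AdGroup.isAd hA u).isNull.tau n) f.tail w

/-- The harmonic Ihara action. -/
@[reducible] noncomputable def harAction :
    letI := adGroupGroup (N := N) hA
    MulAction (AdGroup N A) (S → HarSpace N A) :=
  letI := adGroupGroup (N := N) hA
  { smul := fun u h n => ⟨harLim (tau n u.val) (h n).val,
      apply_replicate_append (tail_harLim ((AdGroup.isAd hA u).agrees.tau n)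
        ((AdGroup.isAd hA u).isNull.tau n) (h n).tail)⟩
    one_smul := fun h => by
      funext n
      refine Subtype.ext (funext fun w => ?_)
      refine tendsto_nhds_unique (AdGroup.tendsto hA 1 n (h n) w)
        (tendsto_const_nhds.congr fun l => ?_)
      have : tau (n : ℕ) (X (some 0) : NCSeries (Letter N) A) = X (some 0) := by
        ext w
        rw [tau_apply, X]
        split
        · subst w; simp
        · simp
      rw [adGroupGroup_one hA, this]
      exact ((h n).property l w).symm.trans (congrFun (X_ihara (A := A) (h n).val) _).symm
    mul_smul := fun u v h => by
      funext n
      refine Subtype.ext (funext fun w => ?_)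
      refine tendsto_nhds_unique (AdGroup.tendsto hA (u * v) n (h n) w) ?_
      have hu := AdGroup.isAd hA u
      have hv := AdGroup.isAd hA v
      rw [adGroupGroup_mul hA, ← ihara_tau hu.agrees.vanishBelow.nil hv.agrees.vanishBelow.nil]
      exact harLim_ihara (hu.agrees.tau n) (hu.isNull.tau n) (hv.agrees.tau n) (hv.isNull.tau n)
        (h n).tail w }

theorem isHarmonicIharaAction :
    letI := adGroupGroup (N := N) hA
    letI := harAction (N := N) hA S
    IsHarmonicIharaAction N A S := by
  refine ⟨fun u v => (adIhara_eq _ _).symm, fun u h n w => ?_⟩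
  rw [show (fun l : ℕ => adIhara (tauAd n u.val) (h n).val (List.replicate l none ++ w)) =
    fun l : ℕ => ihara (tau n u.val) (h n).val (List.replicate l none ++ w) from
      funext fun l => congrFun (adIhara_eq _ _) _]
  exact AdGroup.tendsto hA u n (h n) w

end Limit

/-! ### Stabilizers -/

section Trailing

variable {N : ℕ} {A : Type*} [CommRing A]

theorem coprod_none_some_replicate (f : NCSeries (Letter N) A) (l : ZMod N) (b : ℕ) :
    coprod f [none] (some l :: List.replicate b none) = f (none :: some l :: List.replicate b none) +
      (b + 1 : ℕ) * f (some l :: List.replicate (b + 1) none) := by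
  rw [coprod_cons_cons, coprod_nil_left, coprod_none_replicate]
  rfl

/-- Shuffling `e_0` into `x e_{z_l} e_0 ^ b`: the shuffles that do not end with `e_0 ^ (b + 1)`
end with `e_{z_l} e_0 ^ b`. -/
theorem coprod_none_eq (f : NCSeries (Letter N) A) (l : ZMod N) (b : ℕ) {D : ℕ} (x : Word N)
    (hx : depth x = D)
    (h : ∀ z, depth z = D → f (z ++ some l :: List.replicate b none) = 0) :
    coprod f [none] (x ++ some l :: List.replicate b none) =
      (b + 1 : ℕ) * f (x ++ some l :: List.replicate (b + 1) none) := by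
  induction x generalizing f D with
  | nil =>
    have h0 := h [none] (by simpa using hx)
    rw [List.nil_append, coprod_none_some_replicate]
    simp only [List.cons_append, List.nil_append] at h0
    rw [h0, zero_add, List.nil_append]
  | cons a x ih =>
    have h0 := h (none :: a :: x) (by simpa using hx)
    rw [List.cons_append, coprod_cons_cons, coprod_nil_left,
      ih (f.tail a) (D := depth x) rfl fun z hz => ?_]
    · rw [tail_apply, ← List.cons_append, ← List.cons_append, h0, zero_add]
      rfl
    · refine h (a :: z) ?_
      cases a <;> simp_all

theorem exists_append_some {w : Word N} (h : depth w ≠ 0) :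
    ∃ x l b, w = x ++ some l :: List.replicate b none := by
  induction w with
  | nil => simp at h
  | cons a w ih =>
    by_cases hw : depth w = 0
    · cases a with
      | none => simp [hw] at h
      | some l =>
        refine ⟨[], l, w.length, ?_⟩
        rw [← eq_replicate_of_depth_eq_zero hw, List.nil_append]
    · obtain ⟨x, l, b, rfl⟩ := ih hw
      exact ⟨a :: x, l, b, rfl⟩

/-- Induction on the number of trailing e_0's. A primitive series vanishes on the shuffles of e_0
with a non-empty word, and this relation expresses one more trailing e_0 through words with fewer.
-/
theorem apply_eq_zero_of_primitive (hA : ∀ n : ℕ, n ≠ 0 → IsUnit (n : A))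
    {u : NCSeries (Letter N) A} (hu : IsPrimitive u) {D : ℕ}
    (h : ∀ x l, depth x = D → u (x ++ [some l]) = 0) {w : Word N} (hw : depth w = D + 1) :
    u w = 0 := by
  obtain ⟨x, l, b, rfl⟩ := exists_append_some (w := w) (by omega)
  have hx : depth x = D := by simpa using hw
  clear hw
  induction b generalizing x with
  | zero => exact h x l hx
  | succ b ih =>
    have h1 := coprod_none_eq u l b x hx ih
    have h2 : coprod u [none] (x ++ some l :: List.replicate b none) = 0 := by
      obtain ⟨c, v, e⟩ := List.exists_cons_of_ne_nil (l := x ++ some l :: List.replicate b none)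
        (by simp)
      rw [e, hu, primitivePart_apply, one_cons, one_cons, zero_mul, mul_zero, add_zero]
    rw [h2] at h1
    exact (hA (b + 1) b.succ_ne_zero).mul_right_eq_zero.1 h1.symm

theorem AgreesUpTo.succ (hA : ∀ n : ℕ, n ≠ 0 → IsUnit (n : A)) {u : NCSeries (Letter N) A}
    (hu : IsPrimitive u) {D : ℕ} (hD : 1 ≤ D) (h : AgreesUpTo D u)
    (H : ∀ (r : ℕ) (i l : ZMod N) (x : Word N), depth x + 2 = D + 1 →
      u (List.replicate r none ++ some i :: x ++ [some l]) = 0) : AgreesUpTo (D + 1) u := by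
  intro w hw
  rcases hw.lt_or_eq with hw | hw
  · exact h w (by omega)
  · rw [X, if_neg, apply_eq_zero_of_primitive hA hu (fun x l hx => ?_) hw]
    · obtain ⟨r, x, rfl, rfl | ⟨i, x, rfl⟩⟩ := exists_replicate_append x
      · simp at hx; omega
      · exact H r i l x (by simp at hx; omega)
    · rintro rfl
      simp at hw
      omega

end Trailing

/-! ### The equations satisfied by an element of a stabilizer. -/

section Stabilizer

variable {N : ℕ} [NeZero N] {A : Type*} [NormedCommRing A]

omit [NeZero N] in
theorem replicate_append_ne_singleton {x : Word N} (j : ZMod N) (k : ℕ)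
    (h : List.replicate (k + 1) none ++ x = [some j]) : False := by
  rw [List.replicate_succ] at h
  simp at h

omit [NeZero N] in
theorem zeroSum_of_agreesUpTo {D : ℕ} {U : NCSeries (Letter N) A} (hU : AgreesUpTo D U)
    (j : ZMod N) {x : Word N} (hx : depth x ≤ D) :
    zeroSum (rot j U) x = if x = [some j] then 1 else 0 := by
  rw [zeroSum, tsum_eq_single 0]
  · exact hU.rot_apply j hx
  · intro k hk
    rw [hU.rot_apply j (by simpa), if_neg]
    obtain ⟨k, rfl⟩ := Nat.exists_eq_succ_of_ne_zero hk
    exact replicate_append_ne_singleton j k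

variable [IsUltrametricDist A] [CompleteSpace A]

/-- Prefixes of depth at most D contribute only through the single letter e_{z_i}. A prefix of depth
more than D leaves a suffix of depth at most 1, on which the substitution acts trivially. -/
theorem harLim_apply_of_agreesUpTo {D : ℕ} (hD : 1 ≤ D) {U f : NCSeries (Letter N) A}
    (hU : AgreesUpTo D U) (hn : IsNull U) (hf : f.tail none = f) (i : ZMod N) (w : Word N)
    (hw : depth w ≤ D + 1) :
    harLim U f (some i :: w) = ihara U (f.tail (some i)) w +
      ∑ j, ∑ r ∈ (Finset.range (w.length + 2)).filter (fun r => D < depth ((some i :: w).take r)),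
        zeroSum (rot j U) ((some i :: w).take r) * f (some j :: (some i :: w).drop r) := by
  have hU1 := hU.mono hD
  rw [tendsto_nhds_unique (tendsto_harLim hU1 hn hf (some i :: w))
    (tendsto_ihara_some hU.vanishBelow hn hf i w), List.length_cons]
  have key (j : ZMod N) : ∑ r ∈ Finset.range (w.length + 2), zeroSum (rot j U) ((some i :: w).take r) *
      ihara U (f.tail (some j)) ((some i :: w).drop r) =
      (if j = i then ihara U (f.tail (some i)) w else 0) +
      ∑ r ∈ (Finset.range (w.length + 2)).filter (fun r => D < depth ((some i :: w).take r)),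
        zeroSum (rot j U) ((some i :: w).take r) * f (some j :: (some i :: w).drop r) := by
    rw [← Finset.sum_filter_not_add_sum_filter _ fun r => D < depth ((some i :: w).take r)]
    congr 1
    · rw [Finset.sum_eq_single 1]
      · rw [zeroSum_of_agreesUpTo hU j (by simpa using hD)]
        by_cases h : j = i
        · subst h; simp
        · rw [if_neg h, if_neg, zero_mul]
          simpa [eq_comm] using h
      · intro r hr hr1
        simp only [Finset.mem_filter, Finset.mem_range, not_lt] at hr
        rw [zeroSum_of_agreesUpTo hU j hr.2, if_neg, zero_mul]
        intro h
        have := congrArg List.length h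
        simp only [List.length_take, List.length_cons, List.length_nil] at this
        omega
      · intro h
        simp at h
        omega
    · refine Finset.sum_congr rfl fun r hr => ?_
      simp only [Finset.mem_filter, Finset.mem_range] at hr
      have hd := depth_take_add_drop r (some i :: w)
      rw [depth_some_cons] at hd
      rw [ihara_apply_of_agreesUpTo hD hU _ (by omega)]
      rfl
  rw [Finset.sum_congr rfl fun j _ => key j, Finset.sum_add_distrib]
  simp

omit [CompleteSpace A] [IsUltrametricDist A] [NeZero N] in
theorem depth_take_le_of_append_some {x : Word N} {l : ZMod N} {r : ℕ} (hr : r ≤ x.length) :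
    depth ((x ++ [some l]).take r) ≤ depth x := by
  rw [List.take_append_of_le_length hr]
  have := depth_take_add_drop r x
  omega

/-- The first non-trivial equation satisfied by the stabilizer. -/
theorem sum_zeroSum_mul_eq_zero {D : ℕ} (hD : 1 ≤ D) {U f : NCSeries (Letter N) A}
    (hU : AgreesUpTo D U) (hn : IsNull U) (hf : f.tail none = f) (hfix : harLim U f = f)
    (i l : ZMod N) (x : Word N) (hx : depth x + 2 = D + 1) :
    ∑ j, zeroSum (rot j U) (some i :: x ++ [some l]) * f [some j] = 0 := by
  have h := harLim_apply_of_agreesUpTo hD hU hn hf i (x ++ [some l])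
    (by rw [depth_append]; simp; omega)
  rw [hfix, ihara_apply_of_agreesUpTo hD hU _ (by rw [depth_append]; simp; omega), tail_apply,
    left_eq_add] at h
  rw [← h]
  refine Finset.sum_congr rfl fun j _ => ?_
  -- A proper prefix misses the final e_{z_l}, so its depth is at most D; only the whole word
  -- remains.
  rw [Finset.sum_eq_single (x.length + 2)]
  · rw [List.take_of_length_le (by simp), List.drop_of_length_le (by simp)]
    rfl
  · intro r hr hr'
    simp only [Finset.mem_filter, Finset.mem_range, List.length_append, List.length_singleton] at hr
    have := depth_take_le_of_append_some (x := some i :: x) (l := l) (r := r) (by simp; omega)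
    rw [depth_some_cons] at this
    simp only [List.cons_append] at this
    omega
  · intro hr
    exfalso
    apply hr
    simp only [Finset.mem_filter, Finset.mem_range, List.length_append, List.length_singleton]
    refine ⟨by omega, ?_⟩
    rw [List.take_of_length_le (by simp)]
    simp
    omega

omit [NeZero N] [CompleteSpace A] [IsUltrametricDist A] in
theorem mul_apply_of_agreesUpTo {D : ℕ} {U F : NCSeries (Letter N) A}
    (hU : AgreesUpTo D U) (j l : ZMod N) (x : Word N) (hx : depth x ≤ D) (a : ℕ) :
    (rot j U * F) (List.replicate (a + 1) none ++ (x ++ [some l])) =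
      rot j U (List.replicate (a + 1) none ++ (x ++ [some l])) * F [] := by
  rw [mul_replicate_append (fun k => hU.vanishBelow.rot j _ (by simp)),
    Finset.sum_eq_single (x.length + 1)]
  · rw [List.take_of_length_le (by simp), List.drop_of_length_le (by simp)]
  · intro r hr hr'
    have := depth_take_le_of_append_some (x := x) (l := l) (r := r) (by simp at hr; omega)
    rw [hU.rot_apply j (by simpa using by omega), if_neg (replicate_append_ne_singleton j a), zero_mul]
  · simp

omit [CompleteSpace A] [IsUltrametricDist A] in
-- In depth D + 1 the correction to the identity comes from the words v = e_0^b e_{z_j}: their e_0's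
-- are copied, and u^{(z_j)} must produce all the rest of the word.
theorem ihara_apply_of_agreesUpTo_succ {D : ℕ} (hD : 1 ≤ D) {U : NCSeries (Letter N) A}
    (hU : AgreesUpTo D U) (g : NCSeries (Letter N) A) (i l : ZMod N) (x : Word N)
    (hx : depth x + 2 = D + 1) (a : ℕ) :
    ihara U g (List.replicate a none ++ (some i :: x ++ [some l])) =
      g (List.replicate a none ++ (some i :: x ++ [some l])) +
      ∑ b ∈ Finset.range (a + 1), ∑ j,
        rot j U (List.replicate (a - b) none ++ (some i :: x ++ [some l])) *
          g (List.replicate b none ++ [some j]) := by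
  induction a generalizing g with
  | zero =>
    rw [ihara_eq hU.vanishBelow.nil]
    simp only [List.replicate_zero, List.nil_append, NCSeries.add_apply, NCSeries.sum_apply,
      List.cons_append, const_cons, X_mul_cons, zero_add, Finset.sum_range_one]
    rw [if_neg (by simp), zero_add]
    have key (j : ZMod N) : (rot j U * ihara U (g.tail (some j))) (some i :: (x ++ [some l])) =
        (if j = i then g (some i :: (x ++ [some l])) else 0) +
          rot j U (some i :: (x ++ [some l])) * g [some j] := by
      have hi : ihara U (g.tail (some i)) (x ++ [some l]) = g (some i :: (x ++ [some l])) :=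
        ihara_apply_of_agreesUpTo hD hU _ (by rw [depth_append]; simp; omega)
      have hj : ihara U (g.tail (some j)) [] = g [some j] :=
        ihara_apply_of_agreesUpTo hD hU _ (by simp)
      rw [mul_apply, Finset.sum_eq_add_of_mem 1 (x.length + 2) (by simp) (by simp) (by omega)]
      · congr 1
        · rw [hU.rot_apply j (by simpa using hD)]
          by_cases h : j = i
          · subst h; simp [hi]
          · rw [if_neg h, if_neg, zero_mul]
            simpa [eq_comm] using h
        · rw [List.take_of_length_le (by simp), List.drop_of_length_le (by simp), hj]
      · intro r hr hr'
        simp only [List.length_cons, List.length_append, List.length_nil, Finset.mem_range] at hr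
        have := depth_take_le_of_append_some (x := some i :: x) (l := l) (r := r) (by simp; omega)
        rw [depth_some_cons, List.cons_append] at this
        rw [hU.rot_apply j (by omega), if_neg, zero_mul]
        intro h
        have := congrArg List.length h
        simp only [List.length_take, List.length_append, List.length_cons, List.length_nil] at this
        omega
    rw [Finset.sum_congr rfl fun j _ => key j, Finset.sum_add_distrib]
    simp
  | succ a ih =>
    have h (j : ZMod N) : (rot j U * ihara U (g.tail (some j)))
        (List.replicate (a + 1) none ++ (some i :: x ++ [some l])) =
        rot j U (List.replicate (a + 1) none ++ (some i :: x ++ [some l])) * g [some j] := by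
      rw [mul_apply_of_agreesUpTo hU j l (some i :: x) (by simp; omega),
        ihara_apply_of_agreesUpTo hD hU _ (by simp)]
      rfl
    rw [ihara_eq hU.vanishBelow.nil, NCSeries.add_apply, NCSeries.add_apply, NCSeries.sum_apply,
      Finset.sum_congr rfl fun j _ => h j, Finset.sum_range_succ' _ (a + 1), List.replicate_succ,
      List.cons_append, X_mul_cons, if_pos rfl, ih, const_cons, zero_add, add_assoc]
    congr 2
    refine Finset.sum_congr rfl fun b _ => Finset.sum_congr rfl fun j _ => ?_
    rw [Nat.add_sub_add_right]
    rfl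

/-- The second non-trivial equation satisfied by the stabilizer. -/
theorem stabilizer_eq {D : ℕ} (hD : 1 ≤ D) {U f : NCSeries (Letter N) A}
    (hU : AgreesUpTo D U) (hn : IsNull U) (hf : f.tail none = f) (hfix : harLim U f = f)
    (i₀ i l : ZMod N) (x : Word N) (hx : depth x + 2 = D + 1) (a : ℕ) {w : Word N}
    (hw : w = some i₀ :: (List.replicate a none ++ (some i :: x ++ [some l]))) :
    ∑ b ∈ Finset.range (a + 1), ∑ j,
      rot j U (List.replicate (a - b) none ++ (some i :: x ++ [some l])) *
        f (some i₀ :: (List.replicate b none ++ [some j])) +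
    ∑ j, ∑ r ∈ (Finset.range (w.length + 1)).filter (fun r => D < depth (w.take r)),
        zeroSum (rot j U) (w.take r) * f (some j :: w.drop r) = 0 := by
  subst hw
  have h := harLim_apply_of_agreesUpTo hD hU hn hf i₀
    (List.replicate a none ++ (some i :: x ++ [some l]))
    (by rw [depth_append, depth_append]; simp; omega)
  rw [hfix, ihara_apply_of_agreesUpTo_succ hD hU _ i l x hx, tail_apply, add_assoc, left_eq_add] at h
  exact h

end Stabilizer


/-! ### Estimates of harmonic sums -/

section Estimates

variable {p : ℕ} [hp : Fact p.Prime] {K : Type*} [NormedField K] [IsUltrametricDist K]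

/-- By Bézout, 1 is an integral combination of t and p; if both had norm less than 1, so would 1. -/
theorem norm_natCast_of_not_dvd (hK : ‖(p : K)‖ = (p : ℝ)⁻¹) {t : ℕ} (ht : ¬ p ∣ t) :
    ‖(t : K)‖ = 1 := by
  refine le_antisymm (IsUltrametricDist.norm_natCast_le_one K t) ?_
  by_contra hc
  have hc := not_le.1 hc
  have hp1 : ‖(p : K)‖ < 1 := by
    rw [hK]; exact inv_lt_one_of_one_lt₀ (by exact_mod_cast hp.out.one_lt)
  have hb : ((t * Nat.gcdA t p + p * Nat.gcdB t p : ℤ) : K) = 1 := by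
    rw [← Nat.gcd_eq_gcd_ab, ((hp.out.coprime_iff_not_dvd).2 ht).symm.gcd_eq_one]; simp
  have hz (z : ℤ) : ‖(z : K)‖ ≤ 1 := IsUltrametricDist.norm_intCast_le_one K z
  have : ‖(1 : K)‖ < 1 := by
    rw [← hb]
    push_cast
    refine (IsUltrametricDist.norm_add_le_max _ _).trans_lt (max_lt ?_ ?_)
    · rw [norm_mul]; exact mul_lt_one_of_nonneg_of_lt_one_left (norm_nonneg _) hc (hz _)
    · rw [norm_mul]; exact mul_lt_one_of_nonneg_of_lt_one_left (norm_nonneg _) hp1 (hz _)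
  simp at this

theorem norm_natCast_eq (hK : ‖(p : K)‖ = (p : ℝ)⁻¹) {n : ℕ} (hn : n ≠ 0) :
    ‖(n : K)‖ = ((p : ℝ) ^ padicValNat p n)⁻¹ := by
  obtain ⟨t, ht⟩ : p ^ padicValNat p n ∣ n := pow_padicValNat_dvd
  have hpt : ¬ p ∣ t := by
    intro h
    apply pow_succ_padicValNat_not_dvd (p := p) hn
    rw [pow_succ]
    conv_rhs => rw [ht]
    exact mul_dvd_mul_left _ h
  conv_lhs => rw [ht]
  rw [Nat.cast_mul, norm_mul, norm_natCast_of_not_dvd hK hpt, mul_one, Nat.cast_pow, norm_pow, hK,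
    inv_pow]

theorem charZero_of_norm (hK : ‖(p : K)‖ = (p : ℝ)⁻¹) : CharZero K := by
  refine charZero_of_inj_zero fun n hn => ?_
  by_contra h0
  have := norm_natCast_eq hK h0
  rw [hn, norm_zero] at this
  have hp0 : (0 : ℝ) < p := by exact_mod_cast hp.out.pos
  have : (0 : ℝ) < ((p : ℝ) ^ padicValNat p n)⁻¹ := by positivity
  linarith

theorem padicValNat_le_of_le_pow {n e : ℕ} (hn : n ≠ 0) (h : n < p ^ (e + 1)) :
    padicValNat p n ≤ e := by
  by_contra hc
  have h1 := Nat.le_of_dvd (Nat.pos_of_ne_zero hn) (pow_padicValNat_dvd (p := p) (n := n))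
  have h2 : p ^ (e + 1) ≤ p ^ padicValNat p n := Nat.pow_le_pow_right hp.out.pos (by omega)
  omega

theorem norm_inv_natCast_le (hK : ‖(p : K)‖ = (p : ℝ)⁻¹) {m ρ : ℕ} (hm : m ≠ 0)
    (h : m < p ^ (ρ + 1)) : ‖((m : K))⁻¹‖ ≤ (p : ℝ) ^ ρ := by
  rw [norm_inv, norm_natCast_eq hK hm, inv_inv]
  exact pow_le_pow_right₀ (by exact_mod_cast hp.out.one_le) (padicValNat_le_of_le_pow hm h)

/-- Since p is invertible mod N, each class contains p^{ρ-e₀} t with 1 ≤ t ≤ N ≤ p^{e₀}, which is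
below n. -/
theorem exists_mem_class {N : ℕ} [NeZero N] (hN : N.Coprime p) {e₀ ρ n : ℕ} (he : N ≤ p ^ e₀)
    (hρ : e₀ ≤ ρ) (hn : p ^ ρ < n) (b : ZMod N) :
    ∃ m : ℕ, 0 < m ∧ m < n ∧ (m : ZMod N) = b ∧ ρ - e₀ ≤ padicValNat p m := by
  have hu : IsUnit ((p ^ (ρ - e₀) : ℕ) : ZMod N) :=
    (ZMod.isUnit_iff_coprime _ _).2 (hN.symm.pow_left _)
  obtain ⟨v, hv⟩ := hu
  obtain ⟨t, ht0, htN, ht⟩ : ∃ t : ℕ, 0 < t ∧ t ≤ N ∧ (t : ZMod N) = ↑v⁻¹ * b := by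
    by_cases h : (↑v⁻¹ * b : ZMod N).val = 0
    · refine ⟨N, Nat.pos_of_ne_zero (NeZero.ne N), le_rfl, ?_⟩
      rw [(ZMod.val_eq_zero _).1 h, ZMod.natCast_self]
    · exact ⟨_, Nat.pos_of_ne_zero h, (ZMod.val_lt _).le, ZMod.natCast_zmod_val _⟩
  have hpp : 0 < p ^ (ρ - e₀) := pow_pos hp.out.pos _
  refine ⟨p ^ (ρ - e₀) * t, by positivity, ?_, ?_, ?_⟩
  · calc p ^ (ρ - e₀) * t ≤ p ^ (ρ - e₀) * p ^ e₀ := Nat.mul_le_mul_left _ (htN.trans he)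
      _ = p ^ ρ := by rw [← pow_add, Nat.sub_add_cancel hρ]
      _ < n := hn
  · rw [Nat.cast_mul, ht, ← hv, ← mul_assoc, Units.mul_inv, one_mul]
  · exact (padicValNat_dvd_iff_le (by positivity)).1 (dvd_mul_right _ _)

theorem le_totient_prime_pow {M : ℕ} (hM : 1 ≤ M) : M ≤ (p ^ M).totient := by
  rw [Nat.totient_prime_pow hp.out (by omega)]
  have h1 : M - 1 < p ^ (M - 1) := Nat.lt_pow_self hp.out.one_lt
  have h2 : 1 ≤ p - 1 := by have := hp.out.two_le; omega
  calc M ≤ p ^ (M - 1) * 1 := by omega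
    _ ≤ _ := Nat.mul_le_mul_left _ h2

/-- Lower bound for the harmonic sums over a residue class. -/
theorem le_norm_sum_class (hK : ‖(p : K)‖ = (p : ℝ)⁻¹) {N : ℕ} [NeZero N] (hN : N.Coprime p)
    {e₀ M ρ n : ℕ} (he : N ≤ p ^ e₀) (hM : e₀ + 2 ≤ M) (hρ : e₀ ≤ ρ) (hn : p ^ ρ < n)
    (hn' : n ≤ p ^ (ρ + 1)) (b : ZMod N) :
    (p : ℝ) ^ ((ρ - e₀) * (p ^ M).totient) * ((p : ℝ) ^ (e₀ + 1))⁻¹ ≤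
      ‖∑ m ∈ (Finset.Ioo 0 n).filter (fun m : ℕ => (m : ZMod N) = b),
        ((m : K) ^ (p ^ M).totient)⁻¹‖ := by
  classical
  have hp1 : (1 : ℝ) < p := by exact_mod_cast hp.out.one_lt
  have hp0 : (0 : ℝ) < p := by linarith
  have := charZero_of_norm hK
  set s := (p ^ M).totient with hs
  have hsM : M ≤ s := le_totient_prime_pow (by omega)
  set E := (Finset.Ioo 0 n).filter (fun m : ℕ => (m : ZMod N) = b) with hE
  obtain ⟨m₁, h1, h2, h3, h4⟩ := exists_mem_class hN he hρ hn b
  have hm₁ : m₁ ∈ E := by simp [hE, h1, h2, h3]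
  obtain ⟨m₀, hm₀, hmax⟩ := Finset.exists_max_image E (padicValNat p) ⟨m₁, hm₁⟩
  set e := padicValNat p m₀ with hee
  have heρ : ρ - e₀ ≤ e := h4.trans (hmax m₁ hm₁)
  have hE0 {m : ℕ} (hm : m ∈ E) : m ≠ 0 ∧ m < n := by
    simp only [hE, Finset.mem_filter, Finset.mem_Ioo] at hm
    omega
  set P : K := (p : K) ^ e with hP
  have hPn : ‖P‖ = ((p : ℝ) ^ e)⁻¹ := by rw [hP, norm_pow, hK, inv_pow]
  have hP0 : P ≠ 0 := norm_pos_iff.1 (by rw [hPn]; positivity)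
  -- the terms of maximal valuation dominate, and are congruent to one
  have hterm (m : ℕ) (hm : m ∈ E) :
      ‖(P / m) ^ s - (if padicValNat p m = e then 1 else 0)‖ ≤ ((p : ℝ) ^ M)⁻¹ := by
    obtain ⟨hm0, hmn⟩ := hE0 hm
    have hmK : (m : K) ≠ 0 := by exact_mod_cast hm0
    split_ifs with hv
    · obtain ⟨t, ht⟩ : p ^ e ∣ m := hv ▸ pow_padicValNat_dvd
      have hpt : ¬ p ∣ t := by
        intro h
        apply pow_succ_padicValNat_not_dvd (p := p) hm0
        rw [hv, pow_succ, ht]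
        exact mul_dvd_mul_left _ h
      have ht0 : (t : K) ≠ 0 := by
        rintro h
        have : t = 0 := by exact_mod_cast h
        exact hpt (this ▸ dvd_zero p)
      have hPm : P / m = (t : K)⁻¹ := by
        rw [ht, Nat.cast_mul, Nat.cast_pow, ← hP]
        field_simp
      have hmod : t ^ s ≡ 1 [MOD p ^ M] :=
        Nat.ModEq.pow_totient ((hp.out.coprime_iff_not_dvd.2 hpt).symm.pow_right _)
      have htpos : 1 ≤ t ^ s := Nat.one_le_pow _ _ (Nat.pos_of_ne_zero (by exact_mod_cast ht0))
      obtain ⟨c, hc⟩ := (Nat.modEq_iff_dvd' htpos).1 hmod.symm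
      have hc' : (t : K) ^ s = p ^ M * c + 1 := by
        have : t ^ s = p ^ M * c + 1 := by omega
        exact_mod_cast congrArg (Nat.cast : ℕ → K) this
      rw [hPm, inv_pow, show ((t : K) ^ s)⁻¹ - 1 = ((t : K) ^ s)⁻¹ * (-(p ^ M * c)) by
        rw [show -((p : K) ^ M * c) = 1 - (t : K) ^ s by rw [hc']; ring, mul_sub, mul_one,
          inv_mul_cancel₀ (pow_ne_zero _ ht0)], norm_mul, norm_inv, norm_pow,
        norm_natCast_of_not_dvd hK hpt, one_pow, inv_one, one_mul, norm_neg, norm_mul, norm_pow, hK,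
        inv_pow]
      exact mul_le_of_le_one_right (by positivity) (IsUltrametricDist.norm_natCast_le_one K c)
    · have hlt : padicValNat p m < e := lt_of_le_of_ne (hmax m hm) hv
      rw [sub_zero, norm_pow, norm_div, hPn, norm_natCast_eq hK hm0]
      have h5 : ((p : ℝ) ^ e)⁻¹ / ((p : ℝ) ^ padicValNat p m)⁻¹ ≤ (p : ℝ)⁻¹ := by
        rw [div_inv_eq_mul, inv_mul_le_iff₀ (by positivity), ← div_eq_mul_inv,
          le_div_iff₀ hp0, ← pow_succ]
        exact pow_le_pow_right₀ hp1.le hlt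
      calc _ ≤ ((p : ℝ)⁻¹) ^ s := by gcongr
        _ ≤ ((p : ℝ)⁻¹) ^ M :=
          pow_le_pow_of_le_one (by positivity) (inv_le_one_of_one_le₀ hp1.le) hsM
        _ = _ := inv_pow _ _
  set E' := E.filter fun m => padicValNat p m = e with hE'
  have hcard0 : E'.card ≠ 0 := Finset.card_ne_zero.2 ⟨m₀, by simp [hE', hm₀]; rfl⟩
  -- The indices of exact valuation e are distinct multiples of p^e below p^{ρ+1}. As e ≥ ρ - e₀,
  -- there are at most p^{e₀+1} of them, so their number is not divisible by p^{e₀+2}.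
  have hcard : E'.card ≤ p ^ (ρ + 1 - e) := by
    rw [← Finset.card_range (p ^ (ρ + 1 - e))]
    refine Finset.card_le_card_of_injOn (fun m => m / p ^ e) (fun m hm => ?_)
      (fun m hm m' hm' h => ?_)
    · have hm : m ∈ E' := hm
      rw [hE', Finset.mem_filter] at hm
      have heρ' : e ≤ ρ := hm.2 ▸ padicValNat_le_of_le_pow (hE0 hm.1).1 ((hE0 hm.1).2.trans_le hn')
      simp only [Finset.coe_range, Set.mem_Iio]
      rw [Nat.div_lt_iff_lt_mul (pow_pos hp.out.pos _), ← pow_add,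
        Nat.sub_add_cancel (by omega)]
      exact (hE0 hm.1).2.trans_le hn'
    · have hdvd {m : ℕ} (hm : m ∈ E') : p ^ e ∣ m := by
        rw [hE', Finset.mem_filter] at hm
        exact hm.2 ▸ pow_padicValNat_dvd
      exact Nat.div_left_inj (hdvd hm) (hdvd hm') |>.1 h
  have hcardn : ((p : ℝ) ^ (e₀ + 1))⁻¹ ≤ ‖(E'.card : K)‖ := by
    rw [norm_natCast_eq hK hcard0]
    refine inv_anti₀ (by positivity) (pow_le_pow_right₀ hp1.le ?_)
    refine padicValNat_le_of_le_pow hcard0 (hcard.trans_lt ?_)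
    exact Nat.pow_lt_pow_right hp.out.one_lt (by omega)
  -- After scaling by P^s the sum is congruent mod p^M to the number of its terms of maximal
  -- valuation. As M ≥ e₀ + 2, this congruence determines the size of the sum from below.
  have hsum : ‖∑ m ∈ E, (P / m) ^ s - (E'.card : K)‖ ≤ ((p : ℝ) ^ M)⁻¹ := by
    have : (E'.card : K) = ∑ m ∈ E, if padicValNat p m = e then 1 else 0 := by
      rw [Finset.sum_boole]
    rw [this, ← Finset.sum_sub_distrib]
    exact IsUltrametricDist.norm_sum_le_of_forall_le_of_nonneg (by positivity) hterm
  have hlow : ((p : ℝ) ^ (e₀ + 1))⁻¹ ≤ ‖∑ m ∈ E, (P / m) ^ s‖ := by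
    by_contra hc
    have h6 : ‖(E'.card : K)‖ ≤ max ‖∑ m ∈ E, (P / m) ^ s‖ ‖∑ m ∈ E, (P / m) ^ s - (E'.card : K)‖ := by
      have := IsUltrametricDist.norm_add_le_max (∑ m ∈ E, (P / (m : K)) ^ s)
        ((E'.card : K) - ∑ m ∈ E, (P / m) ^ s)
      rwa [add_sub_cancel, norm_sub_rev] at this
    have h7 : ((p : ℝ) ^ M)⁻¹ < ((p : ℝ) ^ (e₀ + 1))⁻¹ :=
      inv_strictAnti₀ (by positivity) (pow_lt_pow_right₀ hp1 (by omega))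
    have := hcardn.trans_lt (h6.trans_lt (max_lt (not_le.1 hc) (hsum.trans_lt h7)))
    exact lt_irrefl _ this
  have hfact : ∑ m ∈ E, (P / m) ^ s = P ^ s * ∑ m ∈ E, ((m : K) ^ s)⁻¹ := by
    rw [Finset.mul_sum]
    exact Finset.sum_congr rfl fun m _ => by rw [div_pow, div_eq_mul_inv]
  rw [hfact, norm_mul, norm_pow, hPn, inv_pow, ← pow_mul, le_inv_mul_iff₀ (by positivity)] at hlow
  refine le_trans ?_ hlow
  gcongr
  · exact hp1.le

end Estimates

/-! ### Freeness at the harmonic sequences -/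

/-! ### Fourier inversion on ℤ/N and the growth argument. -/

section Fourier

variable {p : ℕ} [hp : Fact p.Prime] {K : Type*} [NormedField K] [IsUltrametricDist K]
  {A : Type*} [NormedCommRing A] [IsUltrametricDist A] [NormedAlgebra K A]
  {N : ℕ} [NeZero N] {ξ : K}

/-- The character `j ↦ ξ ^ j`. -/
noncomputable def rootChar (hξ : IsPrimitiveRoot ξ N) : AddChar (ZMod N) K :=
  AddChar.zmodChar N hξ.pow_eq_one

omit [IsUltrametricDist K] in
theorem rootChar_apply (hξ : IsPrimitiveRoot ξ N) (j : ZMod N) : rootChar hξ j = ξ ^ j.val :=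
  AddChar.zmodChar_apply _ _

omit [IsUltrametricDist K] in
theorem norm_rootChar (hξ : IsPrimitiveRoot ξ N) (j : ZMod N) : ‖rootChar hξ j‖ = 1 := by
  have h : ‖ξ‖ ^ N = 1 := by rw [← norm_pow, hξ.pow_eq_one, norm_one]
  rw [rootChar_apply, norm_pow, (pow_eq_one_iff_of_nonneg (norm_nonneg _) (NeZero.ne N)).1 h,
    one_pow]

omit [IsUltrametricDist K] in
theorem sum_rootChar_mul (hξ : IsPrimitiveRoot ξ N) (b : ZMod N) :
    ∑ x, rootChar hξ (x * b) = if b = 0 then (N : K) else 0 := by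
  have := AddChar.sum_mulShift b (AddChar.zmodChar_primitive_of_primitive_root N hξ)
  rwa [ZMod.card, Nat.cast_ite, Nat.cast_zero] at this

/-- The twisted harmonic sums of depth one. -/
noncomputable def harmonicSum (hξ : IsPrimitiveRoot ξ N) (n : ℕ) (i j : ZMod N) (s : ℕ) : K :=
  ∑ m ∈ Finset.Ioo 0 n, (rootChar hξ i / rootChar hξ j) ^ m / (m : K) ^ s

omit [IsUltrametricDist K] [IsUltrametricDist A] in
-- Orthogonality: ∑_i ξ^{i(m-b)} is N if m ≡ b mod N and 0 otherwise. The transform in i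
-- diagonalizes the matrix of twisted harmonic sums.
theorem sum_smul_sum_harmonicSum (hξ : IsPrimitiveRoot ξ N) (n s : ℕ) (b : ZMod N)
    (c : ZMod N → A) :
    ∑ i, rootChar hξ (-(i * b)) • ∑ j, harmonicSum hξ n i j s • c j =
      ((N : K) * ∑ m ∈ (Finset.Ioo 0 n).filter (fun m : ℕ => (m : ZMod N) = b), ((m : K) ^ s)⁻¹) •
        ∑ j, rootChar hξ (-(j * b)) • c j := by
  have h1 (i j : ZMod N) : rootChar hξ (-(i * b)) • harmonicSum hξ n i j s • c j =
      (∑ m ∈ Finset.Ioo 0 n, rootChar hξ (i * (m - b)) * (rootChar hξ (-(j * m)) * ((m : K) ^ s)⁻¹)) •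
        c j := by
    rw [smul_smul, harmonicSum, Finset.mul_sum]
    congr 1
    refine Finset.sum_congr rfl fun m _ => ?_
    rw [← AddChar.map_sub_eq_div, ← AddChar.map_nsmul_eq_pow, div_eq_mul_inv, ← mul_assoc,
      ← mul_assoc, ← AddChar.map_add_eq_mul, ← AddChar.map_add_eq_mul]
    congr 2
    rw [nsmul_eq_mul]
    ring
  simp only [Finset.smul_sum, h1]
  rw [Finset.sum_comm]
  refine Finset.sum_congr rfl fun j _ => ?_
  rw [← Finset.sum_smul, Finset.sum_comm, smul_smul]
  congr 1
  simp only [← Finset.sum_mul, sum_rootChar_mul, sub_eq_zero]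
  rw [Finset.sum_filter, Finset.mul_sum, Finset.sum_mul]
  refine Finset.sum_congr rfl fun m _ => ?_
  split_ifs with h
  · rw [h]; ring
  · ring

omit [IsUltrametricDist K] [IsUltrametricDist A] in
theorem eq_zero_of_fourier (hξ : IsPrimitiveRoot ξ N) (hN : (N : K) ≠ 0) {c : ZMod N → A}
    (h : ∀ b, ∑ j, rootChar hξ (-(j * b)) • c j = 0) (i : ZMod N) : c i = 0 := by
  have h1 : ∑ b, rootChar hξ (i * b) • ∑ j, rootChar hξ (-(j * b)) • c j = (N : K) • c i := by
    simp only [Finset.smul_sum, smul_smul, ← AddChar.map_add_eq_mul]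
    rw [Finset.sum_comm]
    simp only [← Finset.sum_smul]
    have h2 (j : ZMod N) : ∑ b, rootChar hξ (i * b + -(j * b)) = if j = i then (N : K) else 0 := by
      have h3 := sum_rootChar_mul hξ (i - j)
      simp only [sub_eq_zero, eq_comm (a := i)] at h3
      rw [← h3]
      exact Finset.sum_congr rfl fun b _ => by congr 1; ring
    simp [h2]
  rw [Finset.sum_eq_zero fun b _ => by rw [h b, smul_zero]] at h1
  exact (smul_eq_zero_iff_right hN).1 h1.symm

/-- For s = φ(p^M) the diagonal entries grow like p^{ρs}, against an upper bound of order
p^{ρ(s-1)}. The gain p^ρ is unbounded on S, so every Fourier coefficient of c vanishes. -/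
theorem eq_zero_of_norm_sum_harmonicSum_le (hK : ‖(p : K)‖ = (p : ℝ)⁻¹) (hNp : N.Coprime p)
    (hξ : IsPrimitiveRoot ξ N) {S : Set ℕ} (hS : ∀ B, ∃ n ∈ S, B ≤ n) {M : ℕ} (hM : N + 2 ≤ M)
    (c : ZMod N → A) (C : ℝ)
    (h : ∀ n ∈ S, ∀ ρ, p ^ ρ < n → n ≤ p ^ (ρ + 1) → ∀ i,
      ‖∑ j, harmonicSum hξ n i j (p ^ M).totient • c j‖ ≤ C * (p : ℝ) ^ (ρ * ((p ^ M).totient - 1)))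
    (j : ZMod N) : c j = 0 := by
  have hp1 : (1 : ℝ) < p := by exact_mod_cast hp.out.one_lt
  have hp0 : (0 : ℝ) < p := by linarith
  have := charZero_of_norm hK
  have hN0 : (N : K) ≠ 0 := by exact_mod_cast NeZero.ne N
  refine eq_zero_of_fourier hξ hN0 (fun b => ?_) j
  by_contra hv
  set v := ∑ j, rootChar hξ (-(j * b)) • c j with hvdef
  have hv0 : 0 < ‖v‖ := norm_pos_iff.2 hv
  set s := (p ^ M).totient with hs
  have hs1 : 1 ≤ s := Nat.totient_pos.2 (pow_pos hp.out.pos _)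
  -- R exceeds the ratio of the constants of the two estimates, and p^ρ ≥ p^R > R. The lower bound
  -- is applied with e₀ = N, since N ≤ p^N.
  obtain ⟨R, hR⟩ := exists_nat_gt (C * (p : ℝ) ^ (N * s + (N + 1)) / ‖v‖)
  obtain ⟨n, hnS, hn⟩ := hS (p ^ (max R N) + 1)
  set ρ := Nat.log p (n - 1) with hρ
  have hn1 : n - 1 ≠ 0 := by have := pow_pos hp.out.pos (max R N); omega
  have hρn : p ^ ρ < n := by have : p ^ ρ ≤ n - 1 := Nat.pow_log_le_self p hn1; omega
  have hnρ : n ≤ p ^ (ρ + 1) := by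
    have : n - 1 < p ^ (ρ + 1) := Nat.lt_pow_succ_log_self hp.out.one_lt (n - 1)
    omega
  have hRρ : max R N ≤ ρ := Nat.le_log_of_pow_le hp.out.one_lt (by omega)
  have hNp' : ¬ p ∣ N := (hp.out.coprime_iff_not_dvd).1 hNp.symm
  have hlow := le_norm_sum_class hK hNp (Nat.lt_pow_self hp.out.one_lt).le hM
    ((le_max_right R N).trans hRρ) hρn hnρ b
  have hup : ‖∑ i, rootChar hξ (-(i * b)) • ∑ j, harmonicSum hξ n i j s • c j‖ ≤
      C * (p : ℝ) ^ (ρ * (s - 1)) := by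
    refine IsUltrametricDist.norm_sum_le_of_forall_le_of_nonneg
      ((norm_nonneg _).trans (h n hnS ρ hρn hnρ 0)) fun i _ => ?_
    rw [norm_smul, norm_rootChar, one_mul]
    exact h n hnS ρ hρn hnρ i
  rw [sum_smul_sum_harmonicSum, norm_smul, norm_mul, norm_natCast_of_not_dvd hK hNp', one_mul,
    ← hvdef] at hup
  have h1 := (mul_le_mul_of_nonneg_right hlow hv0.le).trans hup
  have e1 : (p : ℝ) ^ ((ρ - N) * s) * (p : ℝ) ^ (N * s) =
      (p : ℝ) ^ ρ * (p : ℝ) ^ (ρ * (s - 1)) := by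
    rw [← pow_add, ← pow_add, ← add_mul, Nat.sub_add_cancel ((le_max_right R N).trans hRρ)]
    congr 1
    obtain ⟨t, ht⟩ : ∃ t, s = t + 1 := ⟨s - 1, by omega⟩
    rw [ht, Nat.add_sub_cancel]; ring
  have h2 : (p : ℝ) ^ ρ * ‖v‖ ≤ C * (p : ℝ) ^ (N * s + (N + 1)) := by
    have hpos : (0 : ℝ) < (p : ℝ) ^ (ρ * (s - 1)) := by positivity
    refine le_of_mul_le_mul_left ?_ hpos
    calc (p : ℝ) ^ (ρ * (s - 1)) * ((p : ℝ) ^ ρ * ‖v‖)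
        = ((p : ℝ) ^ ((ρ - N) * s) * ((p : ℝ) ^ (N + 1))⁻¹ * ‖v‖) * (p : ℝ) ^ (N * s + (N + 1)) := by
          rw [pow_add _ (N * s)]
          have : ((p : ℝ) ^ (N + 1)) ≠ 0 := by positivity
          rw [← mul_assoc, mul_comm ((p : ℝ) ^ (ρ * (s - 1))), ← e1]
          field_simp
      _ ≤ C * (p : ℝ) ^ (ρ * (s - 1)) * (p : ℝ) ^ (N * s + (N + 1)) := by gcongr
      _ = _ := by ring
  rw [div_lt_iff₀ hv0] at hR
  have h3 : (R : ℝ) ≤ (p : ℝ) ^ ρ := by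
    have h4 : R < p ^ R := Nat.lt_pow_self hp.out.one_lt
    have h5 : p ^ R ≤ p ^ ρ := Nat.pow_le_pow_right hp.out.pos ((le_max_left R N).trans hRρ)
    exact_mod_cast (h4.le.trans h5)
  nlinarith

end Fourier

/-! ### The coefficients of har_S that index sums of depth 0 and 1. -/

section HarmonicSequence

variable {K A : Type*} [Field K] [CommRing A] [Algebra K A] {N : ℕ} {ξ : K} {S : Set ℕ}
  {h : S → HarSpace N A}

theorem IsHarmonicSequence.apply_singleton (hh : IsHarmonicSequence ξ h) (n : S) (j : ZMod N) :
    (h n).val [some j] = algebraMap K A ((1 / ξ ^ j.val) ^ (n : ℕ)) := by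
  have := hh n 0 (fun _ => j) Fin.elim0 fun i => i.elim0
  simpa [harmonicWord, har] using this

theorem IsHarmonicSequence.apply_cons_replicate (hh : IsHarmonicSequence ξ h) (n : S)
    (i j : ZMod N) (b : ℕ) :
    (h n).val (some i :: (List.replicate b none ++ [some j])) = algebraMap K A
      ((n : K) ^ (b + 1) * ((∑ m ∈ Finset.Ioo 0 (n : ℕ), (ξ ^ i.val / ξ ^ j.val) ^ m / (m : K) ^ (b + 1)) *
        (1 / ξ ^ i.val) ^ (n : ℕ))) := by
  have := hh n 1 ![j, i] (fun _ => b + 1) (by simp)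
  have e : harmonicWord ![j, i] (fun _ : Fin 1 => b + 1) =
      some i :: (List.replicate b none ++ [some j]) := by
    simp [harmonicWord]
  rw [e] at this
  rw [this, har, Finset.sum_mul, Fin.sum_univ_one]
  congr 2
  · refine Finset.sum_bij' (fun m _ => m 0) (fun m _ _ => m) ?_ ?_ ?_ ?_ ?_
    · intro m hm
      simp only [Finset.mem_filter, Fintype.mem_piFinset] at hm
      exact hm.1 0
    · intro m hm
      simp only [Finset.mem_filter, Fintype.mem_piFinset]
      refine ⟨fun _ => hm, fun a b hab => ?_⟩
      rw [Subsingleton.elim a b] at hab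
      exact absurd hab (lt_irrefl _)
    · intro m _
      funext a
      rw [Subsingleton.elim a 0]
    · intro m _; rfl
    · intro m _
      simp

end HarmonicSequence

section Estimates

variable {p : ℕ} [hp : Fact p.Prime] {K : Type*} [NormedField K] [IsUltrametricDist K]
  {A : Type*} [NormedCommRing A] [NormedAlgebra K A] {N : ℕ} [NeZero N] {ξ : K}

theorem norm_harmonicSum_le (hK : ‖(p : K)‖ = (p : ℝ)⁻¹) (hξ : IsPrimitiveRoot ξ N) {n ρ : ℕ}
    (hn : n ≤ p ^ (ρ + 1)) (i j : ZMod N) (s : ℕ) :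
    ‖harmonicSum hξ n i j s‖ ≤ (p : ℝ) ^ (ρ * s) := by
  refine IsUltrametricDist.norm_sum_le_of_forall_le_of_nonneg (by positivity) fun m hm => ?_
  rw [Finset.mem_Ioo] at hm
  rw [norm_div, norm_pow, norm_div, norm_rootChar, norm_rootChar, div_one, one_pow, one_div,
    norm_pow, ← inv_pow, ← norm_inv, pow_mul]
  exact pow_le_pow_left₀ (norm_nonneg _) (norm_inv_natCast_le hK (by omega) (by omega)) s

omit [IsUltrametricDist K] [NeZero N] in
theorem norm_tau_apply (n : ℕ) (u : NCSeries (Letter N) A) (w : Word N) :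
    ‖tau n u w‖ = ‖(n : K)‖ ^ (w.length - 1) * ‖u w‖ := by
  rw [tau_apply, ← norm_pow, ← norm_smul, Algebra.smul_def, map_pow, map_natCast]

omit [NeZero N] in
theorem norm_zeroSum_tau_le [IsUltrametricDist A] (n : ℕ) {u : NCSeries (Letter N) A} {x : Word N}
    {C : ℝ} (hC : ∀ w, depth w ≤ depth x → ‖u w‖ ≤ C) (j : ZMod N) :
    ‖zeroSum (rot j (tau n u)) x‖ ≤ ‖(n : K)‖ ^ (x.length - 1) * C := by
  have hC0 : 0 ≤ C := (norm_nonneg _).trans (hC x le_rfl)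
  refine IsUltrametricDist.norm_tsum_le_of_forall_le_of_nonneg (by positivity) fun k => ?_
  rw [rot_apply, norm_tau_apply (K := K), length_unrotate]
  have h1 := IsUltrametricDist.norm_natCast_le_one K n
  refine mul_le_mul (pow_le_pow_of_le_one (norm_nonneg _) h1 (by simp; omega)) (hC _ (by simp))
    (norm_nonneg _) (by positivity)

variable {S : Set ℕ} {h : S → HarSpace N A}

omit [IsUltrametricDist K] in
theorem IsHarmonicSequence.apply_cons_replicate_eq_smul (hh : IsHarmonicSequence ξ h)
    (hξ : IsPrimitiveRoot ξ N) (n : S) (i j : ZMod N) (b : ℕ) :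
    (h n).val (some i :: (List.replicate b none ++ [some j])) =
      (((n : ℕ) : K) ^ (b + 1) * (1 / rootChar hξ i) ^ (n : ℕ)) •
        algebraMap K A (harmonicSum hξ n i j (b + 1)) := by
  rw [hh.apply_cons_replicate, Algebra.smul_def, ← map_mul]
  simp only [harmonicSum, rootChar_apply]
  congr 1
  ring

theorem IsHarmonicSequence.norm_apply_le (hh : IsHarmonicSequence ξ h)
    (hK : ‖(p : K)‖ = (p : ℝ)⁻¹) (hξ : IsPrimitiveRoot ξ N) (n : S) {ρ : ℕ}
    (hn : (n : ℕ) ≤ p ^ (ρ + 1)) (i : ZMod N) {x : Word N}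
    (hx : x = [] ∨ ∃ b j, x = List.replicate b none ++ [some j]) :
    ‖(h n).val (some i :: x)‖ ≤
      ‖((n : ℕ) : K)‖ ^ x.length * ((p : ℝ) ^ (ρ * x.length) * ‖(1 : A)‖) := by
  rcases hx with rfl | ⟨b, j, rfl⟩
  · rw [hh.apply_singleton, norm_algebraMap, ← rootChar_apply hξ, norm_pow, norm_div, norm_one,
      norm_rootChar]
    simp
  · rw [hh.apply_cons_replicate_eq_smul hξ, norm_smul, norm_mul, norm_pow, norm_pow, norm_div,
      norm_one, norm_rootChar, div_one, one_pow, mul_one, norm_algebraMap]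
    simp only [List.length_append, List.length_replicate, List.length_singleton]
    gcongr
    exact norm_harmonicSum_le hK hξ hn i j _

end Estimates

section HarmonicFree

variable {p : ℕ} [hp : Fact p.Prime] {K : Type*} [NormedField K] [IsUltrametricDist K]
  {A : Type*} [NormedCommRing A] [IsUltrametricDist A] [CompleteSpace A] [NormedAlgebra K A]
  {N : ℕ} [NeZero N] {ξ : K} {S : Set ℕ} {h : S → HarSpace N A}

omit hp [NeZero N] in
-- Ensures that the suffixes met in the error terms index harmonic sums of depth at most 1, and not
-- words ending with e_0, whose coefficients are arbitrary.
theorem eq_nil_or_eq_replicate_of_suffix {x y : Word N} {l : ZMod N} (h : x <:+ y ++ [some l])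
    (hx : depth x ≤ 1) : x = [] ∨ ∃ b j, x = List.replicate b none ++ [some j] := by
  rcases x.eq_nil_or_concat with rfl | ⟨z, a, rfl⟩
  · exact .inl rfl
  · obtain ⟨t, ht⟩ := h
    rw [List.concat_eq_append, ← List.append_assoc] at ht
    obtain ⟨-, ha⟩ := List.append_inj' ht rfl
    rw [List.concat_eq_append, ha, depth_append] at hx
    rw [List.concat_eq_append]
    refine .inr ⟨z.length, l, ?_⟩
    rw [ha, ← eq_replicate_of_depth_eq_zero (w := z) (by simpa using hx)]

/-- The estimate of the main term of the second equation satisfied by the stabilizer. -/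
theorem norm_sum_harmonicSum_smul_le (hK : ‖(p : K)‖ = (p : ℝ)⁻¹) (hξ : IsPrimitiveRoot ξ N)
    (hh : IsHarmonicSequence ξ h) {D : ℕ} (hD : 1 ≤ D) {u : NCSeries (Letter N) A}
    (hu : AgreesUpTo D u) (hn : IsNull u) (n : S) (hn0 : (n : ℕ) ≠ 0)
    (hfix : harLim (tau n u) (h n).val = (h n).val)
    {C : ℝ} (hC : ∀ w, depth w ≤ D + 2 → ‖u w‖ ≤ C) (i l : ZMod N) {x : Word N}
    (hx : depth x + 2 = D + 1) {r s ρ : ℕ} (hs : x.length + 2 ≤ s)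
    (hr : ∀ r' < r, ∀ j, rot j u (List.replicate r' none ++ (some i :: x ++ [some l])) = 0)
    (hnρ : (n : ℕ) ≤ p ^ (ρ + 1)) (i₀ : ZMod N) :
    ‖∑ j, harmonicSum hξ n i₀ j s •
      rot j u (List.replicate r none ++ (some i :: x ++ [some l]))‖ ≤
        C * ‖(1 : A)‖ * (p : ℝ) ^ (ρ * (s - 1)) := by
  have := charZero_of_norm hK
  have hC0 : 0 ≤ C := (norm_nonneg _).trans (hC [] (by simp))
  have hp1 : (1 : ℝ) ≤ p := by exact_mod_cast hp.out.one_le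
  set y : Word N := some i :: x ++ [some l] with hy
  have hylen : y.length = x.length + 2 := by simp [hy]
  have hydepth : depth y = D + 1 := by rw [hy, depth_append]; simp; omega
  obtain ⟨s, rfl⟩ : ∃ t, s = t + 1 := ⟨s - 1, by omega⟩
  rw [Nat.add_sub_cancel]
  -- With a = s + r, the term b = s pairs the unknown coefficients at e_0^r y with harmonic sums of
  -- exponent s + 1. By homogeneity every term carries the same power of n, which is cancelled at
  -- the end.
  set w : Word N := some i₀ :: (List.replicate (s + r) none ++ y) with hw
  have hwlen : w.length = s + r + y.length + 1 := by simp [hw]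
  have hwdepth : depth w = D + 2 := by
    rw [hw, ← List.singleton_append, depth_append, depth_append, hydepth]; simp; omega
  set B : ℝ := ‖((n : ℕ) : K)‖ ^ (w.length - 1) * (C * ‖(1 : A)‖ * (p : ℝ) ^ (ρ * s)) with hB
  have hB0 : 0 ≤ B := by positivity
  have key := stabilizer_eq hD (hu.tau n) (hn.tau n) (h n).tail hfix i₀ i l x hx (s + r) hw
  rw [← Finset.add_sum_erase _ _ (a := s) (by simp), add_assoc, add_eq_zero_iff_eq_neg,
    ← hy] at key
  have e1 : ∑ j, rot j (tau n u) (List.replicate (s + r - s) none ++ y) *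
      (h n).val (some i₀ :: (List.replicate s none ++ [some j])) =
      (((n : ℕ) : K) ^ (w.length - 1) * (1 / rootChar hξ i₀) ^ (n : ℕ)) •
        ∑ j, harmonicSum hξ n i₀ j (s + 1) • rot j u (List.replicate r none ++ y) := by
    rw [Finset.smul_sum]
    refine Finset.sum_congr rfl fun j _ => ?_
    rw [hh.apply_cons_replicate_eq_smul hξ, rot_tau, tau_apply, Nat.add_sub_cancel_left]
    have e2 : (n : ℕ) = algebraMap K A (n : ℕ) := (map_natCast _ _).symm
    have e3 : w.length - 1 = ((List.replicate r (none : Letter N) ++ y).length - 1) + (s + 1) := by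
      rw [hwlen]; simp; omega
    rw [e3, pow_add]
    simp only [Algebra.smul_def, map_mul, map_pow, map_natCast]
    ring
  have h1 : ‖∑ j, rot j (tau n u) (List.replicate (s + r - s) none ++ y) *
      (h n).val (some i₀ :: (List.replicate s none ++ [some j]))‖ ≤ B := by
    rw [key, norm_neg]
    refine (IsUltrametricDist.norm_add_le_max _ _).trans (max_le ?_ ?_)
    · refine IsUltrametricDist.norm_sum_le_of_forall_le_of_nonneg hB0 fun b hb => ?_
      refine IsUltrametricDist.norm_sum_le_of_forall_le_of_nonneg hB0 fun j _ => ?_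
      simp only [Finset.mem_erase, Finset.mem_range] at hb
      -- For b < s the harmonic sum has exponent at most s, hence a smaller pole; for b > s fewer
      -- than r leading e_0's remain and `hr` gives zero.
      rcases lt_or_gt_of_ne hb.1 with hbs | hbs
      · refine (norm_mul_le _ _).trans ?_
        rw [rot_apply, norm_tau_apply (K := K), length_unrotate]
        have h2 := hh.norm_apply_le hK hξ n hnρ i₀ (.inr ⟨b, j, rfl⟩)
        have h3 := hC (unrotate j (List.replicate (s + r - b) none ++ y)) (by
          rw [depth_unrotate, depth_append, hydepth]; simp)
        refine (mul_le_mul (mul_le_mul_of_nonneg_left h3 (by positivity)) h2 (norm_nonneg _)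
          (by positivity)).trans ?_
        have h4 : w.length - 1 = ((List.replicate (s + r - b) (none : Letter N) ++ y).length - 1) +
            (List.replicate b none ++ [some j]).length := by
          rw [hwlen]; simp; omega
        have h5 : (p : ℝ) ^ (ρ * (List.replicate b none ++ [some j]).length) ≤ (p : ℝ) ^ (ρ * s) :=
          pow_le_pow_right₀ hp1 (Nat.mul_le_mul_left _ (by simp; omega))
        rw [hB, h4, pow_add]
        calc _ = ‖((n : ℕ) : K)‖ ^ ((List.replicate (s + r - b) (none : Letter N) ++ y).length - 1) *
              ‖((n : ℕ) : K)‖ ^ (List.replicate b none ++ [some j]).length *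
              (C * ‖(1 : A)‖ * (p : ℝ) ^ (ρ * (List.replicate b none ++ [some j]).length)) := by ring
          _ ≤ _ := by gcongr
      · rw [rot_tau, tau_apply, hr _ (by omega), mul_zero, zero_mul, norm_zero]
        exact hB0
    · refine IsUltrametricDist.norm_sum_le_of_forall_le_of_nonneg hB0 fun j _ => ?_
      refine IsUltrametricDist.norm_sum_le_of_forall_le_of_nonneg hB0 fun t ht => ?_
      simp only [Finset.mem_filter, Finset.mem_range] at ht
      have hd := depth_take_add_drop t w
      have ht0 : t ≠ 0 := by rintro rfl; simp at ht
      -- A suffix containing y would have depth D + 1, leaving a prefix of depth at most 1 ≤ D. So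
      -- the suffix is shorter than y, and the harmonic sum has weight at most s.
      have hlt : (w.drop t).length < y.length := by
        by_contra hc
        have hsuf : y <:+ w.drop t := by
          refine List.suffix_of_suffix_length_le ⟨some i₀ :: List.replicate (s + r) none, ?_⟩
            (List.drop_suffix t w) (by omega)
          simp [hw]
        obtain ⟨z, hz⟩ := hsuf
        have : depth (w.drop t) = depth z + depth y := by rw [← hz, depth_append]
        omega
      have h2 := hh.norm_apply_le hK hξ n hnρ j (eq_nil_or_eq_replicate_of_suffix
        (x := w.drop t) (y := some i₀ :: (List.replicate (s + r) none ++ some i :: x)) (l := l)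
        ((List.drop_suffix t w).trans (by simp [hw, hy])) (by omega))
      have h3 := norm_zeroSum_tau_le (K := K) n (x := w.take t)
        (fun v hv => hC v (by omega)) j
      refine (norm_mul_le _ _).trans ((mul_le_mul h3 h2 (norm_nonneg _) (by positivity)).trans ?_)
      have h4 : w.length - 1 = ((w.take t).length - 1) + (w.drop t).length := by
        simp; omega
      have h5 : (p : ℝ) ^ (ρ * (w.drop t).length) ≤ (p : ℝ) ^ (ρ * s) :=
        pow_le_pow_right₀ hp1 (Nat.mul_le_mul_left _ (by omega))
      rw [hB, h4, pow_add]
      calc _ = ‖((n : ℕ) : K)‖ ^ ((w.take t).length - 1) * ‖((n : ℕ) : K)‖ ^ (w.drop t).length *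
            (C * ‖(1 : A)‖ * (p : ℝ) ^ (ρ * (w.drop t).length)) := by ring
        _ ≤ _ := by gcongr
  rw [e1, norm_smul, norm_mul, norm_pow, norm_pow, norm_div, norm_one, norm_rootChar, div_one,
    one_pow, mul_one] at h1
  exact le_of_mul_le_mul_left h1 (pow_pos (norm_pos_iff.2 (by exact_mod_cast hn0)) _)

theorem AgreesUpTo.succ_of_fix_harmonicSequence (hA : ∀ n : ℕ, n ≠ 0 → IsUnit (n : A))
    (hK : ‖(p : K)‖ = (p : ℝ)⁻¹) (hNp : N.Coprime p) (hξ : IsPrimitiveRoot ξ N)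
    (hS : ∀ B, ∃ n ∈ S, B ≤ n) (hS0 : 0 ∉ S)
    (hh : IsHarmonicSequence ξ h) {D : ℕ} (hD : 1 ≤ D) {u : NCSeries (Letter N) A}
    (hu : AgreesUpTo D u) (hn : IsNull u) (hprim : IsPrimitive u)
    (hfix : ∀ n : S, harLim (HarmonicIhara.tau n u) (h n).val = (h n).val) : AgreesUpTo (D + 1) u := by
  obtain ⟨C, hC0, hC⟩ := hn.bounded (D + 2)
  refine hu.succ hA hprim hD fun r i l x hx => ?_
  suffices ∀ j, rot j u (List.replicate r none ++ (some i :: x ++ [some l])) = 0 by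
    simpa using this 0
  induction r using Nat.strong_induction_on with
  | _ r ih =>
    -- The first bound serves the lower estimate of the class sums; the second makes φ(p^M) at least
    -- the length of y.
    set M := max (N + 2) (x.length + 2) with hM
    refine eq_zero_of_norm_sum_harmonicSum_le hK hNp hξ hS (le_max_left (N + 2) (x.length + 2)) _
      (C * ‖(1 : A)‖) fun n hnS ρ _ hnρ i₀ => ?_
    refine norm_sum_harmonicSum_smul_le hK hξ hh hD hu hn ⟨n, hnS⟩ ?_ (hfix _) hC i l hx
      ((le_max_right (N + 2) (x.length + 2)).trans (le_totient_prime_pow (by omega))) ih hnρ i₀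
    rintro rfl
    exact hS0 hnS

omit [IsUltrametricDist A] [CompleteSpace A] [NeZero N] in
theorem eq_X_of_forall_agreesUpTo {u : NCSeries (Letter N) A} (h1 : AgreesUpTo 1 u)
    (h : ∀ D, 1 ≤ D → AgreesUpTo D u → AgreesUpTo (D + 1) u) : u = X (some 0) := by
  have (D : ℕ) : AgreesUpTo (D + 1) u := by
    induction D with
    | zero => exact h1
    | succ D ih => exact h _ (by omega) ih
  ext w
  exact this (depth w) w (by omega)

end HarmonicFree

/-! ### Freeness on the independence set -/

section Independence

variable {N : ℕ} [NeZero N] {A : Type*} [NormedCommRing A] [IsUltrametricDist A] [CompleteSpace A]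

omit [NeZero N] in
theorem tendsto_rot_replicate {u : NCSeries (Letter N) A} (hn : IsNull u) (j : ZMod N)
    (w : Word N) : Tendsto (fun k : ℕ => rot j u (List.replicate k none ++ w)) atTop (𝓝 0) := by
  rw [← Nat.cofinite_eq_atTop]
  exact ((hn.rot j).hasSum w).tendsto_cofinite_zero

omit [NeZero N] in
-- By homogeneity, up to a power of n the sum is a rigid analytic function of n, as in the
-- definition of `IndepSet`.
theorem zeroSum_rot_tau {u : NCSeries (Letter N) A} (hn : IsNull u) (n : ℕ) (j : ZMod N)
    {w : Word N} (hw : w ≠ []) : zeroSum (rot j (tau n u)) w =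
      (n : A) ^ (w.length - 1) * ∑' k, rot j u (List.replicate k none ++ w) * (n : A) ^ k := by
  have h1 := ((hn.tau n).rot j).hasSum w
  have hw0 := List.length_pos_iff.2 hw
  rw [zeroSum, ← Summable.tsum_mul_left]
  · refine tsum_congr fun k => ?_
    rw [rot_tau, tau_apply, mul_left_comm, ← pow_add, mul_comm]
    congr 2
    simp; omega
  · refine NonarchimedeanAddGroup.summable_of_tendsto_cofinite_zero ?_
    rw [Nat.cofinite_eq_atTop]
    refine squeeze_zero_norm (fun k => ?_) (tendsto_zero_iff_norm_tendsto_zero.1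
      (tendsto_rot_replicate hn j w))
    rw [mul_comm]
    exact norm_natCast_pow_mul_le _ _ _

theorem AgreesUpTo.succ_of_fix_indepSet (hA : ∀ n : ℕ, n ≠ 0 → IsUnit (n : A)) {S : Set ℕ}
    (hS0 : 0 ∉ S) {h : S → HarSpace N A} (hh : h ∈ IndepSet N A S) {D : ℕ} (hD : 1 ≤ D)
    {u : NCSeries (Letter N) A} (hu : AgreesUpTo D u) (hn : IsNull u) (hprim : IsPrimitive u)
    (hfix : ∀ n : S, harLim (HarmonicIhara.tau n u) (h n).val = (h n).val) :
    AgreesUpTo (D + 1) u := by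
  refine hu.succ hA hprim hD fun r i l x hx => ?_
  have key := hh (fun j k => rot j u (List.replicate k none ++ (some i :: x ++ [some l])))
    (fun j => tendsto_rot_replicate hn j _) (fun n => ?_) 0 r
  · simpa using key
  · have hn0 : (n : ℕ) ≠ 0 := fun h0 => hS0 (h0 ▸ n.2)
    have h1 := sum_zeroSum_mul_eq_zero hD (hu.tau n) (hn.tau n) (h n).tail (hfix n) i l x hx
    simp only [zeroSum_rot_tau hn n _ (w := some i :: x ++ [some l]) (by simp), mul_assoc,
      ← Finset.mul_sum] at h1
    exact ((hA n hn0).pow _).mul_right_eq_zero.1 h1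

theorem harLim_apply_singleton {U f : NCSeries (Letter N) A} (hU : AgreesUpTo 1 U) (hn : IsNull U)
    (hf : f.tail none = f) (i : ZMod N) : harLim U f [some i] = f [some i] := by
  refine tendsto_nhds_unique (tendsto_harLim hU hn hf [some i])
    (tendsto_const_nhds.congr fun l => ?_)
  rw [ihara_apply_of_agreesUpTo le_rfl hU _ (by simp), apply_replicate_append hf]

end Independence

/-! ### Zeros of convergent power series, and the case N = 1. -/

section PowerSeries

variable {K : Type*} [NormedField K] {A : Type*} [NormedCommRing A] [IsUltrametricDist A]
  [CompleteSpace A] [NormedAlgebra K A]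

/-- A power series, convergent on the unit disc, that vanishes on a sequence of non-zero points
tending to zero is zero. -/
theorem eq_zero_of_tsum_eq_zero {a : ℕ → A} (ha : Tendsto a atTop (𝓝 0)) {t : ℕ → K}
    (ht : Tendsto t atTop (𝓝 0)) (ht0 : ∀ i, t i ≠ 0)
    (h : ∀ i, ∑' k, t i ^ k • a k = 0) (k : ℕ) : a k = 0 := by
  induction k using Nat.strong_induction_on with
  | _ k ih =>
    obtain ⟨B, hB⟩ := ha.norm.bddAbove_range
    have hB (m : ℕ) : ‖a m‖ ≤ B := hB ⟨m, rfl⟩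
    have hB0 : 0 ≤ B := (norm_nonneg _).trans (hB 0)
    have ht' := tendsto_zero_iff_norm_tendsto_zero.1 ht
    -- Once the lower coefficients vanish, dividing the relation by t^k gives ‖a_k‖ ≤ ‖t‖ B; then t
    -- tends to 0.
    rw [← norm_le_zero_iff, ← zero_mul B]
    refine ge_of_tendsto (ht'.mul_const B) ?_
    filter_upwards [ht'.eventually_le_const one_pos] with i hi
    have hsum : Summable fun m => t i ^ m • a m := by
      refine NonarchimedeanAddGroup.summable_of_tendsto_cofinite_zero ?_
      rw [Nat.cofinite_eq_atTop]
      refine squeeze_zero_norm (fun m => ?_) (tendsto_zero_iff_norm_tendsto_zero.1 ha)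
      rw [norm_smul, norm_pow]
      exact mul_le_of_le_one_left (norm_nonneg _) (pow_le_one₀ (norm_nonneg _) hi)
    have h1 := h i
    rw [hsum.tsum_eq_add_tsum_ite k, add_eq_zero_iff_eq_neg] at h1
    have h2 : ‖t i ^ k • a k‖ ≤ ‖t i‖ ^ (k + 1) * B := by
      rw [h1, norm_neg]
      refine IsUltrametricDist.norm_tsum_le_of_forall_le_of_nonneg (by positivity) fun m => ?_
      split_ifs with hm
      · rw [norm_zero]; positivity
      rcases lt_or_gt_of_ne hm with hm | hm
      · rw [ih m hm, smul_zero, norm_zero]; positivity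
      · rw [norm_smul, norm_pow]
        exact mul_le_mul (pow_le_pow_of_le_one (norm_nonneg _) hi hm) (hB m) (norm_nonneg _)
          (by positivity)
    rw [norm_smul, norm_pow, pow_succ, mul_assoc] at h2
    exact le_of_mul_le_mul_left h2 (pow_pos (norm_pos_iff.2 (ht0 i)) k)

theorem tendsto_natCast {p : ℕ} [hp : Fact p.Prime] (hK : ‖(p : K)‖ = (p : ℝ)⁻¹)
    [IsUltrametricDist K] {a : ℕ → ℕ}
    (ha : Tendsto (fun i => (a i : ℤ_[p])) atTop (𝓝 0)) :
    Tendsto (fun i => (a i : K)) atTop (𝓝 0) := by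
  rw [tendsto_zero_iff_norm_tendsto_zero] at ha ⊢
  refine ha.congr fun i => ?_
  by_cases h : a i = 0
  · simp [h]
  · rw [norm_natCast_eq hK h, PadicInt.norm_def, PadicInt.coe_natCast,
      norm_natCast_eq Padic.norm_p h]

/-- A non-zero integer divisible by p^B is at least p^B > B. -/
theorem unbounded_of_tendsto {p : ℕ} [hp : Fact p.Prime] {S : Set ℕ} (hS0 : 0 ∉ S) {a : ℕ → ℕ}
    (haS : ∀ i, a i ∈ S) (ha : Tendsto (fun i => (a i : ℤ_[p])) atTop (𝓝 0)) (B : ℕ) :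
    ∃ n ∈ S, B ≤ n := by
  have hp0 : (0 : ℝ) < p := by exact_mod_cast hp.out.pos
  obtain ⟨i, hi⟩ := ((tendsto_zero_iff_norm_tendsto_zero.1 ha).eventually_lt_const
    (show (0 : ℝ) < ((p : ℝ) ^ B)⁻¹ by positivity)).exists
  have hai : a i ≠ 0 := fun h0 => hS0 (h0 ▸ haS i)
  refine ⟨a i, haS i, ?_⟩
  rw [PadicInt.norm_def, PadicInt.coe_natCast, norm_natCast_eq Padic.norm_p hai,
    inv_lt_inv₀ (by positivity) (by positivity)] at hi
  have h1 : p ^ B < p ^ padicValNat p (a i) := by exact_mod_cast hi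
  have h2 := Nat.le_of_dvd (Nat.pos_of_ne_zero hai) (pow_padicValNat_dvd (p := p) (n := a i))
  have h3 : B < p ^ B := Nat.lt_pow_self hp.out.one_lt
  omega

/-- For N = 1 the only function n ↦ h_n[e_1] is the constant 1, so independence amounts to the
identity principle for power series near 0. -/
theorem IsHarmonicSequence.mem_indepSet {p : ℕ} [hp : Fact p.Prime] [IsUltrametricDist K]
    (hK : ‖(p : K)‖ = (p : ℝ)⁻¹) {ξ : K} (hξ : IsPrimitiveRoot ξ 1) {S : Set ℕ} (hS0 : 0 ∉ S)
    {t : ℕ → ℕ} (htS : ∀ i, t i ∈ S) (ht : Tendsto (fun i => (t i : ℤ_[p])) atTop (𝓝 0))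
    {h : S → HarSpace 1 A} (hh : IsHarmonicSequence ξ h) : h ∈ IndepSet 1 A S := by
  have := charZero_of_norm hK
  obtain rfl : ξ = 1 := by simpa using hξ
  intro a ha H i
  obtain rfl := Subsingleton.elim i 0
  refine eq_zero_of_tsum_eq_zero (ha 0) (tendsto_natCast hK ht)
    (fun i => Nat.cast_ne_zero.2 fun h0 => hS0 (h0 ▸ htS i)) fun i => ?_
  have h1 := H ⟨t i, htS i⟩
  rw [Fintype.sum_subsingleton _ 0, hh.apply_singleton] at h1
  rw [← (show _ = (0 : A) by simpa using h1)]
  exact tsum_congr fun k => by rw [Algebra.smul_def, map_pow, map_natCast, mul_comm]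

end PowerSeries

/-! ### Existence of the harmonic sequences -/

section Existence

variable {N : ℕ}

/-- The concatenation of the words `e_0 ^ a e_{z_j}`. -/
def blocks (L : List (ℕ × ZMod N)) : Word N :=
  (L.map fun q => List.replicate q.1 none ++ [some q.2]).flatten

theorem replicate_append_some_inj {a b : ℕ} {i j : ZMod N} {v w : Word N}
    (h : List.replicate a none ++ some i :: v = List.replicate b none ++ some j :: w) :
    a = b ∧ i = j ∧ v = w := by
  induction a generalizing b with
  | zero =>
    cases b with
    | zero => simpa using h
    | succ b => simp [List.replicate_succ] at h
  | succ a ih =>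
    cases b with
    | zero => simp [List.replicate_succ] at h
    | succ b =>
      simp only [List.replicate_succ, List.cons_append, List.cons.injEq, true_and] at h
      obtain ⟨h1, h2⟩ := ih h
      exact ⟨congrArg _ h1, h2⟩

theorem blocks_cons (q : ℕ × ZMod N) (L : List (ℕ × ZMod N)) :
    blocks (q :: L) = List.replicate q.1 none ++ some q.2 :: blocks L := by
  simp [blocks]

theorem blocks_injective : Function.Injective (blocks (N := N)) := by
  intro L L' h
  induction L generalizing L' with
  | nil =>
    cases L' with
    | nil => rfl
    | cons q L' => rw [blocks_cons] at h; simp [blocks] at h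
  | cons q L ih =>
    cases L' with
    | nil => rw [blocks_cons] at h; simp [blocks] at h
    | cons q' L' =>
      rw [blocks_cons, blocks_cons] at h
      obtain ⟨h1, h2, h3⟩ := replicate_append_some_inj h
      rw [ih h3, Prod.ext h1 h2]

theorem harmonicWord_eq {d : ℕ} (j : Fin (d + 1) → ZMod N) (s : Fin d → ℕ) :
    harmonicWord j s = some (j (Fin.last d)) ::
      blocks (List.ofFn fun i : Fin d => (s i.rev - 1, j i.rev.castSucc)) := by
  simp [harmonicWord, blocks, Function.comp_def]

/-- The exponents must be at least 1 because the words involve the truncated difference s - 1. -/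
theorem harmonicWord_inj {d d' : ℕ} {j : Fin (d + 1) → ZMod N} {s : Fin d → ℕ}
    {j' : Fin (d' + 1) → ZMod N} {s' : Fin d' → ℕ} (hs : ∀ i, 1 ≤ s i) (hs' : ∀ i, 1 ≤ s' i)
    (h : harmonicWord j s = harmonicWord j' s') :
    (⟨d, j, s⟩ : Σ d : ℕ, (Fin (d + 1) → ZMod N) × (Fin d → ℕ)) = ⟨d', j', s'⟩ := by
  rw [harmonicWord_eq, harmonicWord_eq, List.cons.injEq, Option.some.injEq] at h
  obtain ⟨h0, h⟩ := h
  have h := blocks_injective h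
  obtain rfl : d = d' := by simpa using congrArg List.length h
  have h1 (i : Fin d) := congrFun (List.ofFn_injective h) i.rev
  simp only [Fin.rev_rev, Prod.mk.injEq] at h1
  have e1 : j = j' := funext fun i => Fin.lastCases h0 (fun i => (h1 i).2) i
  have e2 : s = s' := funext fun i => by have := (h1 i).1; have := hs i; have := hs' i; omega
  rw [e1, e2]

theorem exists_isHarmonicSequence {K A : Type*} [Field K] [CommRing A] [Algebra K A] (ξ : K)
    (S : Set ℕ) : ∃ h : S → HarSpace N A, IsHarmonicSequence ξ h := by
  classical
  let P (v : Word N) (q : Σ d : ℕ, (Fin (d + 1) → ZMod N) × (Fin d → ℕ)) : Prop :=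
    (∀ i, 1 ≤ q.2.2 i) ∧ harmonicWord q.2.1 q.2.2 = v
  let F (n : ℕ) (v : Word N) : A := if hv : ∃ q, P v q then
    algebraMap K A (har ξ n hv.choose.2.1 hv.choose.2.2) else 0
  -- Deleting the leading e_0's before evaluating makes the series independent of them; words
  -- indexing no harmonic sum get the value 0.
  refine ⟨fun n => ⟨fun w => F n (w.dropWhile Option.isNone), fun l w => congrArg (F n) ?_⟩, ?_⟩
  · induction l with
    | zero => rfl
    | succ l ih => rw [← ih]; rfl
  · intro n d j s hs
    have hw : ∃ q, P (harmonicWord j s) q := ⟨⟨d, j, s⟩, hs, rfl⟩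
    have hq : hw.choose = ⟨d, j, s⟩ := harmonicWord_inj hw.choose_spec.1 hs hw.choose_spec.2
    change F n (harmonicWord j s) = _
    simp only [F, dif_pos hw]
    rw [hq]

end Existence

/-! ### Orbits with trivial stabilizers -/

section Torsor

variable {G : Type*} [Group G] {X : Type*} [MulAction G X]

theorem isStable_orbit (x : X) : IsStable G (MulAction.orbit G x) := fun g _ hy =>
  MulAction.mem_orbit_of_mem_orbit g hy

theorem isFreeOn_orbit {x : X} (hx : ∀ g : G, g • x = x → g = 1) :
    IsFreeOn G (MulAction.orbit G x) := by
  rintro _ ⟨k, rfl⟩ g hg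
  have h : (k⁻¹ * g * k) • x = x := by
    rw [mul_smul, mul_smul, inv_smul_eq_iff]
    exact hg
  have h1 := hx _ h
  rw [mul_assoc, inv_mul_eq_one] at h1
  simpa using h1.symm

theorem isTorsor_orbit {x : X} (hx : ∀ g : G, g • x = x → g = 1) :
    IsTorsor G (MulAction.orbit G x) := by
  refine ⟨MulAction.nonempty_orbit x, isStable_orbit x, fun y hy z hz => ?_⟩
  obtain ⟨g, rfl⟩ := MulAction.mem_orbit_iff.1
    (show z ∈ MulAction.orbit G y from (MulAction.orbit_eq_iff.2 hy).symm ▸ hz)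
  refine ⟨g, rfl, fun k hk => ?_⟩
  have h := isFreeOn_orbit hx y hy (g⁻¹ * k) (by rw [mul_smul, inv_smul_eq_iff]; exact hk)
  exact (inv_mul_eq_one.1 h).symm

end Torsor

section Main

variable {N : ℕ} [NeZero N] {A : Type*} [NormedCommRing A] [IsUltrametricDist A] [CompleteSpace A]
  (hA : ∀ n : ℕ, n ≠ 0 → IsUnit (n : A)) {S : Set ℕ}

include hA

/-- The action does not change the coefficients at the words of one letter, on which alone
independence depends. -/
theorem isStable_indepSet :
    letI := adGroupGroup (N := N) hA
    letI := harAction (N := N) hA S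
    IsStable (AdGroup N A) (IndepSet N A S) := by
  intro u h hh a ha H
  refine hh a ha fun n => ?_
  rw [← H n]
  refine Finset.sum_congr rfl fun i _ => ?_
  congr 1
  exact (harLim_apply_singleton ((AdGroup.isAd hA u).agrees.tau n)
    ((AdGroup.isAd hA u).isNull.tau n) (h n).tail i).symm

omit hA [CompleteSpace A] in
theorem eq_one_of_forall_agreesUpTo (hA : ∀ n : ℕ, n ≠ 0 → IsUnit (n : A)) {u : AdGroup N A}
    (h : ∀ D, 1 ≤ D → AgreesUpTo D (show NCSeries (Letter N) A from u.val) →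
      AgreesUpTo (D + 1) (show NCSeries (Letter N) A from u.val)) :
    letI := adGroupGroup (N := N) hA
    u = 1 :=
  Subtype.ext (eq_X_of_forall_agreesUpTo (AdGroup.isAd hA u).agrees h)

theorem harLim_eq_of_smul_eq {u : AdGroup N A} {h : S → HarSpace N A}
    (hu : letI := adGroupGroup (N := N) hA
      letI := harAction (N := N) hA S
      u • h = h) (n : S) : harLim (tau n u.val) (h n).val = (h n).val :=
  congrArg Subtype.val (congrFun hu n)

theorem isFreeOn_indepSet (hS0 : 0 ∉ S) :
    letI := adGroupGroup (N := N) hA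
    letI := harAction (N := N) hA S
    IsFreeOn (AdGroup N A) (IndepSet N A S) := by
  intro h hh u hu
  exact eq_one_of_forall_agreesUpTo hA fun D hD h1 => h1.succ_of_fix_indepSet hA hS0 hh hD
    (AdGroup.isAd hA u).isNull (AdGroup.isAd hA u).isPrimitive (harLim_eq_of_smul_eq hA hu)

theorem IsHarmonicSequence.eq_one_of_smul_eq {p : ℕ} [Fact p.Prime] {K : Type*} [NormedField K]
    [IsUltrametricDist K] [NormedAlgebra K A] (hK : ‖(p : K)‖ = (p : ℝ)⁻¹) (hNp : N.Coprime p)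
    {ξ : K} (hξ : IsPrimitiveRoot ξ N) (hS : ∀ B, ∃ n ∈ S, B ≤ n) (hS0 : 0 ∉ S)
    {h : S → HarSpace N A} (hh : IsHarmonicSequence ξ h) :
    letI := adGroupGroup (N := N) hA
    letI := harAction (N := N) hA S
    ∀ u : AdGroup N A, u • h = h → u = 1 := by
  intro u hu
  exact eq_one_of_forall_agreesUpTo hA fun D hD h1 => h1.succ_of_fix_harmonicSequence hA hK hNp hξ
    hS hS0 hh hD (AdGroup.isAd hA u).isNull (AdGroup.isAd hA u).isPrimitive
    (harLim_eq_of_smul_eq hA hu)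

omit hA [IsUltrametricDist A] [CompleteSpace A] in
theorem isUnit_natCast (K : Type*) [NormedField K] [CharZero K] [NormedAlgebra K A] (n : ℕ)
    (hn : n ≠ 0) : IsUnit (n : A) := by
  rw [← map_natCast (algebraMap K A)]
  exact (IsUnit.mk0 (n : K) (by exact_mod_cast hn)).map _

end Main

end HarmonicIhara

theorem mainTheorem4
    (p : ℕ) [Fact p.Prime]
    (k : Type*) [Field k] [Finite k] [CharP k p]
    (N : ℕ) [NeZero N] (hN : N = 1 ∨ N.Prime) (hNp : N.Coprime p)
    (hk : ∃ ζ : k, IsPrimitiveRoot ζ N)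
    -- `K` is the fraction field of the Witt vectors of `k`, with its `p`-adic absolute value
    (K : Type*) [NormedField K] [IsUltrametricDist K] [CompleteSpace K]
    [Algebra (WittVector p k) K] [IsFractionRing (WittVector p k) K]
    (hball : ∀ x : K, ‖x‖ ≤ 1 ↔ x ∈ Set.range (algebraMap (WittVector p k) K))
    (hnorm : ‖(p : K)‖ = (p : ℝ)⁻¹)
    (ξ : K) (hξ : IsPrimitiveRoot ξ N) :
    -- (i)
    (∀ (A : Type*) [NormedCommRing A] [IsUltrametricDist A] [CompleteSpace A] [NormedAlgebra K A]
      (S : Set ℕ), 0 ∉ S →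
      (∃ a : ℕ → ℕ, (∀ i, a i ∈ S) ∧ Tendsto (fun i => (a i : ℤ_[p])) atTop (𝓝 0)) →
      ∃ (_ : Group (AdGroup N A)) (_ : MulAction (AdGroup N A) (S → HarSpace N A)),
        IsHarmonicIharaAction N A S ∧
        IsStable (AdGroup N A) (IndepSet N A S) ∧
        IsFreeOn (AdGroup N A) (IndepSet N A S) ∧
        (∃ h : S → HarSpace N A, IsHarmonicSequence ξ h) ∧
        (N = 1 → ∀ h : S → HarSpace N A, IsHarmonicSequence ξ h → h ∈ IndepSet N A S) ∧
        (∃ E : Set (S → HarSpace N A), IndepSet N A S ⊆ E ∧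
          (∀ h : S → HarSpace N A, IsHarmonicSequence ξ h → h ∈ E) ∧
          IsStable (AdGroup N A) E ∧ IsFreeOn (AdGroup N A) E) ∧
        (∀ h : S → HarSpace N A, IsHarmonicSequence ξ h →
          IsTorsor (AdGroup N A) (MulAction.orbit (AdGroup N A) h))) ∧
    -- (ii)
    (∃ (_ : Group (AdGroup N K))
        (_ : MulAction (AdGroup N K)
          ((Set.range fun a : ℕ => Nat.card k ^ a : Set ℕ) → HarSpace N K)),
      IsHarmonicIharaAction N K (Set.range fun a : ℕ => Nat.card k ^ a) ∧
      (∃ h : (Set.range fun a : ℕ => Nat.card k ^ a : Set ℕ) → HarSpace N K,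
        IsHarmonicSequence ξ h) ∧
      ∀ h : (Set.range fun a : ℕ => Nat.card k ^ a : Set ℕ) → HarSpace N K,
        IsHarmonicSequence ξ h →
          IsTorsor (AdGroup N K) (MulAction.orbit (AdGroup N K) h)) := by
  have := charZero_of_norm hnorm
  refine ⟨fun A _ _ _ _ S hS0 ⟨t, htS, ht⟩ => ?_, ?_⟩
  · have hA : ∀ n : ℕ, n ≠ 0 → IsUnit (n : A) := isUnit_natCast K
    let _ := adGroupGroup (N := N) hA
    let _ := harAction (N := N) hA S
    have hfree (h : S → HarSpace N A) (hh : IsHarmonicSequence ξ h) :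
        ∀ u : AdGroup N A, u • h = h → u = 1 :=
      hh.eq_one_of_smul_eq hA hnorm hNp hξ (unbounded_of_tendsto hS0 htS ht) hS0
    refine ⟨_, _, isHarmonicIharaAction hA S, isStable_indepSet hA, isFreeOn_indepSet hA hS0,
      -- The required stable set is the union of the independence set with the orbits of all
      -- harmonic sequences; trivial stabilizers are inherited along orbits by conjugation.
      exists_isHarmonicSequence ξ S, ?_, ⟨IndepSet N A S ∪
        ⋃ h ∈ {h : S → HarSpace N A | IsHarmonicSequence ξ h}, MulAction.orbit (AdGroup N A) h,
        Set.subset_union_left, fun h hh => ?_, ?_, ?_⟩, fun h hh => isTorsor_orbit (hfree h hh)⟩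
    · rintro rfl h hh
      exact hh.mem_indepSet hnorm hξ hS0 htS ht
    · exact .inr (Set.mem_biUnion hh (MulAction.mem_orbit_self h))
    · rintro u x (hx | hx)
      · exact .inl (isStable_indepSet hA u x hx)
      · obtain ⟨h, hh, hx⟩ := Set.mem_iUnion₂.1 hx
        exact .inr (Set.mem_biUnion hh (isStable_orbit h u x hx))
    · rintro x (hx | hx) u hu
      · exact isFreeOn_indepSet hA hS0 x hx u hu
      · obtain ⟨h, hh, hx⟩ := Set.mem_iUnion₂.1 hx
        exact isFreeOn_orbit (hfree h hh) x hx u hu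
  · have hA : ∀ n : ℕ, n ≠ 0 → IsUnit (n : K) := isUnit_natCast K
    let _ := adGroupGroup (N := N) hA
    let _ := harAction (N := N) hA (Set.range fun a : ℕ => Nat.card k ^ a)
    have hcard : 1 < Nat.card k := Finite.one_lt_card
    -- Freeness at harmonic sequences needs only that S is unbounded, which is immediate for the
    -- powers of q.
    have hS (B : ℕ) : ∃ n ∈ Set.range fun a : ℕ => Nat.card k ^ a, B ≤ n :=
      ⟨_, ⟨B, rfl⟩, (Nat.lt_pow_self hcard).le⟩
    have hS0 : 0 ∉ Set.range fun a : ℕ => Nat.card k ^ a := by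
      rintro ⟨a, ha⟩
      exact (pow_pos (by omega : 0 < Nat.card k) a).ne' ha
    exact ⟨_, _, isHarmonicIharaAction hA _, exists_isHarmonicSequence ξ _, fun h hh =>
      isTorsor_orbit (hh.eq_one_of_smul_eq hA hnorm hNp hξ hS hS0)⟩
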